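/- **Setting.** Let $f_1,\dots,f_N:\mathbb R^d\to\mathbb R$ ($N\ge 1$) be differentiable and $\beta$-smooth ($\|\nabla f_i(x)-\nabla f_i(y)\|\le\beta\|x-y\|$, $\beta>0$), and let $f=\frac1N\sum_i f_i$. Client $i$ has stochastic gradients $g_i(x)=g_i(x;\xi)$, $\xi\sim\mathcal D_i$, which are unbiased, $\mathbb E\,g_i(x)=\nabla f_i(x)$, and have variance $\mathbb E\|g_i(x)-\nabla f_i(x)\|^2\le\sigma^2$ for all $x$; all samples that are used (over rounds, clients and local steps) are independent. Let $p\in\{0,1\}^d$ be a mask, $\odot$ the entrywise product, and $K\ge 1$ the number of local steps. **Algorithm (FedPVR).** Given a starting point $x^0$, initial control variates $c_i^0$ and $c^0=\frac1N\sum_i c_i^0$, round $r=1,2,\dots$ computes, for every client $i$, $y_{i,0}^r=x^{r-1}$ and $$y_{i,k}^r=y_{i,k-1}^r-\eta_l\bigl(g_i(y_{i,k-1}^r)-c_i^{r-1}+c^{r-1}\bigr)\quad(1\le k\le K),\qquad c_i^r=c_i^{r-1}-c^{r-1}+\tfrac1{K\eta_l}\,p\odot(x^{r-1}-y_{i,K}^r),$$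 and then $x^r=x^{r-1}+\frac{\eta_g}{N}\sum_i(y_{i,K}^r-x^{r-1})$ and $c^r=\frac1N\sum_i c_i^r$. *Warm start* means that $c_i^0=\frac1K\sum_{k=1}^K p\odot g_i(x^0)$ is the average of $K$ independent masked stochastic gradients at $x^0$; *zero start* means $c_i^0=0$. The output $\bar x^R$ is one of $x^0,\dots,x^R$, picked independently of the run, $x^r$ with probability proportional to $w_r$. Put $\tilde\eta=K\eta_l\eta_g$. **Theorem.** Let $\eta_g=\sqrt N$. There is an absolute constant $C>0$ such that the following holds for every $\varepsilon>0$. 1. *Strongly convex.* Let $\mu>0$, let every $f_i$ be $\mu$-convex, $\langle\nabla f_i(x),y-x\rangle\le-\bigl(f_i(x)-f_i(y)+\frac\mu2\|x-y\|^2\bigr)$ for all $x,y$, let $x^*$ minimise $f$, and put $D=\|x^0-x^*\|^2$, $\zeta_{1-p}^2=\frac1N\sum_i\|(1-p)\odot\nabla f_i(x^*)\|^2$, $\zeta^2=\frac1N\sum_i\|\nabla f_i(x^*)\|^2$, $w_r=(1-\frac{\mu\tilde\eta}{2})^{-(r+1)}$. With warm start, there is $0<\eta_l\le\min\bigl(\frac1{80K\eta_g\beta},\frac{26}{20\mu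 K\eta_g}\bigr)$ such that $\mathbb E[f(\bar x^R)]-f(x^*)<\varepsilon$ for every integer $$R\ge\Bigl\lfloor C\Bigl(\frac{\sigma^2}{\mu NK\varepsilon}+\frac{\zeta_{1-p}^2}{\mu\varepsilon}+\frac\beta\mu\Bigr)\Lambda\Bigr\rfloor,\qquad \Lambda=\log\Bigl(2+\frac{\mu D}{\varepsilon}\Bigr).$$ With zero start the same holds with $\Lambda=\log\bigl(2+\frac{\mu(D+\zeta^2/\beta^2)}{\varepsilon}\bigr)$. Thus $R=\tilde{\mathcal O}\bigl(\frac{\sigma^2}{\mu NK\varepsilon}+\frac{\zeta_{1-p}^2}{\mu\varepsilon}+\frac\beta\mu\bigr)$ rounds suffice. 2. *General convex.* Let every $f_i$ be convex (the above with $\mu=0$), let $x^*$ minimise $f$, let $D$, $\zeta_{1-p}^2$ be as above and $F=f(x^0)-f(x^*)$. With warm start and $w_r=1$, there is $0<\eta_l\le\frac1{80K\eta_g\beta}$ such that $\mathbb E[f(\bar x^R)]-f(x^*)<\varepsilon$ for every integer $$R\ge\Bigl\lfloor C\Bigl(\frac{\sigma^2D}{KN\varepsilon^2}+\frac{\zeta_{1-p}^2D}{\varepsilon^2}+\frac{\beta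 D}{\varepsilon}+F\Bigr)\Bigr\rfloor .$$ 3. *Non-convex.* Let $f$ be bounded below, $f^*=\inf f$, $F=f(x^0)-f^*$, and let $\hat\zeta_{1-p}$ be such that $\frac1N\sum_i\|(1-p)\odot\nabla f_i(x)\|^2\le\hat\zeta_{1-p}^2$ for all $x$. With warm start and $w_r=1$, there is $0<\eta_l\le\frac1{26K\eta_g\beta}$ such that $\mathbb E\|\nabla f(\bar x^R)\|^2<\varepsilon$ for every integer $$R\ge\Bigl\lfloor C\Bigl(\frac{\beta\sigma^2F}{KN\varepsilon^2}+\frac{\beta\hat\zeta_{1-p}^2F}{N\varepsilon^2}+\frac{\beta F}{\varepsilon}\Bigr)\Bigr\rfloor .$$ Outside the logarithm of the zero-start case, only the heterogeneity of the block of weights that is not variance reduced enters these bounds. -/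

import Mathlib

open MeasureTheory ProbabilityTheory

noncomputable section

namespace FedPVR

/-- The parameter space `ℝ^d` with its Euclidean norm. -/
abbrev Vec (d : ℕ) := EuclideanSpace ℝ (Fin d)

/-- `mask q v` keeps the coordinates of `v` in the block `q` and sets the others to zero.
For a binary vector `p` with support `q` this is `p ⊙ v`, and `mask qᶜ v` is `(1 - p) ⊙ v`. -/
def mask {d : ℕ} (q : Finset (Fin d)) (v : Vec d) : Vec d :=
  WithLp.toLp 2 (fun j => if j ∈ q then v j else 0)

/-! ### Objective functions -/

/-- The global objective `f = (1/N) ∑ᵢ fᵢ`. -/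
def objective {d N : ℕ} (f : Fin N → Vec d → ℝ) (x : Vec d) : ℝ :=
  (1 / (N : ℝ)) * ∑ i, f i x

/-- `β`-smoothness: `h` is differentiable and its gradient is `β`-Lipschitz. -/
def IsSmooth {d : ℕ} (β : ℝ) (h : Vec d → ℝ) : Prop :=
  Differentiable ℝ h ∧ ∀ x y, ‖gradient h x - gradient h y‖ ≤ β * ‖x - y‖

/-- `μ`-convexity (first-order form); `μ = 0` is convexity. -/
def IsMuConvex {d : ℕ} (μ : ℝ) (h : Vec d → ℝ) : Prop :=
  ∀ x y, inner ℝ (gradient h x) (y - x) ≤ -(h x - h y + μ / 2 * ‖x - y‖ ^ 2)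

/-- Gradient heterogeneity of the block `q` of coordinates at `x`:
`(1/N) ∑ᵢ ‖mask q (∇fᵢ(x))‖²`. -/
def heterogeneity {d N : ℕ} (q : Finset (Fin d)) (f : Fin N → Vec d → ℝ) (x : Vec d) : ℝ :=
  (1 / (N : ℝ)) * ∑ i, ‖mask q (gradient (f i) x)‖ ^ 2

/-! ### Stochastic gradients -/

/-- `g x s` is the stochastic gradient of `h` at `x` computed from the sample `s`; for `s` drawn
from `D` it is unbiased and its variance is at most `σ²`. -/
structure IsStochasticGradient {d : ℕ} {S : Type*} [MeasurableSpace S] (D : Measure S)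
    (h : Vec d → ℝ) (g : Vec d → S → Vec d) (σ : ℝ) : Prop where
  measurable : Measurable (fun z : Vec d × S => g z.1 z.2)
  memLp : ∀ x, MemLp (g x) 2 D
  unbiased : ∀ x, ∫ s, g x s ∂D = gradient h x
  variance_le : ∀ x, ∫ s, ‖g x s - gradient h x‖ ^ 2 ∂D ≤ σ ^ 2

/-- The samples `ξ r i k` (round `r`, client `i`, local step `k`) are independent random
variables, and those of client `i` have law `D i`. -/
structure IsSampling {N : ℕ} {S Ω : Type*} [MeasurableSpace S] [MeasurableSpace Ω]
    (P : Measure Ω) (D : Fin N → Measure S) (ξ : ℕ → Fin N → ℕ → Ω → S) : Prop where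
  measurable : ∀ r i k, Measurable (ξ r i k)
  law : ∀ r i k, P.map (ξ r i k) = D i
  indep : iIndepFun (fun t : ℕ × Fin N × ℕ => ξ t.1 t.2.1 t.2.2) P

/-! ### The algorithm -/

/-- The server model, the server control variate and the client control variates.
Control variates are vectors of full length that vanish outside the variance-reduced block. -/
structure State (d N : ℕ) where
  x : Vec d
  c : Vec d
  ci : Fin N → Vec d

/-- The client model after `k` local steps from the server model `x`, with client control
variate `ci`, server control variate `c` and samples `s 0, s 1, …`. -/
def localModel {d : ℕ} {S : Type*} (g : Vec d → S → Vec d) (ηl : ℝ) (x ci c : Vec d)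
    (s : ℕ → S) : ℕ → Vec d
  | 0 => x
  | k + 1 => localModel g ηl x ci c s k -
      ηl • (g (localModel g ηl x ci c s k) (s k) - ci + c)

/-- One communication round; `p` is the variance-reduced block. -/
def commRound {d N : ℕ} {S : Type*} (g : Fin N → Vec d → S → Vec d) (p : Finset (Fin d)) (K : ℕ)
    (ηl ηg : ℝ) (s : Fin N → ℕ → S) (st : State d N) : State d N :=
  let y : Fin N → Vec d := fun i => localModel (g i) ηl st.x (st.ci i) st.c (s i) K
  let ci' : Fin N → Vec d := fun i =>
    st.ci i - st.c + (1 / ((K : ℝ) * ηl)) • mask p (st.x - y i)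
  { x := st.x + (ηg / (N : ℝ)) • ∑ i, (y i - st.x)
    c := (1 / (N : ℝ)) • ∑ i, ci' i
    ci := ci' }

/-- Initial state with all control variates equal to zero. -/
def zeroStart {d : ℕ} (N : ℕ) (x₀ : Vec d) : State d N := ⟨x₀, 0, fun _ => 0⟩

/-- Warm start: every client sets its control variate to the masked average of `K` stochastic
gradients at `x₀`, and the server variate is their mean; the server model is not moved. -/
def warmStart {d N : ℕ} {S : Type*} (g : Fin N → Vec d → S → Vec d) (p : Finset (Fin d)) (K : ℕ)
    (x₀ : Vec d) (s : Fin N → ℕ → S) : State d N :=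
  let ci : Fin N → Vec d := fun i =>
    (1 / (K : ℝ)) • ∑ k ∈ Finset.range K, mask p (g i x₀ (s i k))
  ⟨x₀, (1 / (N : ℝ)) • ∑ i, ci i, ci⟩

/-- The state after `r` rounds; round `r ≥ 1` uses the samples `s r`. -/
def run {d N : ℕ} {S : Type*} (g : Fin N → Vec d → S → Vec d) (p : Finset (Fin d)) (K : ℕ)
    (ηl ηg : ℝ) (s : ℕ → Fin N → ℕ → S) (init : State d N) : ℕ → State d N
  | 0 => init
  | r + 1 => commRound g p K ηl ηg (s (r + 1)) (run g p K ηl ηg s init r)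

/-- The random server model `x^r` for zero initial control variates. -/
def zeroIterate {d N : ℕ} {S Ω : Type*} (g : Fin N → Vec d → S → Vec d) (p : Finset (Fin d))
    (K : ℕ) (ηl ηg : ℝ) (ξ : ℕ → Fin N → ℕ → Ω → S) (x₀ : Vec d) (r : ℕ) (ω : Ω) : Vec d :=
  (run g p K ηl ηg (fun r i k => ξ r i k ω) (zeroStart N x₀) r).x

/-- The random server model `x^r` for warm-started control variates; the warm start uses the
samples with round index `0`. -/
def warmIterate {d N : ℕ} {S Ω : Type*} (g : Fin N → Vec d → S → Vec d) (p : Finset (Fin d))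
    (K : ℕ) (ηl ηg : ℝ) (ξ : ℕ → Fin N → ℕ → Ω → S) (x₀ : Vec d) (r : ℕ) (ω : Ω) : Vec d :=
  (run g p K ηl ηg (fun r i k => ξ r i k ω) (warmStart g p K x₀ (fun i k => ξ 0 i k ω)) r).x

/-- The law of the output after `R` rounds: one of `x^0, …, x^R`, picked independently of the
run, `x^r` being picked with probability `w r / ∑ w`. -/
def outputLaw {d : ℕ} {Ω : Type*} [MeasurableSpace Ω] (P : Measure Ω) (x : ℕ → Ω → Vec d)
    (w : ℕ → ℝ) (R : ℕ) : Measure (Vec d) :=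
  ∑ r ∈ Finset.range (R + 1),
    ENNReal.ofReal (w r / ∑ t ∈ Finset.range (R + 1), w t) • P.map (x r)

/-- Under the law `ν`, the error `e` is integrable with expectation smaller than `ε`. -/
def ExpectedErrorLT {d : ℕ} (ν : Measure (Vec d)) (e : Vec d → ℝ) (ε : ℝ) : Prop :=
  Integrable e ν ∧ ∫ x, e x ∂ν < ε

end FedPVR

end

noncomputable section

set_option linter.unusedSectionVars false

namespace FedPVR

/-! ### Smooth and convex functions -/

section Smooth

variable {d : ℕ} {β μ : ℝ} {h : Vec d → ℝ}

/-! Put t = K η_l η_g with η_g = √N. Two algebraic facts reduce the algorithm to a simple form. The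
corrections c_i - c sum to zero over the clients, so the server moves by -t times the average of all
N K local stochastic gradients (`IsState.commRound_x`). The correction also cancels in the update of
c_i, so the new c_i is the masked average of the K stochastic gradients that client i has just used
(`IsState.commRound_ci`). A control variate therefore forgets its predecessor; it misses its
reference, a masked gradient, only by the drift of the local models, the distance between the
gradients at x and the reference gradients, and averaged noise of size σ²/K
(`IsRound.controlError_clientDirection_le`).

The drift is of order (K η_l)² (V + σ²/K), where V is the mean square of the first local direction
∇f_i(x) - c_i + c (`IsRound.drift_le`). In this direction the control variates remove the
heterogeneity of the masked block up to their own error. What is left is that error, the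
heterogeneity of the complementary block, and the suboptimality of x or the size of ∇f(x)
(`IsRound.average_directionSq_le_of_convex`, `IsRound.average_directionSq_le`).

Drift and control error feed each other, and a potential closes the loop. With U the mean square
control error it is E‖x - x*‖² + (K η_l)² U in the convex cases, with reference gradients at x*, and
E f(x) + β (K η_l)² U in the non-convex case, with reference gradients at x. Since η_g = √N, the
weight (K η_l)² equals t²/N, so control noise σ²/K costs t² σ²/(KN), the same order as the noise of
the averaged direction. When βt ≤ 1/1000, drift has such small coefficients that the old control
error is absorbed, and one round lowers the potential by a multiple of t times the error, up to
O(t²) noise (`IsRound.convex_potential_le`, `IsRound.nonconvex_potential_le`). Strong convexity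
contracts it by 1 - μt/2 as well.

All probability enters through orthogonality: a fresh sample and the past have a product law, so
gradient noise is orthogonal to whatever does not use its sample
(`IsStochasticGradient.integral_inner_noise`). `IsRound` records these relations, and the analysis
of a round uses nothing else.

Unrolling with the weights w_r bounds the weighted error of the iterates by the initial potential
over t Σ w_r plus O(t) noise. The step 1/t = 1000β + const · noise/ε (with a further β in the
non-convex case) gives the noise at most half of ε, and the number of rounds makes the initial term
smaller than the other half. -/

theorem IsSmooth.continuous_gradient (hs : IsSmooth β h) : Continuous (gradient h) :=
  (LipschitzWith.of_dist_le_mul (K := β.toNNReal) (f := gradient h) fun x y => by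
    rw [dist_eq_norm, dist_eq_norm]
    exact (hs.2 x y).trans
      (mul_le_mul_of_nonneg_right (Real.le_coe_toNNReal β) (norm_nonneg _))).continuous

theorem IsSmooth.norm_sq_gradient_sub_le (hs : IsSmooth β h) (x y : Vec d) :
    ‖gradient h x - gradient h y‖ ^ 2 ≤ β ^ 2 * ‖x - y‖ ^ 2 := by
  rw [← mul_pow]
  exact pow_le_pow_left₀ (norm_nonneg _) (hs.2 x y) 2

/-- The descent lemma. -/
theorem IsSmooth.le_add_inner (hs : IsSmooth β h) (x y : Vec d) :
    h y ≤ h x + inner ℝ (gradient h x) (y - x) + β / 2 * ‖y - x‖ ^ 2 := by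
  have hd : ∀ t : ℝ, HasDerivAt (fun t : ℝ => h (x + t • (y - x)))
      (inner ℝ (gradient h (x + t • (y - x))) (y - x)) t := by
    intro t
    have h1 := (hs.1 (x + t • (y - x))).hasFDerivAt
    have h2 : HasDerivAt (fun t : ℝ => x + t • (y - x)) (y - x) t := by
      simpa using ((hasDerivAt_id t).smul_const (y - x)).const_add x
    have h3 := h1.comp_hasDerivAt t h2
    rwa [← inner_gradient_left] at h3
  -- Subtracting the claimed quadratic bound along the segment leaves a function whose derivative is
  -- nonpositive, by Cauchy-Schwarz and the Lipschitz gradient. Comparing its values at 0 and 1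
  -- replaces an integration.
  have hφ : ∀ t : ℝ, HasDerivAt (fun t : ℝ => h (x + t • (y - x))
      - t * inner ℝ (gradient h x) (y - x) - β / 2 * t ^ 2 * ‖y - x‖ ^ 2)
      (inner ℝ (gradient h (x + t • (y - x))) (y - x) - inner ℝ (gradient h x) (y - x)
        - β * t * ‖y - x‖ ^ 2) t := by
    intro t
    have h1 := ((hd t).sub ((hasDerivAt_id t).mul_const (inner ℝ (gradient h x) (y - x)))).sub
      ((((hasDerivAt_id t).pow 2).const_mul (β / 2)).mul_const (‖y - x‖ ^ 2))
    refine h1.congr_deriv ?_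
    simp only [id_eq, Nat.cast_ofNat, one_mul, mul_one]
    ring
  have hanti : AntitoneOn (fun t : ℝ => h (x + t • (y - x))
      - t * inner ℝ (gradient h x) (y - x) - β / 2 * t ^ 2 * ‖y - x‖ ^ 2) (Set.Icc 0 1) := by
    refine antitoneOn_of_deriv_nonpos (convex_Icc 0 1)
      (fun t _ => (hφ t).continuousAt.continuousWithinAt)
      (fun t _ => (hφ t).differentiableAt.differentiableWithinAt) ?_
    intro t ht
    rw [interior_Icc] at ht
    rw [(hφ t).deriv, ← inner_sub_left]
    have h1 := real_inner_le_norm (gradient h (x + t • (y - x)) - gradient h x) (y - x)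
    have h2 := hs.2 (x + t • (y - x)) x
    rw [add_sub_cancel_left, norm_smul, Real.norm_of_nonneg ht.1.le] at h2
    nlinarith [mul_le_mul_of_nonneg_right h2 (norm_nonneg (y - x))]
  have := hanti (Set.left_mem_Icc.2 zero_le_one) (Set.right_mem_Icc.2 zero_le_one) zero_le_one
  simp only [one_smul, add_sub_cancel, one_mul, one_pow, mul_one, zero_smul, add_zero, zero_mul,
    sub_zero, ne_eq, OfNat.ofNat_ne_zero, not_false_eq_true, zero_pow, mul_zero] at this
  linarith

theorem gradient_eq_zero_of_forall_le {xs : Vec d} (hmin : ∀ x, h xs ≤ h x) :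
    gradient h xs = 0 := by
  have : IsLocalMin h xs := Filter.Eventually.of_forall hmin
  rw [gradient, this.fderiv_eq_zero, map_zero]

/-- `‖∇h(x)‖² ≤ 2β (h(x) - inf h)`. -/
theorem IsSmooth.norm_sq_gradient_le (hβ : 0 < β) (hs : IsSmooth β h) {m : ℝ}
    (hm : ∀ x, m ≤ h x) (x : Vec d) : ‖gradient h x‖ ^ 2 ≤ 2 * β * (h x - m) := by
  -- The step of length 1/β minimises the quadratic upper bound at x.
  have h1 := hs.le_add_inner x (x - (1 / β) • gradient h x)
  have h2 := hm (x - (1 / β) • gradient h x)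
  rw [sub_sub_cancel_left, inner_neg_right, inner_smul_right, real_inner_self_eq_norm_sq,
    norm_neg, norm_smul, Real.norm_of_nonneg (by positivity)] at h1
  have h3 : ‖gradient h x‖ ^ 2 / (2 * β) ≤ h x - m := by
    have : β / 2 * (1 / β * ‖gradient h x‖) ^ 2 = 1 / β * ‖gradient h x‖ ^ 2
        - ‖gradient h x‖ ^ 2 / (2 * β) := by
      field_simp; ring
    linarith
  rwa [div_le_iff₀ (by positivity), mul_comm] at h3

theorem IsMuConvex.mono {ν : ℝ} (hνμ : ν ≤ μ) (hc : IsMuConvex μ h) : IsMuConvex ν h := by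
  intro x y
  have := hc x y
  nlinarith [sq_nonneg ‖x - y‖]

/-- Cocoercivity of the gradient of a smooth convex function. -/
theorem IsSmooth.norm_sq_gradient_sub_le_of_convex (hβ : 0 < β) (hs : IsSmooth β h)
    (hc : IsMuConvex 0 h) (x y : Vec d) :
    ‖gradient h x - gradient h y‖ ^ 2 ≤
      2 * β * (h x - h y - inner ℝ (gradient h y) (x - y)) := by
  set v := gradient h x - gradient h y with hv
  -- At the test point x - v/β the smooth upper bound from x is played against the convex lower
  -- bound from y.
  have h1 := hs.le_add_inner x (x - (1 / β) • v)
  have h2 := hc y (x - (1 / β) • v)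
  rw [sub_sub_cancel_left, inner_neg_right, inner_smul_right,
    norm_neg, norm_smul, Real.norm_of_nonneg (by positivity)] at h1
  rw [show x - (1 / β) • v - y = (x - y) - (1 / β) • v by abel, inner_sub_right,
    inner_smul_right] at h2
  have h4 : inner ℝ (gradient h x) v - inner ℝ (gradient h y) v = ‖v‖ ^ 2 := by
    rw [← inner_sub_left, ← hv, real_inner_self_eq_norm_sq]
  have h3 : ‖v‖ ^ 2 / (2 * β) ≤ h x - h y - inner ℝ (gradient h y) (x - y) := by
    have h5 : β / 2 * (1 / β * ‖v‖) ^ 2 = 1 / β * ‖v‖ ^ 2 - ‖v‖ ^ 2 / (2 * β) := by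
      field_simp; ring
    have h6 : 1 / β * ‖v‖ ^ 2 = 1 / β * inner ℝ (gradient h x) v
        - 1 / β * inner ℝ (gradient h y) v := by rw [← h4]; ring
    linarith
  rwa [div_le_iff₀ (by positivity), mul_comm] at h3

/-- Adding the convexity inequalities for (x, y) and (y, x) gives strong monotonicity of the
gradient, which Cauchy-Schwarz and the Lipschitz bound limit from above. Two distinct points are
needed, hence the separate treatment of dimension 0 later. -/
theorem IsMuConvex.le_of_isSmooth [Nontrivial (Vec d)] (hs : IsSmooth β h)
    (hc : IsMuConvex μ h) : μ ≤ β := by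
  obtain ⟨x, y, hxy⟩ := exists_pair_ne (Vec d)
  have h1 := hc x y
  have h2 := hc y x
  have h3 : inner ℝ (gradient h x) (y - x) + inner ℝ (gradient h y) (x - y)
      = -inner ℝ (gradient h x - gradient h y) (x - y) := by
    rw [← neg_sub x y, inner_neg_right, inner_sub_left]; ring
  have h4 := real_inner_le_norm (gradient h x - gradient h y) (x - y)
  have h5 := mul_le_mul_of_nonneg_right (hs.2 x y) (norm_nonneg (x - y))
  have h6 : 0 < ‖x - y‖ := norm_pos_iff.2 (sub_ne_zero.2 hxy)
  rw [norm_sub_rev y x] at h2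
  nlinarith [pow_pos h6 2]

/-- Perturbed strong convexity. -/
theorem IsMuConvex.inner_gradient_ge (hμ : 0 ≤ μ) (hμβ : μ ≤ β) (hs : IsSmooth β h)
    (hc : IsMuConvex μ h) (x y z : Vec d) :
    h x - h z + μ / 4 * ‖x - z‖ ^ 2 - β * ‖y - x‖ ^ 2 ≤ inner ℝ (gradient h y) (x - z) := by
  have h1 := hs.le_add_inner y x
  have h2 := hc y z
  have h3 : inner ℝ (gradient h y) (x - z)
      = inner ℝ (gradient h y) (x - y) - inner ℝ (gradient h y) (z - y) := by
    rw [← inner_sub_right]; congr 1; abel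
  -- Trades μ/2 ‖y - z‖² for μ/4 ‖x - z‖² at the price μ/2 ‖x - y‖². With β/2 from smoothness and μ
  -- ≤ β the total price is at most β ‖x - y‖².
  have h4 : ‖x - z‖ ^ 2 ≤ 2 * ‖x - y‖ ^ 2 + 2 * ‖y - z‖ ^ 2 := by
    have : x - z = (x - y) + (y - z) := by abel
    have h5 := norm_add_le (x - y) (y - z)
    rw [← this] at h5
    nlinarith [norm_nonneg (x - z), sq_nonneg (‖x - y‖ - ‖y - z‖)]
  rw [norm_sub_rev y x]
  nlinarith [mul_le_mul_of_nonneg_left h4 hμ, sq_nonneg ‖x - y‖, sq_nonneg ‖y - z‖,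
    mul_le_mul_of_nonneg_right hμβ (sq_nonneg ‖x - y‖)]

end Smooth

/-! ### Averages of smooth and convex functions -/

section Objective

variable {d N : ℕ} {β μ : ℝ} {f : Fin N → Vec d → ℝ}

theorem gradient_objective (hf : ∀ i, Differentiable ℝ (f i)) (x : Vec d) :
    gradient (objective f) x = (1 / (N : ℝ)) • ∑ i, gradient (f i) x := by
  have h1 : HasFDerivAt (objective f) ((1 / (N : ℝ)) • ∑ i, fderiv ℝ (f i) x) x := by
    have := (HasFDerivAt.fun_sum (u := Finset.univ) (A := f)
      (fun i _ => (hf i x).hasFDerivAt)).const_smul (1 / (N : ℝ))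
    exact this
  rw [gradient, h1.fderiv, map_smul, map_sum]
  rfl

theorem IsSmooth.objective (hN : 1 ≤ N) (hs : ∀ i, IsSmooth β (f i)) :
    IsSmooth β (objective f) := by
  have hN' : (0 : ℝ) < N := by exact_mod_cast hN
  refine ⟨?_, fun x y => ?_⟩
  · exact (Differentiable.fun_sum fun i _ => (hs i).1).const_mul _
  · rw [gradient_objective fun i => (hs i).1, gradient_objective fun i => (hs i).1, ← smul_sub,
      ← Finset.sum_sub_distrib, norm_smul, Real.norm_of_nonneg (by positivity)]
    have : ‖∑ i, (gradient (f i) x - gradient (f i) y)‖ ≤ N * (β * ‖x - y‖) := by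
      refine (norm_sum_le _ _).trans ((Finset.sum_le_sum fun i _ => (hs i).2 x y).trans ?_)
      simp
    calc 1 / (N : ℝ) * ‖∑ i, (gradient (f i) x - gradient (f i) y)‖
        ≤ 1 / (N : ℝ) * (N * (β * ‖x - y‖)) := by gcongr
      _ = β * ‖x - y‖ := by field_simp

/-- The heterogeneity of the change of the gradients is controlled by the suboptimality. -/
theorem sum_norm_sq_gradient_sub_le (hN : 1 ≤ N) (hβ : 0 < β) (hs : ∀ i, IsSmooth β (f i))
    (hc : ∀ i, IsMuConvex 0 (f i)) {xs : Vec d} (hmin : ∀ x, objective f xs ≤ objective f x)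
    (x : Vec d) :
    (1 / (N : ℝ)) * ∑ i, ‖gradient (f i) x - gradient (f i) xs‖ ^ 2 ≤
      2 * β * (objective f x - objective f xs) := by
  have hN' : (0 : ℝ) < N := by exact_mod_cast hN
  have h0 := gradient_eq_zero_of_forall_le hmin
  rw [gradient_objective fun i => (hs i).1] at h0
  -- The linear terms of the cocoercivity bounds cancel on averaging, because the client gradients
  -- sum to zero at the minimiser.
  have h1 : ∑ i, inner ℝ (gradient (f i) xs) (x - xs) = 0 := by
    rw [← sum_inner]
    have : ∑ i, gradient (f i) xs = 0 := by
      simpa [hN'.ne'] using h0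
    rw [this, inner_zero_left]
  have h2 := Finset.sum_le_sum fun i (_ : i ∈ Finset.univ) =>
    (hs i).norm_sq_gradient_sub_le_of_convex hβ (hc i) x xs
  rw [← Finset.mul_sum, Finset.sum_sub_distrib, Finset.sum_sub_distrib, h1] at h2
  calc _ ≤ (1 / (N : ℝ)) * _ := mul_le_mul_of_nonneg_left h2 (by positivity)
    _ = _ := by simp only [objective]; ring

end Objective

/-! ### The mask -/

section Mask

variable {d : ℕ} (q : Finset (Fin d))

/-- The mask as a linear map. -/
def maskLinear : Vec d →ₗ[ℝ] Vec d where
  toFun := mask q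
  map_add' u v := by ext j; simp only [mask, PiLp.add_apply]; split_ifs <;> simp
  map_smul' a v := by ext j; simp [mask]

theorem mask_sub (u v : Vec d) : mask q (u - v) = mask q u - mask q v := (maskLinear q).map_sub u v

theorem mask_smul (a : ℝ) (v : Vec d) : mask q (a • v) = a • mask q v := (maskLinear q).map_smul a v

theorem mask_sum {ι : Type*} (s : Finset ι) (v : ι → Vec d) :
    mask q (∑ i ∈ s, v i) = ∑ i ∈ s, mask q (v i) := map_sum (maskLinear q) v s

theorem mask_zero : mask q (0 : Vec d) = 0 := (maskLinear q).map_zero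

theorem mask_mask (v : Vec d) : mask q (mask q v) = mask q v := by
  ext j; simp only [mask]; split_ifs <;> rfl

theorem mask_univ (v : Vec d) : mask Finset.univ v = v := by
  ext j; simp [mask]

theorem mask_add_mask_compl (v : Vec d) : mask q v + mask qᶜ v = v := by
  ext j
  by_cases hj : j ∈ q <;> simp [mask, hj]

theorem norm_mask_le (v : Vec d) : ‖mask q v‖ ≤ ‖v‖ := by
  rw [EuclideanSpace.norm_eq, EuclideanSpace.norm_eq]
  refine Real.sqrt_le_sqrt (Finset.sum_le_sum fun j _ => ?_)
  by_cases hj : j ∈ q <;> simp [mask, hj, sq_nonneg]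

theorem norm_sq_mask_le (v : Vec d) : ‖mask q v‖ ^ 2 ≤ ‖v‖ ^ 2 :=
  pow_le_pow_left₀ (norm_nonneg _) (norm_mask_le q v) 2

theorem continuous_mask : Continuous (mask q) :=
  (maskLinear q).continuous_of_finiteDimensional

end Mask

/-! ### Mean squares of random vectors -/

section MeanSquare

variable {Ω : Type*} [MeasurableSpace Ω] {P : Measure Ω} {d : ℕ} {X Y Z : Ω → Vec d}

/-- The mean square `𝔼‖X‖²`. -/
def meanSq (P : Measure Ω) (X : Ω → Vec d) : ℝ := ∫ ω, ‖X ω‖ ^ 2 ∂P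

theorem meanSq_nonneg : 0 ≤ meanSq P X := integral_nonneg fun _ => sq_nonneg _

theorem integrable_norm_sq (hX : MemLp X 2 P) : Integrable (fun ω => ‖X ω‖ ^ 2) P :=
  (memLp_two_iff_integrable_sq_norm hX.1).1 hX

theorem integrable_inner_of_memLp (hX : MemLp X 2 P) (hY : MemLp Y 2 P) :
    Integrable (fun ω => (inner ℝ (X ω) (Y ω) : ℝ)) P := by
  refine Integrable.mono' ((integrable_norm_sq hX).add (integrable_norm_sq hY))
    (hX.1.inner hY.1) (Filter.Eventually.of_forall fun ω => ?_)
  refine (norm_inner_le_norm _ _).trans ?_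
  simp only [Pi.add_apply]
  nlinarith [sq_nonneg (‖X ω‖ - ‖Y ω‖), sq_nonneg ‖X ω‖, sq_nonneg ‖Y ω‖]

theorem meanSq_smul (a : ℝ) : meanSq P (fun ω => a • X ω) = a ^ 2 * meanSq P X := by
  simp only [meanSq, norm_smul, mul_pow, Real.norm_eq_abs, sq_abs]
  exact integral_const_mul _ _

theorem meanSq_le_of_norm_sq_le {a : ℝ} (hX : MemLp X 2 P) (hY : MemLp Y 2 P)
    (h : ∀ ω, ‖X ω‖ ^ 2 ≤ a * ‖Y ω‖ ^ 2) : meanSq P X ≤ a * meanSq P Y := by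
  rw [meanSq, meanSq, ← integral_const_mul]
  exact integral_mono (integrable_norm_sq hX) ((integrable_norm_sq hY).const_mul a) h

theorem meanSq_add (hX : MemLp X 2 P) (hY : MemLp Y 2 P) :
    meanSq P (fun ω => X ω + Y ω) =
      meanSq P X + 2 * (∫ ω, inner ℝ (X ω) (Y ω) ∂P) + meanSq P Y := by
  simp only [meanSq]
  have h1 := (integrable_inner_of_memLp hX hY).const_mul 2
  have h2 := integrable_norm_sq hX
  have h3 := integrable_norm_sq hY
  calc ∫ ω, ‖X ω + Y ω‖ ^ 2 ∂P
      = ∫ ω, (‖X ω‖ ^ 2 + 2 * inner ℝ (X ω) (Y ω)) + ‖Y ω‖ ^ 2 ∂P :=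
        integral_congr_ae (Filter.Eventually.of_forall fun ω => norm_add_sq_real _ _)
    _ = _ := by
        rw [integral_add (f := fun ω => ‖X ω‖ ^ 2 + 2 * inner ℝ (X ω) (Y ω)) (h2.add h1) h3,
          integral_add h2 h1, integral_const_mul]

theorem meanSq_add_le (hX : MemLp X 2 P) (hY : MemLp Y 2 P) {t : ℝ} (ht : 0 < t) :
    meanSq P (fun ω => X ω + Y ω) ≤ (1 + 1 / t) * meanSq P X + (1 + t) * meanSq P Y := by
  simp only [meanSq]
  rw [← integral_const_mul, ← integral_const_mul, ← integral_add
    ((integrable_norm_sq hX).const_mul _) ((integrable_norm_sq hY).const_mul _)]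
  refine integral_mono (integrable_norm_sq (hX.add hY))
    (((integrable_norm_sq hX).const_mul _).add ((integrable_norm_sq hY).const_mul _))
    fun ω => ?_
  have h1 := norm_add_sq_real (X ω) (Y ω)
  have h2 := real_inner_le_norm (X ω) (Y ω)
  have h3 : 2 * (‖X ω‖ * ‖Y ω‖) ≤ 1 / t * ‖X ω‖ ^ 2 + t * ‖Y ω‖ ^ 2 := by
    have : 1 / t * ‖X ω‖ ^ 2 + t * ‖Y ω‖ ^ 2 - 2 * (‖X ω‖ * ‖Y ω‖) =
        1 / t * (‖X ω‖ - t * ‖Y ω‖) ^ 2 := by field_simp; ring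
    have h4 : 0 ≤ 1 / t * (‖X ω‖ - t * ‖Y ω‖) ^ 2 := by positivity
    linarith
  change ‖X ω + Y ω‖ ^ 2 ≤ (1 + 1 / t) * ‖X ω‖ ^ 2 + (1 + t) * ‖Y ω‖ ^ 2
  linarith

theorem meanSq_add_le_two (hX : MemLp X 2 P) (hY : MemLp Y 2 P) :
    meanSq P (fun ω => X ω + Y ω) ≤ 2 * meanSq P X + 2 * meanSq P Y := by
  have := meanSq_add_le hX hY one_pos
  norm_num at this
  exact this

theorem meanSq_add_le_three (hX : MemLp X 2 P) (hY : MemLp Y 2 P) (hZ : MemLp Z 2 P) :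
    meanSq P (fun ω => X ω + Y ω + Z ω) ≤ 3 * meanSq P X + 3 * meanSq P Y + 3 * meanSq P Z := by
  -- Young with parameter 2 gives X + Y the weight 3/2, which becomes 3 after splitting, and Z the
  -- weight 3.
  have h1 := meanSq_add_le (hX.add hY) hZ two_pos
  have h2 := meanSq_add_le_two hX hY
  simp only [Pi.add_apply] at h1
  change _ ≤ (1 + 1 / 2) * meanSq P (fun ω => X ω + Y ω) + _ at h1
  norm_num at h1
  linarith

theorem meanSq_sum_of_orthogonal {ι : Type*} (s : Finset ι) {W : ι → Ω → Vec d}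
    (hW : ∀ i, MemLp (W i) 2 P)
    (horth : ∀ i ∈ s, ∀ j ∈ s, i ≠ j → ∫ ω, inner ℝ (W i ω) (W j ω) ∂P = 0) :
    meanSq P (fun ω => ∑ i ∈ s, W i ω) = ∑ i ∈ s, meanSq P (W i) := by
  have h1 : ∀ ω, ‖∑ i ∈ s, W i ω‖ ^ 2 = ∑ i ∈ s, ∑ j ∈ s, inner ℝ (W i ω) (W j ω) := by
    intro ω
    rw [← real_inner_self_eq_norm_sq, sum_inner]
    exact Finset.sum_congr rfl fun i _ => inner_sum _ _ _
  simp only [meanSq, h1]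
  rw [integral_finsetSum _ fun i _ => integrable_finsetSum _ fun j _ =>
    integrable_inner_of_memLp (hW i) (hW j)]
  refine Finset.sum_congr rfl fun i hi => ?_
  rw [integral_finsetSum _ fun j _ => integrable_inner_of_memLp (hW i) (hW j),
    Finset.sum_eq_single_of_mem i hi fun j hj hji => horth i hi j hj hji.symm]
  simp only [real_inner_self_eq_norm_sq]

theorem norm_sq_sum_le {ι : Type*} (s : Finset ι) (v : ι → Vec d) :
    ‖∑ i ∈ s, v i‖ ^ 2 ≤ s.card * ∑ i ∈ s, ‖v i‖ ^ 2 :=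
  (pow_le_pow_left₀ (norm_nonneg _) (norm_sum_le s v) 2).trans sq_sum_le_card_mul_sum_sq

theorem norm_sq_average_le {n : ℕ} (hn : 1 ≤ n) {ι : Type*} {s : Finset ι} (hs : s.card = n)
    (v : ι → Vec d) : ‖(1 / (n : ℝ)) • ∑ i ∈ s, v i‖ ^ 2 ≤ (1 / (n : ℝ)) * ∑ i ∈ s, ‖v i‖ ^ 2 := by
  have hn' : (0 : ℝ) < n := by exact_mod_cast hn
  have h1 := norm_sq_sum_le s v
  rw [hs] at h1
  rw [norm_smul, mul_pow, Real.norm_eq_abs, sq_abs]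
  calc (1 / (n : ℝ)) ^ 2 * ‖∑ i ∈ s, v i‖ ^ 2
      ≤ (1 / (n : ℝ)) ^ 2 * (n * ∑ i ∈ s, ‖v i‖ ^ 2) := by gcongr
    _ = _ := by field_simp

theorem memLp_finset_sum {ι : Type*} (s : Finset ι) {W : ι → Ω → Vec d}
    (hW : ∀ i ∈ s, MemLp (W i) 2 P) : MemLp (fun ω => ∑ i ∈ s, W i ω) 2 P := by
  have := memLp_finsetSum (μ := P) (p := 2) s hW
  simpa using this

theorem memLp_smul (a : ℝ) (hX : MemLp X 2 P) : MemLp (fun ω => a • X ω) 2 P :=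
  hX.const_smul a

theorem meanSq_average_le {n : ℕ} (hn : 1 ≤ n) {ι : Type*} {s : Finset ι} (hs : s.card = n)
    {W : ι → Ω → Vec d} (hW : ∀ i ∈ s, MemLp (W i) 2 P) :
    meanSq P (fun ω => (1 / (n : ℝ)) • ∑ i ∈ s, W i ω) ≤
      (1 / (n : ℝ)) * ∑ i ∈ s, meanSq P (W i) := by
  simp only [meanSq]
  rw [← integral_finsetSum _ fun i hi => integrable_norm_sq (hW i hi), ← integral_const_mul]
  refine integral_mono (integrable_norm_sq (memLp_smul _ (memLp_finset_sum s hW)))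
    ((integrable_finsetSum _ fun i hi => integrable_norm_sq (hW i hi)).const_mul _) fun ω => ?_
  exact norm_sq_average_le hn hs _

theorem meanSq_mask_le (q : Finset (Fin d)) (hX : MemLp X 2 P)
    (hX' : MemLp (fun ω => mask q (X ω)) 2 P) :
    meanSq P (fun ω => mask q (X ω)) ≤ meanSq P X :=
  integral_mono (integrable_norm_sq hX') (integrable_norm_sq hX) fun _ => norm_sq_mask_le q _

theorem memLp_mask (q : Finset (Fin d)) (hX : MemLp X 2 P) :
    MemLp (fun ω => mask q (X ω)) 2 P :=
  hX.mono ((continuous_mask q).comp_aestronglyMeasurable hX.1)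
    (Filter.Eventually.of_forall fun _ => norm_mask_le q _)

/-- A Lipschitz gradient grows at most linearly. -/
theorem IsSmooth.memLp_gradient [IsFiniteMeasure P] {β : ℝ} {h : Vec d → ℝ} (hs : IsSmooth β h)
    (hX : MemLp X 2 P) : MemLp (fun ω => gradient h (X ω)) 2 P := by
  have h1 : MemLp (fun ω => gradient h (X ω) - gradient h 0) 2 P := by
    refine (hX.norm.const_mul β).of_le
      ((hs.continuous_gradient.comp_aestronglyMeasurable hX.1).sub aestronglyMeasurable_const)
      (Filter.Eventually.of_forall fun ω => ?_)
    have := hs.2 (X ω) 0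
    rw [sub_zero] at this
    exact this.trans (le_abs_self _)
  have h2 := h1.add (memLp_const (gradient h 0))
  refine h2.ae_eq (Filter.Eventually.of_forall fun ω => ?_)
  simp

end MeanSquare

/-! ### Stochastic gradients at random points -/

section Noise

variable {Ω S : Type*} {m : MeasurableSpace Ω} [mΩ : MeasurableSpace Ω] [MeasurableSpace S] {P : Measure Ω}
  [IsProbabilityMeasure P] {d : ℕ} {D : Measure S} {h : Vec d → ℝ} {g : Vec d → S → Vec d}
  {β σ : ℝ} {s : Ω → S} {Y Z : Ω → Vec d}

theorem IsStochasticGradient.measurable_noise (hs : IsSmooth β h)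
    (hg : IsStochasticGradient D h g σ) :
    Measurable (fun z : Vec d × S => g z.1 z.2 - gradient h z.1) :=
  hg.measurable.sub (hs.continuous_gradient.measurable.comp measurable_fst)

/-- Serves in place of conditional expectations: under the product law the past can be frozen and
the fresh sample integrated first. -/
theorem map_prod_of_indep {T : Type*} [MeasurableSpace T] (hm : m ≤ mΩ)
    (hind : Indep m (MeasurableSpace.comap s inferInstance) P) (hsm : Measurable s)
    (hlaw : P.map s = D) {W : Ω → T} (hW : Measurable[m] W) :
    P.map (fun ω => (W ω, s ω)) = (P.map W).prod D := by
  have h1 : IndepFun W s P := indep_of_indep_of_le_left hind hW.comap_le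
  rw [← hlaw]
  exact (indepFun_iff_map_prod_eq_prod_map_map (hW.mono hm le_rfl).aemeasurable
    hsm.aemeasurable).1 h1

/-- By Tonelli the sample is integrated at a frozen point, where the variance bound applies
uniformly. The Lebesgue integral is used because integrability at a random point is itself deduced
from this bound. -/
theorem IsStochasticGradient.lintegral_noise_le [IsProbabilityMeasure D] (hs : IsSmooth β h)
    (hg : IsStochasticGradient D h g σ) (hm : m ≤ mΩ)
    (hind : Indep m (MeasurableSpace.comap s inferInstance) P) (hsm : Measurable s)
    (hlaw : P.map s = D) (hY : Measurable[m] Y) :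
    ∫⁻ ω, ENNReal.ofReal (‖g (Y ω) (s ω) - gradient h (Y ω)‖ ^ 2) ∂P ≤
      ENNReal.ofReal (σ ^ 2) := by
  have hY' : Measurable Y := hY.mono hm le_rfl
  have hn := hg.measurable_noise hs
  have hF : Measurable (fun z : Vec d × S =>
      ENNReal.ofReal (‖g z.1 z.2 - gradient h z.1‖ ^ 2)) := (hn.norm.pow_const 2).ennreal_ofReal
  have h1 := lintegral_map (μ := P) hF (hY'.prodMk hsm)
  rw [map_prod_of_indep hm hind hsm hlaw hY, lintegral_prod _ hF.aemeasurable] at h1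
  rw [← h1]
  have : IsProbabilityMeasure (P.map Y) := Measure.isProbabilityMeasure_map hY'.aemeasurable
  calc _ ≤ ∫⁻ _, ENNReal.ofReal (σ ^ 2) ∂(P.map Y) := by
        refine lintegral_mono fun y => ?_
        rw [← ofReal_integral_eq_lintegral_ofReal]
        · exact ENNReal.ofReal_le_ofReal (hg.variance_le y)
        · exact integrable_norm_sq ((hg.memLp y).sub (memLp_const (gradient h y)))
        · exact Filter.Eventually.of_forall fun _ => sq_nonneg _
    _ = _ := by simp

theorem IsStochasticGradient.memLp_noise [IsProbabilityMeasure D] (hs : IsSmooth β h)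
    (hg : IsStochasticGradient D h g σ) (hm : m ≤ mΩ)
    (hind : Indep m (MeasurableSpace.comap s inferInstance) P) (hsm : Measurable s)
    (hlaw : P.map s = D) (hY : Measurable[m] Y) :
    MemLp (fun ω => g (Y ω) (s ω) - gradient h (Y ω)) 2 P := by
  have hmeas : Measurable (fun ω => g (Y ω) (s ω) - gradient h (Y ω)) :=
    (hg.measurable_noise hs).comp ((hY.mono hm le_rfl).prodMk hsm)
  rw [memLp_two_iff_integrable_sq_norm hmeas.aestronglyMeasurable]
  refine ⟨(hmeas.norm.pow_const 2).aestronglyMeasurable, ?_⟩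
  rw [hasFiniteIntegral_iff_ofReal (Filter.Eventually.of_forall fun _ => sq_nonneg _)]
  exact (hg.lintegral_noise_le hs hm hind hsm hlaw hY).trans_lt ENNReal.ofReal_lt_top

theorem IsStochasticGradient.meanSq_noise_le [IsProbabilityMeasure D] (hs : IsSmooth β h)
    (hg : IsStochasticGradient D h g σ) (hm : m ≤ mΩ)
    (hind : Indep m (MeasurableSpace.comap s inferInstance) P) (hsm : Measurable s)
    (hlaw : P.map s = D) (hY : Measurable[m] Y) :
    meanSq P (fun ω => g (Y ω) (s ω) - gradient h (Y ω)) ≤ σ ^ 2 := by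
  have hmeas : Measurable (fun ω => g (Y ω) (s ω) - gradient h (Y ω)) :=
    (hg.measurable_noise hs).comp ((hY.mono hm le_rfl).prodMk hsm)
  rw [meanSq, integral_eq_lintegral_of_nonneg_ae (Filter.Eventually.of_forall fun _ => sq_nonneg _)
    (hmeas.norm.pow_const 2).aestronglyMeasurable]
  exact ENNReal.toReal_le_of_le_ofReal (sq_nonneg _)
    (hg.lintegral_noise_le hs hm hind hsm hlaw hY)

/-- The noise of a fresh stochastic gradient is orthogonal to everything that is independent of
the sample. -/
theorem IsStochasticGradient.integral_inner_noise [IsProbabilityMeasure D] (hs : IsSmooth β h)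
    (hg : IsStochasticGradient D h g σ) (hm : m ≤ mΩ)
    (hind : Indep m (MeasurableSpace.comap s inferInstance) P) (hsm : Measurable s)
    (hlaw : P.map s = D) (hY : Measurable[m] Y) (hZ : Measurable[m] Z) (hZ2 : MemLp Z 2 P) :
    ∫ ω, inner ℝ (Z ω) (g (Y ω) (s ω) - gradient h (Y ω)) ∂P = 0 := by
  have hYZ : Measurable[m] (fun ω => (Y ω, Z ω)) := hY.prodMk hZ
  have hYZ' : Measurable (fun ω => (Y ω, Z ω)) := hYZ.mono hm le_rfl
  have hF : Measurable (fun z : (Vec d × Vec d) × S =>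
      (inner ℝ z.1.2 (g z.1.1 z.2 - gradient h z.1.1) : ℝ)) :=
    (measurable_snd.comp measurable_fst).inner
      ((hg.measurable_noise hs).comp ((measurable_fst.comp measurable_fst).prodMk measurable_snd))
  have hint : Integrable (fun ω => (inner ℝ (Z ω) (g (Y ω) (s ω) - gradient h (Y ω)) : ℝ)) P :=
    integrable_inner_of_memLp hZ2 (hg.memLp_noise hs hm hind hsm hlaw hY)
  have h1 := integral_map (μ := P) (hYZ'.prodMk hsm).aemeasurable
    (hF.aestronglyMeasurable)
  rw [← h1]
  have h2 : Integrable (fun z : (Vec d × Vec d) × S =>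
      (inner ℝ z.1.2 (g z.1.1 z.2 - gradient h z.1.1) : ℝ))
      (P.map (fun ω => ((Y ω, Z ω), s ω))) :=
    (integrable_map_measure hF.aestronglyMeasurable (hYZ'.prodMk hsm).aemeasurable).2 hint
  have : IsProbabilityMeasure (P.map fun ω => (Y ω, Z ω)) :=
    Measure.isProbabilityMeasure_map hYZ'.aemeasurable
  -- With Y and Z frozen, the inner integral over the sample vanishes by unbiasedness.
  rw [map_prod_of_indep hm hind hsm hlaw hYZ] at h2 ⊢
  rw [integral_prod _ h2]
  refine integral_eq_zero_of_ae (Filter.Eventually.of_forall fun z => ?_)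
  have h3 : Integrable (g z.1) D := (hg.memLp z.1).integrable one_le_two
  simp only [Pi.zero_apply]
  rw [integral_inner (f := fun s => g z.1 s - gradient h z.1) (h3.sub (integrable_const _)), integral_sub h3 (integrable_const _),
    hg.unbiased]
  simp

end Noise

/-! ### One communication round -/

/-- Averages over clients and local steps. -/
def clientAverage {E : Type*} [AddCommGroup E] [Module ℝ E] (N K : ℕ) (a : Fin N → ℕ → E) : E :=
  (1 / (N : ℝ)) • ∑ i, (1 / (K : ℝ)) • ∑ k ∈ Finset.range K, a i k

theorem clientAverage_mono {N K : ℕ} {a b : Fin N → ℕ → ℝ} (h : ∀ i, ∀ k < K, a i k ≤ b i k) :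
    clientAverage N K a ≤ clientAverage N K b := by
  simp only [clientAverage, smul_eq_mul]
  gcongr with i _ k hk
  exact h i k (Finset.mem_range.1 hk)

theorem clientAverage_nonneg {N K : ℕ} {a : Fin N → ℕ → ℝ} (h : ∀ i k, 0 ≤ a i k) :
    0 ≤ clientAverage N K a := by
  simp only [clientAverage, smul_eq_mul]
  have : ∀ i, 0 ≤ ∑ k ∈ Finset.range K, a i k := fun i => Finset.sum_nonneg fun k _ => h i k
  have := fun i => this i
  refine mul_nonneg (by positivity) (Finset.sum_nonneg fun i _ => mul_nonneg (by positivity)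
    (this i))

theorem clientAverage_const {N K : ℕ} (hK : 1 ≤ K) (a : Fin N → ℝ) :
    clientAverage N K (fun i _ => a i) = (1 / (N : ℝ)) * ∑ i, a i := by
  have : (K : ℝ) ≠ 0 := by positivity
  simp [clientAverage, this]

theorem clientAverage_const' {N K : ℕ} (hN : 1 ≤ N) (hK : 1 ≤ K) (a : ℝ) :
    clientAverage N K (fun _ _ => a) = a := by
  have : (N : ℝ) ≠ 0 := by positivity
  rw [clientAverage_const hK]
  simp [this]

theorem clientAverage_add {E : Type*} [AddCommGroup E] [Module ℝ E] {N K : ℕ}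
    (a b : Fin N → ℕ → E) :
    clientAverage N K (fun i k => a i k + b i k) = clientAverage N K a + clientAverage N K b := by
  simp only [clientAverage, Finset.sum_add_distrib, smul_add]

theorem clientAverage_sub {E : Type*} [AddCommGroup E] [Module ℝ E] {N K : ℕ}
    (a b : Fin N → ℕ → E) :
    clientAverage N K (fun i k => a i k - b i k) = clientAverage N K a - clientAverage N K b := by
  simp only [clientAverage, Finset.sum_sub_distrib, smul_sub]

theorem clientAverage_smul {E : Type*} [AddCommGroup E] [Module ℝ E] {N K : ℕ} (r : ℝ)
    (a : Fin N → ℕ → E) :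
    clientAverage N K (fun i k => r • a i k) = r • clientAverage N K a := by
  simp only [clientAverage, ← Finset.smul_sum, smul_comm r]

/-! ### Integrals of client averages and of smooth functions -/

section Integration

variable {Ω : Type*} [MeasurableSpace Ω] {P : Measure Ω} {d N K : ℕ}

theorem integrable_clientAverage {a : Fin N → ℕ → Ω → ℝ} (ha : ∀ i k, Integrable (a i k) P) :
    Integrable (fun ω => clientAverage N K (fun i k => a i k ω)) P := by
  simp only [clientAverage, smul_eq_mul]
  exact (integrable_finsetSum _ fun i _ =>
    (integrable_finsetSum _ fun k _ => ha i k).const_mul _).const_mul _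

theorem integral_clientAverage {a : Fin N → ℕ → Ω → ℝ} (ha : ∀ i k, Integrable (a i k) P) :
    ∫ ω, clientAverage N K (fun i k => a i k ω) ∂P =
      clientAverage N K (fun i k => ∫ ω, a i k ω ∂P) := by
  simp only [clientAverage, smul_eq_mul]
  rw [integral_const_mul, integral_finsetSum _ fun i _ =>
    (integrable_finsetSum _ fun k _ => ha i k).const_mul _]
  congr 1
  refine Finset.sum_congr rfl fun i _ => ?_
  rw [integral_const_mul, integral_finsetSum _ fun k _ => ha i k]

theorem memLp_clientAverage {W : Fin N → ℕ → Ω → Vec d} (hW : ∀ i k, MemLp (W i k) 2 P) :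
    MemLp (fun ω => clientAverage N K (fun i k => W i k ω)) 2 P :=
  memLp_smul _ (memLp_finset_sum _ fun i _ => memLp_smul _ (memLp_finset_sum _ fun k _ => hW i k))

theorem inner_clientAverage (v : Vec d) (a : Fin N → ℕ → Vec d) :
    inner ℝ v (clientAverage N K a) = clientAverage N K (fun i k => inner ℝ v (a i k)) := by
  simp only [clientAverage, inner_smul_right, inner_sum, smul_eq_mul]

theorem meanSq_clientAverage_le (hN : 1 ≤ N) (hK : 1 ≤ K) {W : Fin N → ℕ → Ω → Vec d}
    (hW : ∀ i k, MemLp (W i k) 2 P) :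
    meanSq P (fun ω => clientAverage N K (fun i k => W i k ω)) ≤
      clientAverage N K (fun i k => meanSq P (W i k)) := by
  refine (meanSq_average_le hN (Finset.card_fin N) (W := fun i ω =>
    (1 / (K : ℝ)) • ∑ k ∈ Finset.range K, W i k ω)
    fun i _ => memLp_smul _ (memLp_finset_sum _ fun k _ => hW i k)).trans ?_
  simp only [clientAverage, smul_eq_mul]
  gcongr with i _
  exact meanSq_average_le hK (Finset.card_range K) fun k _ => hW i k

/-- The descent lemma from 0 to X and from X to 0 traps h(X) between two integrable functions.
Neither convexity nor a lower bound for h is required. -/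
theorem IsSmooth.integrable_comp [IsFiniteMeasure P] {β : ℝ} {h : Vec d → ℝ} (hs : IsSmooth β h)
    {X : Ω → Vec d} (hX : MemLp X 2 P) : Integrable (fun ω => h (X ω)) P := by
  have h1 : Integrable (fun ω => h 0 + inner ℝ (gradient h 0) (X ω) + β / 2 * ‖X ω‖ ^ 2) P :=
    ((integrable_const _).add (integrable_inner_of_memLp (memLp_const _) hX)).add
      ((integrable_norm_sq hX).const_mul _)
  have h2 : Integrable (fun ω => h 0 + inner ℝ (gradient h (X ω)) (X ω) - β / 2 * ‖X ω‖ ^ 2) P :=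
    ((integrable_const _).add (integrable_inner_of_memLp (hs.memLp_gradient hX) hX)).sub
      ((integrable_norm_sq hX).const_mul _)
  refine integrable_of_le_of_le (hs.1.continuous.comp_aestronglyMeasurable hX.1)
    (Filter.Eventually.of_forall fun ω => ?_) (Filter.Eventually.of_forall fun ω => ?_) h2 h1
  · have := hs.le_add_inner (X ω) 0
    rw [zero_sub, inner_neg_right, norm_neg] at this
    dsimp only
    linarith
  · have := hs.le_add_inner 0 (X ω)
    rw [sub_zero] at this
    exact this

end Integration

/-- A communication round: started from `x` with control variates `ci` and their mean `c`, client
`i` moves through `y i 0, y i 1, …`, and `n i k` is the noise of its `k`-th stochastic gradient. -/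
structure IsRound {Ω : Type*} [MeasurableSpace Ω] (P : Measure Ω) {d N : ℕ}
    (f : Fin N → Vec d → ℝ) (σ ηl : ℝ) (x c : Ω → Vec d) (ci : Fin N → Ω → Vec d)
    (y n : Fin N → ℕ → Ω → Vec d) : Prop where
  memLp_x : MemLp x 2 P
  memLp_ci : ∀ i, MemLp (ci i) 2 P
  memLp_y : ∀ i k, MemLp (y i k) 2 P
  memLp_noise : ∀ i k, MemLp (n i k) 2 P
  c_eq : ∀ ω, c ω = (1 / (N : ℝ)) • ∑ i, ci i ω
  y_zero : ∀ i, y i 0 = x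
  y_succ : ∀ i k ω, y i (k + 1) ω =
    y i k ω - ηl • (gradient (f i) (y i k ω) + n i k ω - ci i ω + c ω)
  meanSq_noise_le : ∀ i k, meanSq P (n i k) ≤ σ ^ 2
  noise_step : ∀ i k, ∫ ω, inner ℝ
    (y i k ω - x ω - ηl • (gradient (f i) (y i k ω) - ci i ω + c ω)) (n i k ω) ∂P = 0
  noise_start : ∀ i k (φ : Vec d → Vec d), Measurable φ → MemLp (fun ω => φ (x ω)) 2 P →
    ∫ ω, inner ℝ (φ (x ω)) (n i k ω) ∂P = 0
  noise_pair : ∀ i k j l, (i, k) ≠ (j, l) → ∫ ω, inner ℝ (n i k ω) (n j l ω) ∂P = 0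

namespace IsRound

variable {Ω : Type*} [MeasurableSpace Ω] {P : Measure Ω} [IsProbabilityMeasure P] {d N K : ℕ}
  {f : Fin N → Vec d → ℝ} {β σ ηl : ℝ} {x c : Ω → Vec d} {ci : Fin N → Ω → Vec d}
  {y n : Fin N → ℕ → Ω → Vec d}

theorem memLp_c (H : IsRound P f σ ηl x c ci y n) : MemLp c 2 P := by
  have : c = fun ω => (1 / (N : ℝ)) • ∑ i, ci i ω := funext H.c_eq
  rw [this]
  exact memLp_smul _ (memLp_finset_sum _ fun i _ => H.memLp_ci i)

/-! ### Drift of the local models -/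

/-- The mean square of the first local direction of client `i`. -/
def directionSq (P : Measure Ω) (f : Fin N → Vec d → ℝ) (x c : Ω → Vec d)
    (ci : Fin N → Ω → Vec d) (i : Fin N) : ℝ :=
  meanSq P (fun ω => gradient (f i) (x ω) - ci i ω + c ω)

/-- The fresh noise is orthogonal to the rest of the step, so it adds only η_l² σ² and escapes
Young's inequality. Young on the rest multiplies the old drift by 1 + 1/K, and the Lipschitz part of
the gradient adds another 1/K of it. -/
theorem meanSq_drift_succ_le (H : IsRound P f σ ηl x c ci y n) (hs : ∀ i, IsSmooth β (f i))
    (hK : 1 ≤ K) (hη : 4 * (K * ηl * β) ^ 2 ≤ 1) (i : Fin N) (k : ℕ) :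
    meanSq P (fun ω => y i (k + 1) ω - x ω) ≤
      (1 + 2 / K) * meanSq P (fun ω => y i k ω - x ω) +
        (4 * K * ηl ^ 2 * directionSq P f x c ci i + ηl ^ 2 * σ ^ 2) := by
  have hK' : (1 : ℝ) ≤ K := by exact_mod_cast hK
  have hy := H.memLp_y i k
  have hyx : MemLp (fun ω => y i k ω - x ω) 2 P := hy.sub H.memLp_x
  have hg : MemLp (fun ω => gradient (f i) (y i k ω) - ci i ω + c ω) 2 P :=
    (((hs i).memLp_gradient hy).sub (H.memLp_ci i)).add H.memLp_c
  have hgx : MemLp (fun ω => gradient (f i) (x ω) - ci i ω + c ω) 2 P :=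
    (((hs i).memLp_gradient H.memLp_x).sub (H.memLp_ci i)).add H.memLp_c
  have hgd : MemLp (fun ω => gradient (f i) (y i k ω) - gradient (f i) (x ω)) 2 P :=
    ((hs i).memLp_gradient hy).sub ((hs i).memLp_gradient H.memLp_x)
  have hηg : MemLp (fun ω => (-ηl) • (gradient (f i) (y i k ω) - ci i ω + c ω)) 2 P :=
    memLp_smul _ hg
  have hηn : MemLp (fun ω => (-ηl) • n i k ω) 2 P := memLp_smul _ (H.memLp_noise i k)
  have h1 : meanSq P (fun ω => y i (k + 1) ω - x ω) =
      meanSq P (fun ω => (y i k ω - x ω) + (-ηl) • (gradient (f i) (y i k ω) - ci i ω + c ω)) +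
        ηl ^ 2 * meanSq P (n i k) := by
    have h2 := meanSq_add (hyx.add hηg) hηn
    have h3 : ∫ ω, inner ℝ ((y i k ω - x ω) +
        (-ηl) • (gradient (f i) (y i k ω) - ci i ω + c ω)) ((-ηl) • n i k ω) ∂P = 0 := by
      simp only [inner_smul_right]
      rw [integral_const_mul]
      have h4 := H.noise_step i k
      simp only [sub_eq_add_neg (y i k _ - x _), ← neg_smul] at h4
      rw [h4, mul_zero]
    simp only [Pi.add_apply] at h2
    rw [h3, meanSq_smul] at h2
    rw [neg_sq, mul_zero, add_zero] at h2
    rw [show (fun ω => y i (k + 1) ω - x ω) = fun ω => ((y i k ω - x ω) +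
        (-ηl) • (gradient (f i) (y i k ω) - ci i ω + c ω)) + (-ηl) • n i k ω from
      funext fun ω => by rw [H.y_succ]; module]
    exact h2
  -- Parameter K keeps the growth per step at 1 + O(1/K), so that K steps grow by a constant factor.
  have h2 := meanSq_add_le hyx hηg (show (0 : ℝ) < K by positivity)
  rw [meanSq_smul, neg_sq] at h2
  have h3 : meanSq P (fun ω => gradient (f i) (y i k ω) - ci i ω + c ω) ≤
      2 * (β ^ 2 * meanSq P (fun ω => y i k ω - x ω)) + 2 * directionSq P f x c ci i := by
    have h4 := meanSq_add_le_two hgd hgx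
    have h5 := meanSq_le_of_norm_sq_le hgd hyx
      (fun ω => (hs i).norm_sq_gradient_sub_le (y i k ω) (x ω))
    rw [show (fun ω => gradient (f i) (y i k ω) - ci i ω + c ω) = fun ω =>
        (gradient (f i) (y i k ω) - gradient (f i) (x ω)) +
        (gradient (f i) (x ω) - ci i ω + c ω) from funext fun ω => by abel]
    refine h4.trans ?_
    rw [directionSq]
    linarith
  have hE : 0 ≤ meanSq P (fun ω => y i k ω - x ω) := meanSq_nonneg
  have hG : 0 ≤ ηl ^ 2 * meanSq P (fun ω => gradient (f i) (y i k ω) - ci i ω + c ω) :=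
    mul_nonneg (sq_nonneg _) meanSq_nonneg
  have hV : 0 ≤ directionSq P f x c ci i := meanSq_nonneg
  have hn := mul_le_mul_of_nonneg_left (H.meanSq_noise_le i k) (sq_nonneg ηl)
  set E := meanSq P (fun ω => y i k ω - x ω)
  set V := directionSq P f x c ci i
  have h6 : (1 + (K : ℝ)) * (ηl ^ 2 *
      meanSq P (fun ω => gradient (f i) (y i k ω) - ci i ω + c ω)) ≤
      1 / K * E + 4 * K * ηl ^ 2 * V := by
    calc (1 + (K : ℝ)) * (ηl ^ 2 *
      meanSq P (fun ω => gradient (f i) (y i k ω) - ci i ω + c ω))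
        ≤ (K + (K : ℝ)) * (ηl ^ 2 * (2 * (β ^ 2 * E) + 2 * V)) := by gcongr
      _ = 1 / K * (4 * (K * ηl * β) ^ 2 * E) + 4 * K * ηl ^ 2 * V := by field_simp; ring
      _ ≤ 1 / K * (1 * E) + 4 * K * ηl ^ 2 * V := by gcongr
      _ = _ := by rw [one_mul]
  rw [h1]
  have h7 : (1 + 2 / (K : ℝ)) * E = (1 + 1 / K) * E + 1 / K * E := by ring
  linarith

/-- The one-step recursion is unrolled: (1 + 2/K)^K ≤ e² < 8, and at most K increments accumulate,
which gives 32 = 8 · 4 and 8. -/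
theorem meanSq_drift_le (H : IsRound P f σ ηl x c ci y n) (hs : ∀ i, IsSmooth β (f i))
    (hK : 1 ≤ K) (hη : 4 * (K * ηl * β) ^ 2 ≤ 1) (i : Fin N) {k : ℕ} (hk : k ≤ K) :
    meanSq P (fun ω => y i k ω - x ω) ≤
      32 * (K * ηl) ^ 2 * directionSq P f x c ci i + 8 * K * ηl ^ 2 * σ ^ 2 := by
  have hK' : (1 : ℝ) ≤ K := by exact_mod_cast hK
  have hV : 0 ≤ directionSq P f x c ci i := meanSq_nonneg
  set b := 4 * K * ηl ^ 2 * directionSq P f x c ci i + ηl ^ 2 * σ ^ 2 with hb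
  have hb0 : 0 ≤ b := by positivity
  have h1 : ∀ k : ℕ, meanSq P (fun ω => y i k ω - x ω) ≤ (1 + 2 / (K : ℝ)) ^ k * (k * b) := by
    intro k
    induction k with
    | zero => simp [H.y_zero, meanSq]
    | succ k ih =>
      refine (H.meanSq_drift_succ_le hs hK hη i k).trans ?_
      have h2 : 1 ≤ (1 + 2 / (K : ℝ)) ^ (k + 1) :=
        one_le_pow₀ (le_add_of_nonneg_right (by positivity))
      calc (1 + 2 / (K : ℝ)) * meanSq P (fun ω => y i k ω - x ω) + b
          ≤ (1 + 2 / (K : ℝ)) * ((1 + 2 / (K : ℝ)) ^ k * (k * b))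
            + (1 + 2 / (K : ℝ)) ^ (k + 1) * b := by
              gcongr
              exact le_mul_of_one_le_left hb0 h2
        _ = _ := by push_cast; ring
  have h3 : (1 + 2 / (K : ℝ)) ^ k ≤ 8 := by
    calc (1 + 2 / (K : ℝ)) ^ k ≤ (1 + 2 / (K : ℝ)) ^ K :=
          pow_le_pow_right₀ (le_add_of_nonneg_right (by positivity)) hk
      _ ≤ Real.exp (2 / K) ^ K := by
          gcongr
          rw [add_comm]
          exact Real.add_one_le_exp _
      _ = Real.exp 1 ^ 2 := by
          rw [← Real.exp_nat_mul, ← Real.exp_nat_mul]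
          congr 1
          field_simp
          norm_num
      _ ≤ 2.7182818286 ^ 2 := by
          gcongr
          exact Real.exp_one_lt_d9.le
      _ ≤ 8 := by norm_num
  calc meanSq P (fun ω => y i k ω - x ω) ≤ (1 + 2 / (K : ℝ)) ^ k * (k * b) := h1 k
    _ ≤ 8 * (K * b) := by gcongr
    _ = _ := by rw [hb]; ring

/-- The mean drift of the local models during the round. -/
def drift (P : Measure Ω) (N K : ℕ) (x : Ω → Vec d) (y : Fin N → ℕ → Ω → Vec d) : ℝ :=
  clientAverage N K (fun i k => meanSq P (fun ω => y i k ω - x ω))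

theorem drift_nonneg : 0 ≤ drift P N K x y := clientAverage_nonneg fun _ _ => meanSq_nonneg

theorem drift_le (H : IsRound P f σ ηl x c ci y n) (hs : ∀ i, IsSmooth β (f i))
    (hN : 1 ≤ N) (hK : 1 ≤ K) (hη : 4 * (K * ηl * β) ^ 2 ≤ 1) :
    drift P N K x y ≤ (K * ηl) ^ 2 *
      (32 * ((1 / (N : ℝ)) * ∑ i, directionSq P f x c ci i) + 8 * (σ ^ 2 / K)) := by
  have hK' : (K : ℝ) ≠ 0 := by positivity
  refine (clientAverage_mono fun i k hk => H.meanSq_drift_le hs hK hη i hk.le).trans (le_of_eq ?_)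
  rw [clientAverage_add, clientAverage_const' hN hK, clientAverage_const hK, ← Finset.mul_sum]
  field_simp

theorem meanSq_gradient_sub_le (H : IsRound P f σ ηl x c ci y n) (hs : ∀ i, IsSmooth β (f i))
    (i : Fin N) (k : ℕ) :
    meanSq P (fun ω => gradient (f i) (y i k ω) - gradient (f i) (x ω)) ≤
      β ^ 2 * meanSq P (fun ω => y i k ω - x ω) :=
  meanSq_le_of_norm_sq_le (((hs i).memLp_gradient (H.memLp_y i k)).sub
    ((hs i).memLp_gradient H.memLp_x)) ((H.memLp_y i k).sub H.memLp_x)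
    fun ω => (hs i).norm_sq_gradient_sub_le (y i k ω) (x ω)

/-! ### Averaged noise and the aggregated direction -/

theorem meanSq_noise_average_le (H : IsRound P f σ ηl x c ci y n) (hK : 1 ≤ K) (i : Fin N) :
    meanSq P (fun ω => (1 / (K : ℝ)) • ∑ k ∈ Finset.range K, n i k ω) ≤ σ ^ 2 / K := by
  have hK' : (0 : ℝ) < K := by positivity
  rw [meanSq_smul, meanSq_sum_of_orthogonal _ (H.memLp_noise i) fun k _ l _ hkl =>
    H.noise_pair i k i l (by simpa using hkl)]
  calc (1 / (K : ℝ)) ^ 2 * ∑ k ∈ Finset.range K, meanSq P (n i k)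
      ≤ (1 / (K : ℝ)) ^ 2 * ∑ k ∈ Finset.range K, σ ^ 2 := by
        gcongr with k _
        exact H.meanSq_noise_le i k
    _ = σ ^ 2 / K := by simp; field_simp

/-- The N K noises of a round are pairwise orthogonal, across clients as well as across steps. This
is the source of the factor 1/(NK) in front of σ². -/
theorem meanSq_noise_clientAverage_le (H : IsRound P f σ ηl x c ci y n) (hN : 1 ≤ N)
    (hK : 1 ≤ K) :
    meanSq P (fun ω => clientAverage N K (fun i k => n i k ω)) ≤ σ ^ 2 / K * (1 / N) := by
  have hK' : (0 : ℝ) < K := by positivity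
  have hN' : (0 : ℝ) < N := by positivity
  have h1 : (fun ω => clientAverage N K (fun i k => n i k ω)) = fun ω =>
      (1 / (N : ℝ) * (1 / K)) • ∑ t ∈ Finset.univ ×ˢ Finset.range K, n t.1 t.2 ω := by
    funext ω
    rw [clientAverage, ← Finset.smul_sum, smul_smul, Finset.sum_product]
  rw [h1, meanSq_smul, meanSq_sum_of_orthogonal _ (W := fun t : Fin N × ℕ => n t.1 t.2)
    (fun t => H.memLp_noise t.1 t.2) fun t _ u _ htu => H.noise_pair t.1 t.2 u.1 u.2 htu]
  calc (1 / (N : ℝ) * (1 / K)) ^ 2 *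
        ∑ t ∈ (Finset.univ : Finset (Fin N)) ×ˢ Finset.range K, meanSq P (n t.1 t.2)
      ≤ (1 / (N : ℝ) * (1 / K)) ^ 2 *
        ∑ t ∈ (Finset.univ : Finset (Fin N)) ×ˢ Finset.range K, σ ^ 2 := by
        gcongr with t _
        exact H.meanSq_noise_le t.1 t.2
    _ = _ := by simp; field_simp

theorem integral_inner_noise_clientAverage (H : IsRound P f σ ηl x c ci y n) {φ : Vec d → Vec d}
    (hφ : Measurable φ) (hφx : MemLp (fun ω => φ (x ω)) 2 P) :
    ∫ ω, inner ℝ (φ (x ω)) (clientAverage N K (fun i k => n i k ω)) ∂P = 0 := by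
  simp only [inner_clientAverage]
  rw [integral_clientAverage fun i k => integrable_inner_of_memLp hφx (H.memLp_noise i k)]
  simp [H.noise_start _ _ φ hφ hφx, clientAverage]

theorem clientAverage_gradient (hs : ∀ i, IsSmooth β (f i)) (hK : 1 ≤ K) (v : Vec d) :
    clientAverage N K (fun i _ => gradient (f i) v) = gradient (objective f) v := by
  have hK' : (K : ℝ) ≠ 0 := by positivity
  rw [gradient_objective fun i => (hs i).1, clientAverage]
  congr 1
  refine Finset.sum_congr rfl fun i _ => ?_
  rw [Finset.sum_const, Finset.card_range, ← Nat.cast_smul_eq_nsmul ℝ, smul_smul,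
    one_div_mul_cancel hK', one_smul]

theorem meanSq_clientAverage_gradient_sub_le (H : IsRound P f σ ηl x c ci y n)
    (hs : ∀ i, IsSmooth β (f i)) (hN : 1 ≤ N) (hK : 1 ≤ K) :
    meanSq P (fun ω => clientAverage N K (fun i k => gradient (f i) (y i k ω)) -
      gradient (objective f) (x ω)) ≤ β ^ 2 * drift P N K x y := by
  simp only [← clientAverage_gradient hs hK, ← clientAverage_sub]
  refine (meanSq_clientAverage_le hN hK fun i k =>
    ((hs i).memLp_gradient (H.memLp_y i k)).sub ((hs i).memLp_gradient H.memLp_x)).trans ?_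
  rw [drift, ← smul_eq_mul (β ^ 2), ← clientAverage_smul]
  exact clientAverage_mono fun i k _ => H.meanSq_gradient_sub_le hs i k

/-- The aggregated direction of the round. -/
def direction (f : Fin N → Vec d → ℝ) (K : ℕ) (y n : Fin N → ℕ → Ω → Vec d) (ω : Ω) : Vec d :=
  clientAverage N K (fun i k => gradient (f i) (y i k ω) + n i k ω)

theorem memLp_direction (H : IsRound P f σ ηl x c ci y n) (hs : ∀ i, IsSmooth β (f i)) :
    MemLp (direction f K y n) 2 P :=
  memLp_clientAverage fun i k => ((hs i).memLp_gradient (H.memLp_y i k)).add (H.memLp_noise i k)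

/-- The noise is separated with a factor 2 and not by orthogonality: later local gradients depend on
earlier noise, so the cross term need not vanish. -/
theorem meanSq_direction_le (H : IsRound P f σ ηl x c ci y n)
    (hs : ∀ i, IsSmooth β (f i)) (hN : 1 ≤ N) (hK : 1 ≤ K) :
    meanSq P (direction f K y n) ≤ 4 * β ^ 2 * drift P N K x y +
      4 * meanSq P (fun ω => gradient (objective f) (x ω)) + 2 * (σ ^ 2 / K * (1 / N)) := by
  have hA : MemLp (fun ω => clientAverage N K (fun i k => gradient (f i) (y i k ω))) 2 P :=
    memLp_clientAverage fun i k => (hs i).memLp_gradient (H.memLp_y i k)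
  have hG : MemLp (fun ω => gradient (objective f) (x ω)) 2 P :=
    (IsSmooth.objective hN hs).memLp_gradient H.memLp_x
  have hn : MemLp (fun ω => clientAverage N K (fun i k => n i k ω)) 2 P :=
    memLp_clientAverage H.memLp_noise
  have h1 := meanSq_add_le_two hA hn
  have h2 := meanSq_add_le_two (hA.sub hG) hG
  have h3 := H.meanSq_noise_clientAverage_le hN hK
  have h4 := H.meanSq_clientAverage_gradient_sub_le hs hN hK
  simp only [Pi.sub_apply, sub_add_cancel] at h2
  change _ ≤ 2 * meanSq P (fun ω => clientAverage N K (fun i k => gradient (f i) (y i k ω)) -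
    gradient (objective f) (x ω)) + _ at h2
  have h5 : direction f K y n = fun ω => clientAverage N K (fun i k => gradient (f i) (y i k ω)) +
      clientAverage N K (fun i k => n i k ω) := funext fun ω => clientAverage_add _ _
  rw [h5]
  linarith

/-- Against a function of the starting point alone all noise of the round averages out, although the
gradients in the direction still depend on it. -/
theorem integral_inner_direction (H : IsRound P f σ ηl x c ci y n)
    (hs : ∀ i, IsSmooth β (f i)) {φ : Vec d → Vec d}
    (hφ : Measurable φ) (hφx : MemLp (fun ω => φ (x ω)) 2 P) :
    ∫ ω, inner ℝ (φ (x ω)) (direction f K y n ω) ∂P =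
      ∫ ω, inner ℝ (φ (x ω)) (clientAverage N K (fun i k => gradient (f i) (y i k ω))) ∂P := by
  simp only [direction, clientAverage_add, inner_add_right]
  rw [integral_add (integrable_inner_of_memLp hφx (memLp_clientAverage fun i k =>
    (hs i).memLp_gradient (H.memLp_y i k))) (integrable_inner_of_memLp hφx
    (memLp_clientAverage H.memLp_noise)), H.integral_inner_noise_clientAverage hφ hφx, add_zero]

/-! ### Refreshed control variates -/

/-- The new control variate of client `i`, before masking. -/
def clientDirection (f : Fin N → Vec d → ℝ) (K : ℕ) (y n : Fin N → ℕ → Ω → Vec d) (i : Fin N)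
    (ω : Ω) : Vec d :=
  (1 / (K : ℝ)) • ∑ k ∈ Finset.range K, (gradient (f i) (y i k ω) + n i k ω)

theorem memLp_clientDirection (H : IsRound P f σ ηl x c ci y n) (hs : ∀ i, IsSmooth β (f i))
    (i : Fin N) : MemLp (clientDirection f K y n i) 2 P :=
  memLp_smul _ (memLp_finset_sum _ fun k _ =>
    ((hs i).memLp_gradient (H.memLp_y i k)).add (H.memLp_noise i k))

theorem clientDirection_eq (hK : 1 ≤ K) (i : Fin N) (ω : Ω) :
    clientDirection f K y n i ω = (1 / (K : ℝ)) • ∑ k ∈ Finset.range K,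
      (gradient (f i) (y i k ω) - gradient (f i) (x ω)) + gradient (f i) (x ω) +
        (1 / (K : ℝ)) • ∑ k ∈ Finset.range K, n i k ω := by
  have hK' : (K : ℝ) ≠ 0 := by positivity
  rw [clientDirection, Finset.sum_add_distrib, Finset.sum_sub_distrib, Finset.sum_const,
    Finset.card_range, ← Nat.cast_smul_eq_nsmul ℝ, smul_add, smul_sub, smul_smul,
    one_div_mul_cancel hK', one_smul, sub_add_cancel]

theorem memLp_average_gradient_sub (H : IsRound P f σ ηl x c ci y n)
    (hs : ∀ i, IsSmooth β (f i)) (i : Fin N) :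
    MemLp (fun ω => (1 / (K : ℝ)) • ∑ k ∈ Finset.range K,
      (gradient (f i) (y i k ω) - gradient (f i) (x ω))) 2 P :=
  memLp_smul _ (memLp_finset_sum _ fun k _ =>
    ((hs i).memLp_gradient (H.memLp_y i k)).sub ((hs i).memLp_gradient H.memLp_x))

theorem meanSq_average_gradient_sub_le (H : IsRound P f σ ηl x c ci y n)
    (hs : ∀ i, IsSmooth β (f i)) (hK : 1 ≤ K) (i : Fin N) :
    meanSq P (fun ω => (1 / (K : ℝ)) • ∑ k ∈ Finset.range K,
      (gradient (f i) (y i k ω) - gradient (f i) (x ω))) ≤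
      β ^ 2 * ((1 / (K : ℝ)) * ∑ k ∈ Finset.range K, meanSq P (fun ω => y i k ω - x ω)) := by
  refine (meanSq_average_le hK (Finset.card_range K) fun k _ =>
    ((hs i).memLp_gradient (H.memLp_y i k)).sub ((hs i).memLp_gradient H.memLp_x)).trans ?_
  rw [mul_left_comm, Finset.mul_sum _ _ (β ^ 2)]
  gcongr with k _
  exact H.meanSq_gradient_sub_le hs i k

/-- The variance is at most the second moment about 0. -/
theorem norm_sq_average_sub_le {N : ℕ} (hN : 1 ≤ N) (u : Fin N → Vec d) :
    (1 / (N : ℝ)) * ∑ i, ‖(1 / (N : ℝ)) • ∑ j, u j - u i‖ ^ 2 ≤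
      (1 / (N : ℝ)) * ∑ i, ‖u i‖ ^ 2 := by
  have hN' : (0 : ℝ) < N := by positivity
  refine mul_le_mul_of_nonneg_left ?_ (by positivity)
  set w := (1 / (N : ℝ)) • ∑ j, u j with hw
  have h1 : ∑ j, u j = (N : ℝ) • w := by
    rw [hw, smul_smul, mul_one_div_cancel hN'.ne', one_smul]
  have h2 : ∑ i, inner ℝ w (u i) = N * ‖w‖ ^ 2 := by
    rw [← inner_sum, h1, inner_smul_right, real_inner_self_eq_norm_sq]
  simp only [norm_sub_sq_real, Finset.sum_add_distrib, Finset.sum_sub_distrib, ← Finset.mul_sum,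
    h2, Finset.sum_const, Finset.card_univ, Fintype.card_fin, nsmul_eq_mul]
  nlinarith [mul_nonneg hN'.le (sq_nonneg ‖w‖)]

theorem meanSq_average_sub_le (hN : 1 ≤ N) {u : Fin N → Ω → Vec d} (hu : ∀ i, MemLp (u i) 2 P) :
    (1 / (N : ℝ)) * ∑ i, meanSq P (fun ω => (1 / (N : ℝ)) • ∑ j, u j ω - u i ω) ≤
      (1 / (N : ℝ)) * ∑ i, meanSq P (u i) := by
  have hw : ∀ i, MemLp (fun ω => (1 / (N : ℝ)) • ∑ j, u j ω - u i ω) 2 P := fun i =>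
    (memLp_smul _ (memLp_finset_sum _ fun j _ => hu j)).sub (hu i)
  simp only [meanSq]
  rw [← integral_finsetSum _ fun i _ => integrable_norm_sq (hw i), ← integral_const_mul,
    ← integral_finsetSum _ fun i _ => integrable_norm_sq (hu i), ← integral_const_mul]
  exact integral_mono ((integrable_finsetSum _ fun i _ => integrable_norm_sq (hw i)).const_mul _)
    ((integrable_finsetSum _ fun i _ => integrable_norm_sq (hu i)).const_mul _)
    fun ω => norm_sq_average_sub_le hN _

end IsRound

/-! ### Progress in one communication round -/

/-- Mean-square distance of the control variates to the masked vectors `V i`. -/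
def controlError {Ω : Type*} [MeasurableSpace Ω] (P : Measure Ω) {d N : ℕ} (p : Finset (Fin d))
    (V ci : Fin N → Ω → Vec d) : ℝ :=
  (1 / (N : ℝ)) * ∑ i, meanSq P (fun ω => ci i ω - mask p (V i ω))

theorem controlError_nonneg {Ω : Type*} [MeasurableSpace Ω] {P : Measure Ω} {d N : ℕ}
    {p : Finset (Fin d)} {V ci : Fin N → Ω → Vec d} : 0 ≤ controlError P p V ci :=
  mul_nonneg (by positivity) (Finset.sum_nonneg fun _ _ => meanSq_nonneg)

theorem heterogeneity_nonneg {d N : ℕ} (q : Finset (Fin d)) (f : Fin N → Vec d → ℝ) (x : Vec d) :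
    0 ≤ heterogeneity q f x :=
  mul_nonneg (by positivity) (Finset.sum_nonneg fun _ _ => sq_nonneg _)

namespace IsRound

variable {Ω : Type*} [MeasurableSpace Ω] {P : Measure Ω} [IsProbabilityMeasure P] {d N K : ℕ}
  {f : Fin N → Vec d → ℝ} {β σ ηl μ : ℝ} {x c : Ω → Vec d} {ci : Fin N → Ω → Vec d}
  {y n : Fin N → ℕ → Ω → Vec d} {p : Finset (Fin d)} {xs : Vec d}

theorem average_meanSq_le_integral {W : Fin N → Ω → Vec d} (hW : ∀ i, MemLp (W i) 2 P)
    {F : Ω → ℝ} (hF : Integrable F P)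
    (h : ∀ ω, (1 / (N : ℝ)) * ∑ i, ‖W i ω‖ ^ 2 ≤ F ω) :
    (1 / (N : ℝ)) * ∑ i, meanSq P (W i) ≤ ∫ ω, F ω ∂P := by
  simp only [meanSq]
  rw [← integral_finsetSum _ fun i _ => integrable_norm_sq (hW i), ← integral_const_mul]
  exact integral_mono ((integrable_finsetSum _ fun i _ => integrable_norm_sq (hW i)).const_mul _)
    hF h

theorem average_le_three {a b₁ b₂ b₃ : Fin N → ℝ}
    (h : ∀ i, a i ≤ 3 * b₁ i + 3 * b₂ i + 3 * b₃ i) :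
    (1 / (N : ℝ)) * ∑ i, a i ≤ 3 * ((1 / (N : ℝ)) * ∑ i, b₁ i) +
      3 * ((1 / (N : ℝ)) * ∑ i, b₂ i) + 3 * ((1 / (N : ℝ)) * ∑ i, b₃ i) := by
  calc (1 / (N : ℝ)) * ∑ i, a i
      ≤ (1 / (N : ℝ)) * ∑ i, (3 * b₁ i + 3 * b₂ i + 3 * b₃ i) := by
        gcongr with i _
        exact h i
    _ = _ := by simp only [Finset.sum_add_distrib, ← Finset.mul_sum]; ring

/-- Old control variates appear only through the drift, because the new ones are built from
gradients of the round. Masking is linear and does not increase norms, so the unmasked difference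
can be split into drift, change of reference and averaged noise. -/
theorem controlError_clientDirection_le (H : IsRound P f σ ηl x c ci y n)
    (hs : ∀ i, IsSmooth β (f i)) (hN : 1 ≤ N) (hK : 1 ≤ K) {V : Fin N → Ω → Vec d}
    (hV : ∀ i, MemLp (V i) 2 P) :
    controlError P p V (fun i ω => mask p (clientDirection f K y n i ω)) ≤
      3 * (β ^ 2 * drift P N K x y) +
        3 * ((1 / (N : ℝ)) * ∑ i, meanSq P (fun ω => gradient (f i) (x ω) - V i ω)) +
        3 * (σ ^ 2 / K) := by
  have hN' : (N : ℝ) ≠ 0 := by positivity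
  have h1 : ∀ i, meanSq P (fun ω => mask p (clientDirection f K y n i ω) - mask p (V i ω)) ≤
      3 * (β ^ 2 * ((1 / (K : ℝ)) * ∑ k ∈ Finset.range K, meanSq P (fun ω => y i k ω - x ω))) +
      3 * meanSq P (fun ω => gradient (f i) (x ω) - V i ω) + 3 * (σ ^ 2 / K) := by
    intro i
    have hd := (H.memLp_clientDirection (K := K) hs i).sub (hV i)
    have h2 := meanSq_mask_le p hd (memLp_mask p hd)
    simp only [Pi.sub_apply, mask_sub] at h2
    refine h2.trans ?_
    have h3 := meanSq_add_le_three (H.memLp_average_gradient_sub (K := K) hs i)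
      (((hs i).memLp_gradient H.memLp_x).sub (hV i))
      (memLp_smul (1 / (K : ℝ)) (memLp_finset_sum (Finset.range K) fun k _ => H.memLp_noise i k))
    have h4 : clientDirection f K y n i - V i = fun ω => (1 / (K : ℝ)) •
        ∑ k ∈ Finset.range K, (gradient (f i) (y i k ω) - gradient (f i) (x ω)) +
        ((fun ω => gradient (f i) (x ω)) - V i) ω +
        (1 / (K : ℝ)) • ∑ k ∈ Finset.range K, n i k ω := by
      funext ω
      rw [Pi.sub_apply, clientDirection_eq (x := x) hK, Pi.sub_apply]
      abel
    rw [h4]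
    refine h3.trans ?_
    have h5 := H.meanSq_average_gradient_sub_le hs hK i
    have h6 := H.meanSq_noise_average_le hK i
    change _ + 3 * meanSq P (fun ω => gradient (f i) (x ω) - V i ω) + _ ≤ _
    linarith
  refine (average_le_three h1).trans (le_of_eq ?_)
  rw [drift, clientAverage]
  simp only [smul_eq_mul, ← Finset.mul_sum, Finset.sum_const, Finset.card_univ, Fintype.card_fin,
    nsmul_eq_mul]
  field_simp

/-! #### Convex objectives -/

/-- With u_i = c_i - p ⊙ ∇f_i(x*), the first direction is (∇f_i(x) - ∇f_i(x*)) + (1-p) ⊙ ∇f_i(x*) +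
(mean of u - u_i). The masked gradients at x* average to zero, so c is the mean of the u_j, and of
the gradients at x* only the complementary block survives. -/
theorem average_directionSq_le_of_convex (H : IsRound P f σ ηl x c ci y n)
    (hs : ∀ i, IsSmooth β (f i)) (hβ : 0 < β) (hN : 1 ≤ N) (hc : ∀ i, IsMuConvex 0 (f i))
    (hmin : ∀ x, objective f xs ≤ objective f x) :
    (1 / (N : ℝ)) * ∑ i, directionSq P f x c ci i ≤
      3 * (2 * β * ∫ ω, (objective f (x ω) - objective f xs) ∂P) +
        3 * heterogeneity pᶜ f xs +
        3 * controlError P p (fun i _ => gradient (f i) xs) ci := by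
  have hN' : (N : ℝ) ≠ 0 := by positivity
  have hu : ∀ i, MemLp (fun ω => ci i ω - mask p (gradient (f i) xs)) 2 P :=
    fun i => (H.memLp_ci i).sub (memLp_const _)
  have hW : ∀ i, MemLp (fun ω => gradient (f i) (x ω) - gradient (f i) xs) 2 P :=
    fun i => ((hs i).memLp_gradient H.memLp_x).sub (memLp_const _)
  have hsum : (1 / (N : ℝ)) • ∑ i, mask p (gradient (f i) xs) = 0 := by
    have h0 := gradient_eq_zero_of_forall_le hmin
    rw [gradient_objective fun i => (hs i).1] at h0
    rw [← mask_sum, ← mask_smul, h0, mask_zero]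
  have h1 : ∀ i, directionSq P f x c ci i ≤
      3 * meanSq P (fun ω => gradient (f i) (x ω) - gradient (f i) xs) +
      3 * ‖mask pᶜ (gradient (f i) xs)‖ ^ 2 +
      3 * meanSq P (fun ω => (1 / (N : ℝ)) • ∑ j, (ci j ω - mask p (gradient (f j) xs)) -
        (ci i ω - mask p (gradient (f i) xs))) := by
    intro i
    have h2 := meanSq_add_le_three (hW i) (memLp_const (mask pᶜ (gradient (f i) xs)))
      ((memLp_smul (1 / (N : ℝ)) (memLp_finset_sum Finset.univ fun j _ => hu j)).sub (hu i))
    have h3 : (fun ω => gradient (f i) (x ω) - ci i ω + c ω) = fun ω =>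
        (gradient (f i) (x ω) - gradient (f i) xs) + mask pᶜ (gradient (f i) xs) +
        ((1 / (N : ℝ)) • ∑ j, (ci j ω - mask p (gradient (f j) xs)) -
        (ci i ω - mask p (gradient (f i) xs))) := by
      funext ω
      rw [Finset.sum_sub_distrib, smul_sub, hsum, ← H.c_eq, sub_zero]
      rw [← sub_eq_of_eq_add' (mask_add_mask_compl p (gradient (f i) xs)).symm]
      abel
    rw [directionSq, h3]
    refine h2.trans (le_of_eq ?_)
    simp [meanSq]
  refine (average_le_three h1).trans ?_
  have h4 := average_meanSq_le_integral hW
    (F := fun ω => 2 * β * (objective f (x ω) - objective f xs))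
    ((((IsSmooth.objective hN hs).integrable_comp H.memLp_x).sub (integrable_const _)).const_mul _)
    fun ω => sum_norm_sq_gradient_sub_le hN hβ hs hc hmin (x ω)
  rw [integral_const_mul] at h4
  have h5 := meanSq_average_sub_le hN hu
  rw [heterogeneity, controlError]
  linarith

/-- Perturbed strong convexity is applied to every client and local step, with the gradient at the
local model, and then averaged. -/
theorem le_integral_inner_direction (H : IsRound P f σ ηl x c ci y n)
    (hs : ∀ i, IsSmooth β (f i)) (hN : 1 ≤ N) (hK : 1 ≤ K)
    (hμ : 0 ≤ μ) (hμβ : μ ≤ β) (hc : ∀ i, IsMuConvex μ (f i)) :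
    ∫ ω, (objective f (x ω) - objective f xs) ∂P + μ / 4 * meanSq P (fun ω => x ω - xs) -
      β * drift P N K x y ≤ ∫ ω, inner ℝ (x ω - xs) (direction f K y n ω) ∂P := by
  have hx : MemLp (fun ω => x ω - xs) 2 P := H.memLp_x.sub (memLp_const _)
  have hd : ∀ i k, MemLp (fun ω => y i k ω - x ω) 2 P :=
    fun i k => (H.memLp_y i k).sub H.memLp_x
  have ho : Integrable (fun ω => objective f (x ω) - objective f xs) P :=
    ((IsSmooth.objective hN hs).integrable_comp H.memLp_x).sub (integrable_const _)
  have hD : Integrable (fun ω => μ / 4 * ‖x ω - xs‖ ^ 2) P := (integrable_norm_sq hx).const_mul _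
  have hE : Integrable (fun ω => β * clientAverage N K (fun i k => ‖y i k ω - x ω‖ ^ 2)) P :=
    (integrable_clientAverage fun i k => integrable_norm_sq (hd i k)).const_mul _
  rw [H.integral_inner_direction hs (φ := fun v => v - xs) (by fun_prop) hx, drift]
  simp only [meanSq]
  rw [← integral_clientAverage fun i k => integrable_norm_sq (hd i k), ← integral_const_mul,
    ← integral_const_mul, ← integral_add ho hD,
    ← integral_sub (f := fun ω => objective f (x ω) - objective f xs + μ / 4 * ‖x ω - xs‖ ^ 2)
      (ho.add hD) hE]
  refine integral_mono ((ho.add hD).sub hE) (integrable_inner_of_memLp hx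
    (memLp_clientAverage fun i k => (hs i).memLp_gradient (H.memLp_y i k))) fun ω => ?_
  simp only [inner_clientAverage]
  have h1 : clientAverage N K (fun i k => (f i (x ω) - f i xs) + μ / 4 * ‖x ω - xs‖ ^ 2 -
      β * ‖y i k ω - x ω‖ ^ 2) ≤
      clientAverage N K (fun i k => inner ℝ (x ω - xs) (gradient (f i) (y i k ω))) :=
    clientAverage_mono fun i k _ => by
      rw [real_inner_comm]
      exact (hc i).inner_gradient_ge hμ hμβ (hs i) (x ω) (y i k ω) xs
  refine le_trans (le_of_eq ?_) h1
  have h2 := clientAverage_smul (N := N) (K := K) β (fun i k => ‖y i k ω - x ω‖ ^ 2)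
  simp only [smul_eq_mul] at h2
  rw [clientAverage_sub, clientAverage_add, clientAverage_const' hN hK, clientAverage_const hK,
    h2, Finset.sum_sub_distrib, mul_sub]
  rfl

theorem meanSq_server_le_of_convex (H : IsRound P f σ ηl x c ci y n)
    (hs : ∀ i, IsSmooth β (f i)) (hβ : 0 < β) (hN : 1 ≤ N) (hK : 1 ≤ K)
    (hμ : 0 ≤ μ) (hμβ : μ ≤ β) (hc : ∀ i, IsMuConvex μ (f i))
    (hmin : ∀ x, objective f xs ≤ objective f x) {t : ℝ} (ht : 0 ≤ t) :
    meanSq P (fun ω => x ω - t • direction f K y n ω - xs) ≤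
      (1 - μ * t / 2) * meanSq P (fun ω => x ω - xs)
      - 2 * t * ∫ ω, (objective f (x ω) - objective f xs) ∂P
      + 2 * t * (β * drift P N K x y)
      + t ^ 2 * (4 * β ^ 2 * drift P N K x y
        + 8 * β * ∫ ω, (objective f (x ω) - objective f xs) ∂P + 2 * (σ ^ 2 / K * (1 / N))) := by
  have hx : MemLp (fun ω => x ω - xs) 2 P := H.memLp_x.sub (memLp_const _)
  have hso := IsSmooth.objective hN hs
  have h1 := meanSq_add hx (memLp_smul (-t) (H.memLp_direction (K := K) hs))
  rw [meanSq_smul] at h1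
  simp only [inner_smul_right] at h1
  rw [integral_const_mul] at h1
  have h2 : (fun ω => x ω - t • direction f K y n ω - xs) =
      fun ω => (x ω - xs) + (-t) • direction f K y n ω := by
    funext ω; module
  have h3 := H.le_integral_inner_direction (xs := xs) hs hN hK hμ hμβ hc
  have h4 := H.meanSq_direction_le hs hN hK
  have h5 : meanSq P (fun ω => gradient (objective f) (x ω)) ≤
      2 * β * ∫ ω, (objective f (x ω) - objective f xs) ∂P := by
    rw [← integral_const_mul]
    exact integral_mono (integrable_norm_sq (hso.memLp_gradient H.memLp_x))
      (((hso.integrable_comp H.memLp_x).sub (integrable_const _)).const_mul _)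
      fun ω => hso.norm_sq_gradient_le hβ hmin (x ω)
  rw [h2, h1]
  have h6 := mul_le_mul_of_nonneg_left h3 ht
  have h7 := mul_le_mul_of_nonneg_left (h4.trans (add_le_add_left
    (add_le_add_right (mul_le_mul_of_nonneg_left h5 (show (0 : ℝ) ≤ 4 by norm_num)) _) _))
    (sq_nonneg t)
  linarith

/-- The budget of one round. Here ν = 1/N, s = σ²/K, e is the suboptimality, z the heterogeneity, E
the drift, V the mean square first direction and U the control error. Smallness of βt makes the
feedback from U through E back to the potential a fraction of its own weight L U. -/
theorem convex_potential_arith {D D' U U' e E V s z ν β μ t : ℝ} (ht : 0 ≤ t) (hβ : 0 < β)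
    (hμβ : μ ≤ β) (hbt : 1000 * (β * t) ≤ 1) (hν0 : 0 ≤ ν) (hν : ν ≤ 1)
    (he : 0 ≤ e) (hz : 0 ≤ z) (hs : 0 ≤ s) (hU : 0 ≤ U) (hE0 : 0 ≤ E)
    (hE : E ≤ t ^ 2 * ν * (32 * V + 8 * s)) (hV : V ≤ 3 * (2 * β * e) + 3 * z + 3 * U)
    (hD : D' ≤ (1 - μ * t / 2) * D - 2 * t * e + 2 * t * (β * E)
      + t ^ 2 * (4 * β ^ 2 * E + 8 * β * e + 2 * (s * ν)))
    (hU' : U' ≤ 3 * (β ^ 2 * E) + 3 * (2 * β * e) + 3 * s) :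
    D' + t ^ 2 * ν * U' ≤ (1 - μ * t / 2) * (D + t ^ 2 * ν * U) - t * e
      + 6 * t ^ 2 * (s * ν + z) := by
  set L := t ^ 2 * ν with hL
  have hL0 : 0 ≤ L := by positivity
  have hb0 : 0 ≤ β * t := by positivity
  have hte : 0 ≤ t * e := by positivity
  have hLt : L ≤ t ^ 2 := by nlinarith [sq_nonneg t]
  -- drift terms
  have h0 : E ≤ 192 * (β * L * e) + 96 * (L * z) + 96 * (L * U) + 8 * (L * s) := by
    nlinarith [mul_le_mul_of_nonneg_left hV hL0]
  have h1 : t * (β * E) ≤ 1 / 1000 * E := by nlinarith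
  have hbb : (β * t) ^ 2 ≤ 1 / 1000 := by nlinarith
  have h2 : t ^ 2 * (β ^ 2 * E) ≤ 1 / 1000 * E := by
    have := mul_le_mul_of_nonneg_right hbb hE0
    linarith
  have h3 : L * (β ^ 2 * E) ≤ 1 / 1000 * E :=
    (mul_le_mul_of_nonneg_right hLt (by positivity)).trans h2
  -- suboptimality terms
  have h4 : t ^ 2 * (β * e) ≤ 1 / 1000 * (t * e) := by
    have := mul_le_mul_of_nonneg_right (show β * t ≤ 1 / 1000 by linarith) hte
    linarith
  have h5 : L * (β * e) ≤ 1 / 1000 * (t * e) :=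
    (mul_le_mul_of_nonneg_right hLt (by positivity)).trans h4
  have h6 := mul_le_mul_of_nonneg_left hU' hL0
  have h7 : μ * t / 2 * (L * U) ≤ 1 / 2000 * (L * U) := by
    have : μ * t ≤ 1 / 1000 := by nlinarith [mul_le_mul_of_nonneg_right hμβ ht]
    exact mul_le_mul_of_nonneg_right (by linarith) (by positivity)
  -- The factor ν on the heterogeneity is given away here; the convex bounds are stated without it.
  have h8 : L * z ≤ t ^ 2 * z := mul_le_mul_of_nonneg_right hLt hz
  have h9 : 0 ≤ t ^ 2 * z := by positivity
  have h10 : 0 ≤ L * s := by positivity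
  have h11 : 0 ≤ L * U := by positivity
  have h12 : t ^ 2 * (s * ν) = L * s := by rw [hL]; ring
  linarith

/-- Contraction of the convex potential in one round. -/
theorem convex_potential_le (H : IsRound P f σ ηl x c ci y n)
    (hs : ∀ i, IsSmooth β (f i)) (hβ : 0 < β) (hN : 1 ≤ N) (hK : 1 ≤ K) (hηl : 0 ≤ ηl)
    (hμ : 0 ≤ μ) (hμβ : μ ≤ β) (hc : ∀ i, IsMuConvex μ (f i))
    (hmin : ∀ x, objective f xs ≤ objective f x) (hη : 1000 * (β * (K * ηl * √N)) ≤ 1) :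
    meanSq P (fun ω => x ω - (K * ηl * √N) • direction f K y n ω - xs) +
      (K * ηl) ^ 2 * controlError P p (fun i _ => gradient (f i) xs)
        (fun i ω => mask p (clientDirection f K y n i ω)) ≤
    (1 - μ * (K * ηl * √N) / 2) * (meanSq P (fun ω => x ω - xs) +
      (K * ηl) ^ 2 * controlError P p (fun i _ => gradient (f i) xs) ci)
      - (K * ηl * √N) * ∫ ω, (objective f (x ω) - objective f xs) ∂P
      + 6 * (K * ηl * √N) ^ 2 * (σ ^ 2 / K * (1 / N) + heterogeneity pᶜ f xs) := by
  have hN' : (1 : ℝ) ≤ N := by exact_mod_cast hN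
  have hsq : (√N : ℝ) ^ 2 = N := Real.sq_sqrt (by positivity)
  have hsq1 : 1 ≤ √(N : ℝ) := Real.one_le_sqrt.2 hN'
  have hKη : 0 ≤ K * ηl := by positivity
  -- This is where the server step √N matters: the weight of the control error becomes t²/N, so its
  -- noise σ²/K joins the noise σ²/(KN) of the direction.
  have hL : (K * ηl * √N) ^ 2 * (1 / N) = (K * ηl) ^ 2 := by
    rw [mul_pow, hsq]; field_simp
  have hη' : 4 * (K * ηl * β) ^ 2 ≤ 1 := by
    have h1 : K * ηl * β ≤ K * ηl * √N * β := by
      nlinarith [mul_nonneg hKη hβ.le]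
    have h2 : 0 ≤ K * ηl * β := by positivity
    nlinarith
  have h0 : ∀ i, IsMuConvex 0 (f i) := fun i => (hc i).mono hμ
  have hU := H.controlError_clientDirection_le (p := p) hs hN hK
    (V := fun i _ => gradient (f i) xs) fun i => memLp_const _
  have h3 := average_meanSq_le_integral
    (W := fun i ω => gradient (f i) (x ω) - gradient (f i) xs)
    (fun i => ((hs i).memLp_gradient H.memLp_x).sub (memLp_const _))
    (F := fun ω => 2 * β * (objective f (x ω) - objective f xs))
    ((((IsSmooth.objective hN hs).integrable_comp H.memLp_x).sub (integrable_const _)).const_mul _)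
    fun ω => sum_norm_sq_gradient_sub_le hN hβ hs h0 hmin (x ω)
  rw [integral_const_mul] at h3
  rw [← hL]
  refine convex_potential_arith (E := drift P N K x y)
    (V := (1 / (N : ℝ)) * ∑ i, directionSq P f x c ci i)
    (by positivity) hβ hμβ hη (by positivity) (by rw [div_le_one (by positivity)]; exact hN')
    (integral_nonneg fun ω => sub_nonneg.2 (hmin _)) (heterogeneity_nonneg _ _ _) (by positivity)
    controlError_nonneg drift_nonneg ?_ (H.average_directionSq_le_of_convex hs hβ hN h0 hmin)
    (H.meanSq_server_le_of_convex hs hβ hN hK hμ hμβ hc hmin (by positivity)) ?_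
  · rw [hL]
    exact H.drift_le hs hN hK hη'
  · exact hU.trans (by linarith)

/-! #### Non-convex objectives -/

/-- The reference is now the gradient at the current x, so the masked gradients average to p ⊙ ∇f(x)
instead of zero. This replaces the suboptimality term of the convex case. -/
theorem average_directionSq_le (H : IsRound P f σ ηl x c ci y n)
    (hs : ∀ i, IsSmooth β (f i)) (hN : 1 ≤ N) {z : ℝ}
    (hz : ∀ v, heterogeneity pᶜ f v ≤ z) :
    (1 / (N : ℝ)) * ∑ i, directionSq P f x c ci i ≤
      3 * z + 3 * controlError P p (fun i ω => gradient (f i) (x ω)) ci +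
        3 * meanSq P (fun ω => gradient (objective f) (x ω)) := by
  have hN' : (N : ℝ) ≠ 0 := by positivity
  have hg : ∀ i, MemLp (fun ω => gradient (f i) (x ω)) 2 P :=
    fun i => (hs i).memLp_gradient H.memLp_x
  have hG : MemLp (fun ω => gradient (objective f) (x ω)) 2 P :=
    (IsSmooth.objective hN hs).memLp_gradient H.memLp_x
  have hu : ∀ i, MemLp (fun ω => ci i ω - mask p (gradient (f i) (x ω))) 2 P :=
    fun i => (H.memLp_ci i).sub (memLp_mask p (hg i))
  have h1 : ∀ i, directionSq P f x c ci i ≤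
      3 * meanSq P (fun ω => mask pᶜ (gradient (f i) (x ω))) +
      3 * meanSq P (fun ω => (1 / (N : ℝ)) • ∑ j, (ci j ω - mask p (gradient (f j) (x ω))) -
        (ci i ω - mask p (gradient (f i) (x ω)))) +
      3 * meanSq P (fun ω => gradient (objective f) (x ω)) := by
    intro i
    have h2 := meanSq_add_le_three (memLp_mask pᶜ (hg i))
      ((memLp_smul (1 / (N : ℝ)) (memLp_finset_sum Finset.univ fun j _ => hu j)).sub (hu i))
      (memLp_mask p hG)
    have h3 : (fun ω => gradient (f i) (x ω) - ci i ω + c ω) = fun ω =>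
        mask pᶜ (gradient (f i) (x ω)) +
        ((1 / (N : ℝ)) • ∑ j, (ci j ω - mask p (gradient (f j) (x ω))) -
        (ci i ω - mask p (gradient (f i) (x ω)))) + mask p (gradient (objective f) (x ω)) := by
      funext ω
      rw [Finset.sum_sub_distrib, smul_sub, ← H.c_eq, gradient_objective fun i => (hs i).1,
        mask_smul, mask_sum]
      nth_rewrite 1 [← mask_add_mask_compl p (gradient (f i) (x ω))]
      abel
    have h4 := meanSq_mask_le p hG (memLp_mask p hG)
    rw [directionSq, h3]
    refine h2.trans ?_
    change _ + 3 * meanSq P (fun ω => (1 / (N : ℝ)) •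
      ∑ j, (ci j ω - mask p (gradient (f j) (x ω))) -
        (ci i ω - mask p (gradient (f i) (x ω)))) + _ ≤ _
    linarith
  refine (average_le_three h1).trans ?_
  have h4 := average_meanSq_le_integral (fun i => memLp_mask pᶜ (hg i)) (integrable_const z)
    fun ω => hz (x ω)
  simp only [integral_const, probReal_univ, smul_eq_mul, one_mul] at h4
  have h5 := meanSq_average_sub_le hN hu
  rw [controlError]
  simp only [Finset.sum_const, Finset.card_univ, Fintype.card_fin, nsmul_eq_mul,
    ← mul_assoc (1 / (N : ℝ)), one_div_mul_cancel hN', one_mul] at h4 h5 ⊢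
  linarith

theorem integral_objective_server_le (H : IsRound P f σ ηl x c ci y n)
    (hs : ∀ i, IsSmooth β (f i)) (hβ : 0 < β) (hN : 1 ≤ N) (hK : 1 ≤ K) {t : ℝ} (ht : 0 ≤ t) :
    ∫ ω, objective f (x ω - t • direction f K y n ω) ∂P ≤
      ∫ ω, objective f (x ω) ∂P
      - t * (1 / 2 * meanSq P (fun ω => gradient (objective f) (x ω))
        - 1 / 2 * (β ^ 2 * drift P N K x y))
      + β / 2 * (t ^ 2 * (4 * β ^ 2 * drift P N K x y +
        4 * meanSq P (fun ω => gradient (objective f) (x ω)) + 2 * (σ ^ 2 / K * (1 / N)))) := by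
  have hso := IsSmooth.objective hN hs
  have hd := H.memLp_direction (K := K) hs
  have hG := hso.memLp_gradient H.memLp_x
  have hA : MemLp (fun ω => clientAverage N K (fun i k => gradient (f i) (y i k ω))) 2 P :=
    memLp_clientAverage fun i k => (hs i).memLp_gradient (H.memLp_y i k)
  have hI := (integrable_inner_of_memLp hG hd).const_mul t
  have hQ := (integrable_norm_sq hd).const_mul (β / 2 * t ^ 2)
  have hF := hso.integrable_comp H.memLp_x
  have h1 : ∫ ω, objective f (x ω - t • direction f K y n ω) ∂P ≤
      ∫ ω, (objective f (x ω) - t * inner ℝ (gradient (objective f) (x ω)) (direction f K y n ω)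
        + β / 2 * t ^ 2 * ‖direction f K y n ω‖ ^ 2) ∂P := by
    refine integral_mono (hso.integrable_comp (H.memLp_x.sub (memLp_smul t hd)))
      ((hF.sub hI).add hQ) fun ω => ?_
    have := hso.le_add_inner (x ω) (x ω - t • direction f K y n ω)
    rw [sub_sub_cancel_left, inner_neg_right, inner_smul_right, norm_neg, norm_smul, mul_pow,
      Real.norm_eq_abs, sq_abs] at this
    linarith
  rw [integral_add (f := fun ω => objective f (x ω) - t * inner ℝ (gradient (objective f) (x ω))
    (direction f K y n ω)) (hF.sub hI) hQ, integral_sub hF hI, integral_const_mul,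
    integral_const_mul, H.integral_inner_direction hs
      (φ := gradient (objective f)) hso.continuous_gradient.measurable hG] at h1
  -- Polarisation: ⟨G, A⟩ ≥ ‖G‖²/2 - ‖A - G‖²/2, after dropping ‖A‖²/2.
  have h2 : 1 / 2 * meanSq P (fun ω => gradient (objective f) (x ω)) - 1 / 2 *
      meanSq P (fun ω => clientAverage N K (fun i k => gradient (f i) (y i k ω)) -
        gradient (objective f) (x ω)) ≤ ∫ ω, inner ℝ (gradient (objective f) (x ω))
        (clientAverage N K (fun i k => gradient (f i) (y i k ω))) ∂P := by
    have hAG : MemLp (fun ω => clientAverage N K (fun i k => gradient (f i) (y i k ω)) -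
        gradient (objective f) (x ω)) 2 P := hA.sub hG
    simp only [meanSq]
    rw [← integral_const_mul, ← integral_const_mul, ← integral_sub
      ((integrable_norm_sq hG).const_mul _) ((integrable_norm_sq hAG).const_mul _)]
    refine integral_mono (((integrable_norm_sq hG).const_mul _).sub
      ((integrable_norm_sq hAG).const_mul _)) (integrable_inner_of_memLp hG hA) fun ω => ?_
    have := norm_sub_sq_real (clientAverage N K (fun i k => gradient (f i) (y i k ω)))
      (gradient (objective f) (x ω))
    rw [real_inner_comm] at this
    dsimp only
    nlinarith [sq_nonneg ‖clientAverage N K (fun i k => gradient (f i) (y i k ω))‖]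
  have h3 := H.meanSq_clientAverage_gradient_sub_le hs hN hK
  have h4 := H.meanSq_direction_le hs hN hK
  have h5 := mul_le_mul_of_nonneg_left (h2.trans' (sub_le_sub_left
    (mul_le_mul_of_nonneg_left h3 (by norm_num)) _)) ht
  have h6 := mul_le_mul_of_nonneg_left h4 (show 0 ≤ β / 2 * t ^ 2 by positivity)
  rw [meanSq] at h6
  linarith

/-- The same feedback argument, with G the mean square gradient. The heterogeneity z enters only
through the drift, and its factor ν = 1/N is kept. Of the decrease t G/2, half is reserved for drift
and for the motion of the reference gradients. -/
theorem nonconvex_potential_arith {F F' U U' G E V s z ν β t : ℝ} (ht : 0 ≤ t) (hβ : 0 < β)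
    (hbt : 1000 * (β * t) ≤ 1) (hν0 : 0 ≤ ν) (hν : ν ≤ 1)
    (hG : 0 ≤ G) (hz : 0 ≤ z) (hs : 0 ≤ s) (hU : 0 ≤ U) (hE0 : 0 ≤ E)
    (hE : E ≤ t ^ 2 * ν * (32 * V + 8 * s)) (hV : V ≤ 3 * z + 3 * U + 3 * G)
    (hF : F' ≤ F - t * (1 / 2 * G - 1 / 2 * (β ^ 2 * E))
      + β / 2 * (t ^ 2 * (4 * β ^ 2 * E + 4 * G + 2 * (s * ν))))
    (hU' : U' ≤ 3 * (β ^ 2 * E) + 3 * (β ^ 2 * (t ^ 2 * (4 * β ^ 2 * E + 4 * G + 2 * (s * ν))))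
      + 3 * s) :
    F' + β * (t ^ 2 * ν) * U' ≤ F + β * (t ^ 2 * ν) * U - t / 4 * G
      + 6 * β * t ^ 2 * (s * ν + z * ν) := by
  set L := t ^ 2 * ν with hL
  have hL0 : 0 ≤ L := by positivity
  have hb0 : 0 ≤ β * t := by positivity
  have hbt' : β * t ≤ 1 / 1000 := by linarith
  have hLt : L ≤ t ^ 2 := by nlinarith [sq_nonneg t]
  have hbb : (β * t) ^ 2 ≤ 1 / 1000 := by nlinarith
  have hbL : β ^ 2 * L ≤ 1 / 1000 := by nlinarith [sq_nonneg β]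
  have hbL0 : 0 ≤ β ^ 2 * L := by positivity
  set W := 4 * β ^ 2 * E + 4 * G + 2 * (s * ν) with hW
  have hβE : 0 ≤ β * E := by positivity
  have htG : 0 ≤ t * G := by positivity
  have hLs : 0 ≤ β * (L * s) := by positivity
  have hLz : 0 ≤ β * (L * z) := by positivity
  have hLU : 0 ≤ β * (L * U) := by positivity
  have h0 : β * E ≤ 96 * (β * (L * z)) + 96 * (β * (L * U)) + 96 * (β * (L * G))
      + 8 * (β * (L * s)) := by
    have := mul_le_mul_of_nonneg_left (hE.trans (mul_le_mul_of_nonneg_left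
      (show 32 * V + 8 * s ≤ 32 * (3 * z + 3 * U + 3 * G) + 8 * s by linarith) hL0)) hβ.le
    linarith
  have hLG : β * (L * G) ≤ 1 / 1000 * (t * G) := by
    have h1 := mul_le_mul_of_nonneg_right hLt (mul_nonneg hβ.le hG)
    have h2 := mul_le_mul_of_nonneg_right hbt' htG
    linarith
  have hLG0 : 0 ≤ β * (L * G) := by positivity
  have h1 : t * (β ^ 2 * E) ≤ 1 / 1000 * (β * E) := by
    have := mul_le_mul_of_nonneg_right hbt' hβE
    linarith
  have h2 : β * t ^ 2 * W ≤ 4 / 1000 * (β * E) + 4 / 1000 * (t * G) + 2 * (β * (L * s)) := by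
    have e1 := mul_le_mul_of_nonneg_right hbb hβE
    have e2 := mul_le_mul_of_nonneg_right hbt' htG
    have e3 : β * t ^ 2 * (s * ν) = β * (L * s) := by rw [hL]; ring
    rw [hW]
    linarith
  have hW0 : 0 ≤ β * t ^ 2 * W := by positivity
  have h3 : β * L * U' ≤ 3 / 1000 * (β * E) + 3 / 1000 * (β * t ^ 2 * W) + 3 * (β * (L * s)) := by
    have e1 := mul_le_mul_of_nonneg_left hU' (mul_nonneg hβ.le hL0)
    have e2 := mul_le_mul_of_nonneg_right hbL hβE
    have e3 := mul_le_mul_of_nonneg_right hbL hW0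
    linarith
  have h4 : 6 * β * t ^ 2 * (s * ν + z * ν) = 6 * (β * (L * s)) + 6 * (β * (L * z)) := by
    rw [hL]; ring
  rw [h4]
  linarith

/-- Decrease of the non-convex potential in one round. -/
theorem nonconvex_potential_le (H : IsRound P f σ ηl x c ci y n)
    (hs : ∀ i, IsSmooth β (f i)) (hβ : 0 < β) (hN : 1 ≤ N) (hK : 1 ≤ K) (hηl : 0 ≤ ηl)
    {z : ℝ} (hz : ∀ v, heterogeneity pᶜ f v ≤ z) (hη : 1000 * (β * (K * ηl * √N)) ≤ 1) :
    ∫ ω, objective f (x ω - (K * ηl * √N) • direction f K y n ω) ∂P +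
      β * (K * ηl) ^ 2 * controlError P p
        (fun i ω => gradient (f i) (x ω - (K * ηl * √N) • direction f K y n ω))
        (fun i ω => mask p (clientDirection f K y n i ω)) ≤
    ∫ ω, objective f (x ω) ∂P +
      β * (K * ηl) ^ 2 * controlError P p (fun i ω => gradient (f i) (x ω)) ci
      - (K * ηl * √N) / 4 * meanSq P (fun ω => gradient (objective f) (x ω))
      + 6 * β * (K * ηl * √N) ^ 2 * (σ ^ 2 / K * (1 / N) + z * (1 / N)) := by
  have hN' : (1 : ℝ) ≤ N := by exact_mod_cast hN
  have hsq : (√N : ℝ) ^ 2 = N := Real.sq_sqrt (by positivity)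
  have hsq1 : 1 ≤ √(N : ℝ) := Real.one_le_sqrt.2 hN'
  have hKη : 0 ≤ K * ηl := by positivity
  have hL : (K * ηl * √N) ^ 2 * (1 / N) = (K * ηl) ^ 2 := by
    rw [mul_pow, hsq]; field_simp
  have hη' : 4 * (K * ηl * β) ^ 2 ≤ 1 := by
    have h1 : K * ηl * β ≤ K * ηl * √N * β := by
      nlinarith [mul_nonneg hKη hβ.le]
    have h2 : 0 ≤ K * ηl * β := by positivity
    nlinarith
  have hd := H.memLp_direction (K := K) hs
  have hx' : MemLp (fun ω => x ω - (K * ηl * √N) • direction f K y n ω) 2 P :=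
    H.memLp_x.sub (memLp_smul _ hd)
  have hU := H.controlError_clientDirection_le (p := p) hs hN hK
    (V := fun i ω => gradient (f i) (x ω - (K * ηl * √N) • direction f K y n ω))
    fun i => (hs i).memLp_gradient hx'
  -- The new control error is measured at the new server model; the shift of the reference gradients
  -- costs β² times the squared server move.
  have h3 : (1 / (N : ℝ)) * ∑ i, meanSq P (fun ω => gradient (f i) (x ω) -
      gradient (f i) (x ω - (K * ηl * √N) • direction f K y n ω)) ≤
      β ^ 2 * ((K * ηl * √N) ^ 2 * meanSq P (direction f K y n)) := by
    have h4 : ∀ i, meanSq P (fun ω => gradient (f i) (x ω) -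
        gradient (f i) (x ω - (K * ηl * √N) • direction f K y n ω)) ≤
        β ^ 2 * ((K * ηl * √N) ^ 2 * meanSq P (direction f K y n)) := by
      intro i
      rw [← meanSq_smul]
      refine meanSq_le_of_norm_sq_le (((hs i).memLp_gradient H.memLp_x).sub
        ((hs i).memLp_gradient hx')) (memLp_smul _ hd) fun ω => ?_
      have := (hs i).norm_sq_gradient_sub_le (x ω)
        (x ω - (K * ηl * √N) • direction f K y n ω)
      rwa [sub_sub_cancel] at this
    refine (mul_le_mul_of_nonneg_left (Finset.sum_le_sum fun i _ => h4 i)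
      (by positivity)).trans (le_of_eq ?_)
    rw [Finset.sum_const, Finset.card_univ, Fintype.card_fin, nsmul_eq_mul, ← mul_assoc,
      one_div_mul_cancel (by positivity), one_mul]
  have hdir := H.meanSq_direction_le hs hN hK
  rw [← hL]
  refine nonconvex_potential_arith (E := drift P N K x y)
    (V := (1 / (N : ℝ)) * ∑ i, directionSq P f x c ci i)
    (by positivity) hβ hη (by positivity) (by rw [div_le_one (by positivity)]; exact hN')
    meanSq_nonneg ((heterogeneity_nonneg pᶜ f 0).trans (hz 0)) (by positivity)
    controlError_nonneg drift_nonneg ?_ (H.average_directionSq_le hs hN hz)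
    (H.integral_objective_server_le hs hβ hN hK (by positivity)) ?_
  · rw [hL]
    exact H.drift_le hs hN hK hη'
  · have := h3.trans (mul_le_mul_of_nonneg_left (mul_le_mul_of_nonneg_left hdir
      (sq_nonneg (K * ηl * √N))) (sq_nonneg β))
    exact hU.trans (by linarith)

end IsRound

/-! ### The run of the algorithm -/

section Sampling

variable {N : ℕ} {S Ω : Type*} [MeasurableSpace S]

theorem measurable_const_smul_vec {Ω : Type*} {m : MeasurableSpace Ω} {d : ℕ} {X : Ω → Vec d}
    (a : ℝ) (hX : Measurable[m] X) : Measurable[m] (fun ω => a • X ω) :=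
  hX.const_smul a

theorem measurable_smul_sum_vec {Ω ι : Type*} {m : MeasurableSpace Ω} {d : ℕ} (s : Finset ι)
    {X : ι → Ω → Vec d} (a : ℝ) (hX : ∀ i ∈ s, Measurable[m] (X i)) :
    Measurable[m] (fun ω => a • ∑ i ∈ s, X i ω) :=
  measurable_const_smul_vec a (Finset.measurable_fun_sum s hX)

/-- The information contained in the samples with index in `T`. -/
@[reducible]
def samplesIn (ξ : ℕ → Fin N → ℕ → Ω → S) (T : Set (ℕ × Fin N × ℕ)) : MeasurableSpace Ω :=
  ⨆ t ∈ T, MeasurableSpace.comap (ξ t.1 t.2.1 t.2.2) inferInstance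

theorem samplesIn_mono (ξ : ℕ → Fin N → ℕ → Ω → S) {T T' : Set (ℕ × Fin N × ℕ)} (h : T ⊆ T') :
    samplesIn ξ T ≤ samplesIn ξ T' :=
  biSup_mono h

theorem measurable_samplesIn (ξ : ℕ → Fin N → ℕ → Ω → S) {T : Set (ℕ × Fin N × ℕ)}
    {t : ℕ × Fin N × ℕ} (ht : t ∈ T) : Measurable[samplesIn ξ T] (ξ t.1 t.2.1 t.2.2) :=
  (comap_measurable (ξ t.1 t.2.1 t.2.2)).mono
    (le_biSup (fun t : ℕ × Fin N × ℕ =>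
      MeasurableSpace.comap (ξ t.1 t.2.1 t.2.2) inferInstance) ht) le_rfl

variable [mΩ : MeasurableSpace Ω] {P : Measure Ω} {D : Fin N → Measure S}
  {ξ : ℕ → Fin N → ℕ → Ω → S}

theorem IsSampling.samplesIn_le (hξ : IsSampling P D ξ) (T : Set (ℕ × Fin N × ℕ)) :
    samplesIn ξ T ≤ mΩ :=
  iSup₂_le fun t _ => (hξ.measurable t.1 t.2.1 t.2.2).comap_le

theorem IsSampling.indep_samplesIn (hξ : IsSampling P D ξ)
    {T : Set (ℕ × Fin N × ℕ)} {r : ℕ} {i : Fin N} {k : ℕ} (ht : (r, i, k) ∉ T) :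
    Indep (samplesIn ξ T) (MeasurableSpace.comap (ξ r i k) inferInstance) P := by
  have h := indep_iSup_of_disjoint (fun t : ℕ × Fin N × ℕ =>
    (hξ.measurable t.1 t.2.1 t.2.2).comap_le) hξ.indep (Set.disjoint_singleton_right.2 ht)
  simpa [samplesIn] using h

theorem IsSampling.isProbabilityMeasure [IsProbabilityMeasure P] (hξ : IsSampling P D ξ)
    (i : Fin N) : IsProbabilityMeasure (D i) := by
  rw [← hξ.law 0 i 0]
  exact Measure.isProbabilityMeasure_map (hξ.measurable 0 i 0).aemeasurable

end Sampling

/-! ### Closed form of the local steps -/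

section LocalModel

variable {d : ℕ} {S : Type*}

theorem localModel_eq (g : Vec d → S → Vec d) (ηl : ℝ) (x ci c : Vec d) (s : ℕ → S) (k : ℕ) :
    localModel g ηl x ci c s k = x - ηl • (∑ j ∈ Finset.range k,
      g (localModel g ηl x ci c s j) (s j) - (k : ℝ) • (ci - c)) := by
  induction k with
  | zero => simp [localModel]
  | succ k ih =>
    rw [localModel, Finset.sum_range_succ]
    nth_rewrite 1 [ih]
    push_cast
    module

end LocalModel

/-- A random state that depends only on the samples of the first `r` rounds, is
square-integrable, has masked client control variates, and whose server control variate is the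
mean of the client control variates. -/
structure IsState {Ω S : Type*} [MeasurableSpace S] [MeasurableSpace Ω] (P : Measure Ω) {d N : ℕ}
    (p : Finset (Fin d)) (ξ : ℕ → Fin N → ℕ → Ω → S) (r : ℕ) (st : Ω → State d N) : Prop where
  measurable_x : Measurable[samplesIn ξ {t | t.1 ≤ r}] (fun ω => (st ω).x)
  measurable_ci : ∀ i, Measurable[samplesIn ξ {t | t.1 ≤ r}] (fun ω => (st ω).ci i)
  memLp_x : MemLp (fun ω => (st ω).x) 2 P
  memLp_ci : ∀ i, MemLp (fun ω => (st ω).ci i) 2 P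
  c_eq : ∀ ω, (st ω).c = (1 / (N : ℝ)) • ∑ i, (st ω).ci i
  mask_ci : ∀ i ω, mask p ((st ω).ci i) = (st ω).ci i

/-- The local models of the round that starts from the state `st`. -/
def localModels {Ω S : Type*} {d N : ℕ} (g : Fin N → Vec d → S → Vec d) (ηl : ℝ)
    (s : Fin N → ℕ → Ω → S) (st : Ω → State d N) (i : Fin N) (k : ℕ) (ω : Ω) : Vec d :=
  localModel (g i) ηl (st ω).x ((st ω).ci i) (st ω).c (fun k => s i k ω) k

/-- The gradient noise of the round that starts from the state `st`. -/
def localNoise {Ω S : Type*} {d N : ℕ} (f : Fin N → Vec d → ℝ) (g : Fin N → Vec d → S → Vec d)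
    (ηl : ℝ) (s : Fin N → ℕ → Ω → S) (st : Ω → State d N) (i : Fin N) (k : ℕ) (ω : Ω) : Vec d :=
  g i (localModels g ηl s st i k ω) (s i k ω) - gradient (f i) (localModels g ηl s st i k ω)

/-- The samples that are used before local step `k` of client `i` in round `r + 1`. -/
def before {N : ℕ} (r : ℕ) (i : Fin N) (k : ℕ) : Set (ℕ × Fin N × ℕ) :=
  {t | t.1 ≤ r ∨ (t.1 = r + 1 ∧ t.2.1 = i ∧ t.2.2 < k)}

/-! ### From the algorithm to an abstract round -/

namespace IsState

variable {Ω S : Type*} [MeasurableSpace S] [MeasurableSpace Ω] {P : Measure Ω}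
  [IsProbabilityMeasure P] {d N K : ℕ} {p : Finset (Fin d)} {ξ : ℕ → Fin N → ℕ → Ω → S} {r : ℕ}
  {st : Ω → State d N} {f : Fin N → Vec d → ℝ} {g : Fin N → Vec d → S → Vec d}
  {D : Fin N → Measure S} {β σ ηl : ℝ}

theorem subset_before (r : ℕ) (i : Fin N) (k : ℕ) : {t : ℕ × Fin N × ℕ | t.1 ≤ r} ⊆ before r i k :=
  fun _ => Or.inl

theorem measurable_c (H : IsState P p ξ r st) :
    Measurable[samplesIn ξ {t | t.1 ≤ r}] (fun ω => (st ω).c) := by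
  simp only [H.c_eq]
  exact measurable_smul_sum_vec _ _ fun i _ => H.measurable_ci i

theorem memLp_c (H : IsState P p ξ r st) : MemLp (fun ω => (st ω).c) 2 P := by
  simp only [H.c_eq]
  exact memLp_smul _ (memLp_finset_sum _ fun i _ => H.memLp_ci i)

/-- Sample k is first used to form model k + 1, so model k depends only on strictly earlier samples
of its client and on previous rounds. This leaves sample k fresh. -/
theorem measurable_localModels (H : IsState P p ξ r st)
    (hg : ∀ i, IsStochasticGradient (D i) (f i) (g i) σ) (i : Fin N) (k : ℕ) :
    Measurable[samplesIn ξ (before r i k)] (localModels g ηl (ξ (r + 1)) st i k) := by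
  induction k with
  | zero => exact H.measurable_x.mono (samplesIn_mono ξ (subset_before r i 0)) le_rfl
  | succ k ih =>
    have hle := samplesIn_mono ξ (subset_before (N := N) r i (k + 1))
    have h1 : Measurable[samplesIn ξ (before r i (k + 1))]
        (localModels g ηl (ξ (r + 1)) st i k) :=
      ih.mono (samplesIn_mono ξ fun t ht => ht.imp_right fun h => ⟨h.1, h.2.1, by omega⟩) le_rfl
    have h2 : Measurable[samplesIn ξ (before r i (k + 1))] (ξ (r + 1) i k) :=
      measurable_samplesIn ξ (t := (r + 1, i, k)) (Or.inr ⟨rfl, rfl, Nat.lt_succ_self k⟩)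
    exact h1.sub ((((hg i).measurable.comp (h1.prodMk h2)).sub
      ((H.measurable_ci i).mono hle le_rfl)).add (H.measurable_c.mono hle le_rfl) |>.const_smul ηl)

theorem notMem_before (r : ℕ) (i : Fin N) (k : ℕ) : (r + 1, i, k) ∉ before r i k := by
  simp [before]

/-- The variance bound is uniform in the point, so square-integrability of the local models is not
needed; it is deduced from this lemma afterwards. -/
theorem memLp_localNoise (H : IsState P p ξ r st) (hs : ∀ i, IsSmooth β (f i))
    (hg : ∀ i, IsStochasticGradient (D i) (f i) (g i) σ) (hξ : IsSampling P D ξ)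
    (i : Fin N) (k : ℕ) : MemLp (localNoise f g ηl (ξ (r + 1)) st i k) 2 P :=
  have := hξ.isProbabilityMeasure i
  (hg i).memLp_noise (hs i) (hξ.samplesIn_le _) (hξ.indep_samplesIn (notMem_before r i k))
    (hξ.measurable _ _ _) (hξ.law _ _ _) (H.measurable_localModels hg i k)

theorem localModels_succ (i : Fin N) (k : ℕ) (ω : Ω) :
    localModels g ηl (ξ (r + 1)) st i (k + 1) ω = localModels g ηl (ξ (r + 1)) st i k ω -
      ηl • (gradient (f i) (localModels g ηl (ξ (r + 1)) st i k ω) +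
        localNoise f g ηl (ξ (r + 1)) st i k ω - (st ω).ci i + (st ω).c) := by
  rw [localNoise, add_sub_cancel]
  rfl

theorem memLp_localModels (H : IsState P p ξ r st) (hs : ∀ i, IsSmooth β (f i))
    (hg : ∀ i, IsStochasticGradient (D i) (f i) (g i) σ) (hξ : IsSampling P D ξ)
    (i : Fin N) (k : ℕ) : MemLp (localModels g ηl (ξ (r + 1)) st i k) 2 P := by
  induction k with
  | zero => exact H.memLp_x
  | succ k ih =>
    rw [show localModels g ηl (ξ (r + 1)) st i (k + 1) = _ from
      funext (localModels_succ (f := f) i k)]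
    exact ih.sub (memLp_smul _ (((((hs i).memLp_gradient ih).add
      (H.memLp_localNoise hs hg hξ i k)).sub (H.memLp_ci i)).add H.memLp_c))

/-- The noise of a local step is orthogonal to everything that does not use its sample. -/
theorem integral_inner_localNoise (H : IsState P p ξ r st) (hs : ∀ i, IsSmooth β (f i))
    (hg : ∀ i, IsStochasticGradient (D i) (f i) (g i) σ) (hξ : IsSampling P D ξ)
    {i : Fin N} {k : ℕ} {T : Set (ℕ × Fin N × ℕ)} (hT : before r i k ⊆ T)
    (hiT : (r + 1, i, k) ∉ T) {Z : Ω → Vec d} (hZ : Measurable[samplesIn ξ T] Z)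
    (hZ2 : MemLp Z 2 P) :
    ∫ ω, inner ℝ (Z ω) (localNoise f g ηl (ξ (r + 1)) st i k ω) ∂P = 0 :=
  have := hξ.isProbabilityMeasure i
  (hg i).integral_inner_noise (hs i) (hξ.samplesIn_le T) (hξ.indep_samplesIn hiT)
    (hξ.measurable _ _ _) (hξ.law _ _ _)
    ((H.measurable_localModels hg i k).mono (samplesIn_mono ξ hT) le_rfl) hZ hZ2

theorem measurable_localNoise (H : IsState P p ξ r st) (hs : ∀ i, IsSmooth β (f i))
    (hg : ∀ i, IsStochasticGradient (D i) (f i) (g i) σ) (i : Fin N) (k : ℕ) :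
    Measurable[samplesIn ξ (before r i (k + 1))] (localNoise f g ηl (ξ (r + 1)) st i k) := by
  have h1 : Measurable[samplesIn ξ (before r i (k + 1))]
      (localModels g ηl (ξ (r + 1)) st i k) :=
    (H.measurable_localModels hg i k).mono
      (samplesIn_mono ξ fun t ht => ht.imp_right fun h => ⟨h.1, h.2.1, by omega⟩) le_rfl
  have h2 : Measurable[samplesIn ξ (before r i (k + 1))] (ξ (r + 1) i k) :=
    measurable_samplesIn ξ (t := (r + 1, i, k)) (Or.inr ⟨rfl, rfl, Nat.lt_succ_self k⟩)
  exact ((hg i).measurable_noise (hs i)).comp (h1.prodMk h2)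

theorem integral_inner_localNoise_localNoise (H : IsState P p ξ r st)
    (hs : ∀ i, IsSmooth β (f i)) (hg : ∀ i, IsStochasticGradient (D i) (f i) (g i) σ)
    (hξ : IsSampling P D ξ) {i j : Fin N} {k l : ℕ} (h : i ≠ j ∨ k < l) :
    ∫ ω, inner ℝ (localNoise f g ηl (ξ (r + 1)) st i k ω)
      (localNoise f g ηl (ξ (r + 1)) st j l ω) ∂P = 0 := by
  -- The set must contain what determines the point of the second noise and also the whole first
  -- noise, yet miss the sample (r + 1, j, l). This holds for another client or an earlier step.
  refine H.integral_inner_localNoise hs hg hξ (T := before r j l ∪ before r i (k + 1))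
    Set.subset_union_left ?_ ((H.measurable_localNoise hs hg i k).mono
      (samplesIn_mono ξ Set.subset_union_right) le_rfl) (H.memLp_localNoise hs hg hξ i k)
  rintro (h' | h')
  · exact notMem_before r j l h'
  · simp only [before, Set.mem_ofPred_eq] at h'
    rcases h with h | h
    · exact h (by rcases h' with h' | h' <;> [omega; exact h'.2.1.symm])
    · omega

theorem isRound (H : IsState P p ξ r st) (hs : ∀ i, IsSmooth β (f i))
    (hg : ∀ i, IsStochasticGradient (D i) (f i) (g i) σ) (hξ : IsSampling P D ξ) :
    IsRound P f σ ηl (fun ω => (st ω).x) (fun ω => (st ω).c) (fun i ω => (st ω).ci i)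
      (localModels g ηl (ξ (r + 1)) st) (localNoise f g ηl (ξ (r + 1)) st) where
  memLp_x := H.memLp_x
  memLp_ci := H.memLp_ci
  memLp_y := H.memLp_localModels hs hg hξ
  memLp_noise := H.memLp_localNoise hs hg hξ
  c_eq := H.c_eq
  y_zero _ := rfl
  y_succ := localModels_succ
  meanSq_noise_le i k :=
    have := hξ.isProbabilityMeasure i
    (hg i).meanSq_noise_le (hs i) (hξ.samplesIn_le _) (hξ.indep_samplesIn (notMem_before r i k))
      (hξ.measurable _ _ _) (hξ.law _ _ _) (H.measurable_localModels hg i k)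
  noise_step i k := by
    have hle := samplesIn_mono ξ (subset_before (N := N) r i k)
    have h1 := H.measurable_localModels (ηl := ηl) hg i k
    have h2 := H.memLp_localModels (ηl := ηl) hs hg hξ i k
    exact H.integral_inner_localNoise hs hg hξ subset_rfl (notMem_before r i k)
      ((h1.sub (H.measurable_x.mono hle le_rfl)).sub
        ((((hs i).continuous_gradient.measurable.comp h1).sub
          ((H.measurable_ci i).mono hle le_rfl)).add (H.measurable_c.mono hle le_rfl)
            |>.const_smul ηl))
      ((h2.sub H.memLp_x).sub (memLp_smul _ ((((hs i).memLp_gradient h2).sub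
        (H.memLp_ci i)).add H.memLp_c)))
  noise_start i k φ hφ hφx :=
    H.integral_inner_localNoise hs hg hξ subset_rfl (notMem_before r i k)
      (hφ.comp (H.measurable_x.mono (samplesIn_mono ξ (subset_before r i k)) le_rfl)) hφx
  noise_pair i k j l h := by
    by_cases h' : i ≠ j ∨ k < l
    · exact H.integral_inner_localNoise_localNoise hs hg hξ h'
    -- Only the same client with k > l remains, which is symmetric to a case already covered.
    · push Not at h'
      have h2 : l ≠ k := fun e => h (by rw [h'.1, e])
      refine (integral_congr_ae (Filter.Eventually.of_forall fun ω =>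
        real_inner_comm _ _)).trans ?_
      exact H.integral_inner_localNoise_localNoise hs hg hξ (Or.inr (by omega))

theorem clientDirection_eq_average (i : Fin N) (ω : Ω) :
    IsRound.clientDirection f K (localModels g ηl (ξ (r + 1)) st)
      (localNoise f g ηl (ξ (r + 1)) st) i ω = (1 / (K : ℝ)) • ∑ k ∈ Finset.range K,
        g i (localModels g ηl (ξ (r + 1)) st i k ω) (ξ (r + 1) i k ω) := by
  simp only [IsRound.clientDirection, localNoise, add_sub_cancel]

theorem localModels_eq (hK : 1 ≤ K) (i : Fin N) (ω : Ω) :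
    localModels g ηl (ξ (r + 1)) st i K ω = (st ω).x - (K * ηl) •
      (IsRound.clientDirection f K (localModels g ηl (ξ (r + 1)) st)
        (localNoise f g ηl (ξ (r + 1)) st) i ω - ((st ω).ci i - (st ω).c)) := by
  have hK' : (K : ℝ) ≠ 0 := by positivity
  have key : ∀ v w : Vec d,
      ηl • (v - (K : ℝ) • w) = (K * ηl) • ((1 / (K : ℝ)) • v - w) := by
    intro v w
    rw [smul_sub, smul_sub, smul_smul, smul_smul, mul_comm ηl,
      show (K : ℝ) * ηl * (1 / K) = ηl by field_simp]
  rw [clientDirection_eq_average, localModels, localModel_eq, key]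
  rfl

/-- The corrections c_i - c sum to zero because c is the mean of the c_i, so control variates affect
the server only through the points where gradients are taken. -/
theorem commRound_x (H : IsState P p ξ r st) (hN : 1 ≤ N) (hK : 1 ≤ K) (ηg : ℝ) (ω : Ω) :
    (commRound g p K ηl ηg (fun i k => ξ (r + 1) i k ω) (st ω)).x = (st ω).x -
      (K * ηl * ηg) • IsRound.direction f K (localModels g ηl (ξ (r + 1)) st)
        (localNoise f g ηl (ξ (r + 1)) st) ω := by
  have hN' : (N : ℝ) ≠ 0 := by positivity
  have h1 : (commRound g p K ηl ηg (fun i k => ξ (r + 1) i k ω) (st ω)).x = (st ω).x +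
      (ηg / (N : ℝ)) • ∑ i, (localModels g ηl (ξ (r + 1)) st i K ω - (st ω).x) := rfl
  have h2 : ∑ i, ((st ω).ci i - (st ω).c) = 0 := by
    rw [Finset.sum_sub_distrib, Finset.sum_const, Finset.card_univ, Fintype.card_fin,
      ← Nat.cast_smul_eq_nsmul ℝ, H.c_eq, smul_smul, mul_one_div_cancel hN', one_smul, sub_self]
  have h3 : ∑ i, (localModels g ηl (ξ (r + 1)) st i K ω - (st ω).x) = -((K * ηl) •
      ∑ i, IsRound.clientDirection f K (localModels g ηl (ξ (r + 1)) st)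
        (localNoise f g ηl (ξ (r + 1)) st) i ω) := by
    simp only [localModels_eq (f := f) hK, sub_sub_cancel_left, Finset.sum_neg_distrib,
      ← Finset.smul_sum]
    rw [Finset.sum_sub_distrib, h2, sub_zero]
  have h4 : IsRound.direction f K (localModels g ηl (ξ (r + 1)) st)
      (localNoise f g ηl (ξ (r + 1)) st) ω = (1 / (N : ℝ)) •
      ∑ i, IsRound.clientDirection f K (localModels g ηl (ξ (r + 1)) st)
        (localNoise f g ηl (ξ (r + 1)) st) i ω := rfl
  rw [h1, h3, h4, smul_neg, smul_smul, smul_smul, ← sub_eq_add_neg]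
  congr 2
  ring

theorem mask_c (H : IsState P p ξ r st) (ω : Ω) : mask p (st ω).c = (st ω).c := by
  rw [H.c_eq, mask_smul, mask_sum]
  simp only [H.mask_ci]

/-- The masked displacement, divided by K η_l, contributes c - c_i because control variates are
fixed by the mask. This cancels the explicit c_i - c exactly. -/
theorem commRound_ci (H : IsState P p ξ r st) (hK : 1 ≤ K) (hηl : ηl ≠ 0) (ηg : ℝ) (i : Fin N)
    (ω : Ω) :
    (commRound g p K ηl ηg (fun i k => ξ (r + 1) i k ω) (st ω)).ci i =
      mask p (IsRound.clientDirection f K (localModels g ηl (ξ (r + 1)) st)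
        (localNoise f g ηl (ξ (r + 1)) st) i ω) := by
  have hK' : (K : ℝ) ≠ 0 := by positivity
  have h1 : (commRound g p K ηl ηg (fun i k => ξ (r + 1) i k ω) (st ω)).ci i =
      (st ω).ci i - (st ω).c + (1 / ((K : ℝ) * ηl)) •
        mask p ((st ω).x - localModels g ηl (ξ (r + 1)) st i K ω) := rfl
  rw [h1, localModels_eq (f := f) hK, sub_sub_cancel, mask_smul, smul_smul,
    one_div_mul_cancel (mul_ne_zero hK' hηl), one_smul, mask_sub, mask_sub, H.mask_ci, H.mask_c]
  abel

theorem commRound (H : IsState P p ξ r st) (hs : ∀ i, IsSmooth β (f i))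
    (hg : ∀ i, IsStochasticGradient (D i) (f i) (g i) σ) (hξ : IsSampling P D ξ)
    (hN : 1 ≤ N) (hK : 1 ≤ K) (hηl : ηl ≠ 0) (ηg : ℝ) :
    IsState P p ξ (r + 1)
      (fun ω => commRound g p K ηl ηg (fun i k => ξ (r + 1) i k ω) (st ω)) := by
  have hR := H.isRound (ηl := ηl) hs hg hξ
  have hle : samplesIn ξ {t | t.1 ≤ r} ≤ samplesIn ξ {t | t.1 ≤ r + 1} :=
    samplesIn_mono ξ fun t (ht : t.1 ≤ r) => Nat.le_succ_of_le ht
  have hx := H.measurable_x.mono hle le_rfl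
  have hy : ∀ i, Measurable[samplesIn ξ {t | t.1 ≤ r + 1}]
      (localModels g ηl (ξ (r + 1)) st i K) := fun i =>
    (H.measurable_localModels hg i K).mono (samplesIn_mono ξ fun t ht => by
      rcases ht with ht | ht
      · exact Nat.le_succ_of_le ht
      · exact ht.1.le) le_rfl
  refine ⟨?_, fun i => ?_, ?_, fun i => ?_, fun _ => rfl, fun i ω => ?_⟩
  · exact hx.add (measurable_smul_sum_vec Finset.univ (ηg / (N : ℝ)) fun i _ => (hy i).sub hx)
  · exact (((H.measurable_ci i).mono hle le_rfl).sub (H.measurable_c.mono hle le_rfl)).add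
      (measurable_const_smul_vec (1 / ((K : ℝ) * ηl))
        ((continuous_mask p).measurable.comp (hx.sub (hy i))))
  · simp only [H.commRound_x (f := f) hN hK]
    exact H.memLp_x.sub (memLp_smul _ (hR.memLp_direction hs))
  · simp only [H.commRound_ci (f := f) hK hηl]
    exact memLp_mask p (hR.memLp_clientDirection hs i)
  · rw [H.commRound_ci (f := f) hK hηl, mask_mask]

theorem run {init : Ω → State d N} (H : IsState P p ξ 0 init) (hs : ∀ i, IsSmooth β (f i))
    (hg : ∀ i, IsStochasticGradient (D i) (f i) (g i) σ) (hξ : IsSampling P D ξ)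
    (hN : 1 ≤ N) (hK : 1 ≤ K) (hηl : ηl ≠ 0) (ηg : ℝ) (r : ℕ) :
    IsState P p ξ r (fun ω => run g p K ηl ηg (fun r i k => ξ r i k ω) (init ω) r) := by
  induction r with
  | zero => exact H
  | succ r ih => exact ih.commRound hs hg hξ hN hK hηl ηg

theorem zeroStart (x₀ : Vec d) : IsState P p ξ 0 (fun _ => zeroStart N x₀) where
  measurable_x := measurable_const
  measurable_ci _ := measurable_const
  memLp_x := memLp_const _
  memLp_ci _ := memLp_const _
  c_eq _ := by simp [FedPVR.zeroStart]
  mask_ci _ _ := mask_zero p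

theorem memLp_sample (hg : ∀ i, IsStochasticGradient (D i) (f i) (g i) σ)
    (hξ : IsSampling P D ξ) (x₀ : Vec d) (r : ℕ) (i : Fin N) (k : ℕ) :
    MemLp (fun ω => g i x₀ (ξ r i k ω)) 2 P := by
  have h1 := (hg i).memLp x₀
  rw [← hξ.law r i k] at h1
  exact h1.comp_of_map (hξ.measurable r i k).aemeasurable

theorem warmStart (hg : ∀ i, IsStochasticGradient (D i) (f i) (g i) σ)
    (hξ : IsSampling P D ξ) (x₀ : Vec d) :
    IsState P p ξ 0 (fun ω => warmStart g p K x₀ (fun i k => ξ 0 i k ω)) where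
  measurable_x := measurable_const
  measurable_ci i := measurable_smul_sum_vec (Finset.range K) (1 / (K : ℝ)) fun k _ =>
    (continuous_mask p).measurable.comp ((hg i).measurable.comp (measurable_const.prodMk
      (measurable_samplesIn ξ (t := (0, i, k)) (le_refl 0))))
  memLp_x := memLp_const _
  memLp_ci i := memLp_smul _ (memLp_finset_sum _ fun k _ =>
    memLp_mask p (memLp_sample hg hξ x₀ 0 i k))
  c_eq _ := rfl
  mask_ci i ω := by
    simp only [FedPVR.warmStart, mask_smul, mask_sum, mask_mask]

end IsState

/-! ### Accuracy of the warm start -/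

section WarmStart

variable {Ω S : Type*} [MeasurableSpace S] [MeasurableSpace Ω] {P : Measure Ω}
  [IsProbabilityMeasure P] {d N K : ℕ} {p : Finset (Fin d)} {ξ : ℕ → Fin N → ℕ → Ω → S}
  {f : Fin N → Vec d → ℝ} {g : Fin N → Vec d → S → Vec d} {D : Fin N → Measure S} {β σ : ℝ}

/-- The warm-started control variates are accurate up to the noise of `K` stochastic gradients. -/
theorem controlError_warmStart_le (hs : ∀ i, IsSmooth β (f i))
    (hg : ∀ i, IsStochasticGradient (D i) (f i) (g i) σ) (hξ : IsSampling P D ξ) (hN : 1 ≤ N)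
    (hK : 1 ≤ K) (x₀ : Vec d) :
    controlError P p (fun i _ => gradient (f i) x₀)
      (fun i ω => (warmStart g p K x₀ (fun i k => ξ 0 i k ω)).ci i) ≤ σ ^ 2 / K := by
  have hN' : (0 : ℝ) < N := by positivity
  have hK' : (K : ℝ) ≠ 0 := by positivity
  have h1 : ∀ i, meanSq P (fun ω => (warmStart g p K x₀ (fun i k => ξ 0 i k ω)).ci i -
      mask p (gradient (f i) x₀)) ≤ σ ^ 2 / K := by
    intro i
    have hD := hξ.isProbabilityMeasure i
    have hlp : ∀ k, MemLp (fun ω => g i x₀ (ξ 0 i k ω) - gradient (f i) x₀) 2 P :=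
      fun k => (IsState.memLp_sample hg hξ x₀ 0 i k).sub (memLp_const _)
    have hav : MemLp (fun ω => (1 / (K : ℝ)) • ∑ k ∈ Finset.range K,
        (g i x₀ (ξ 0 i k ω) - gradient (f i) x₀)) 2 P :=
      memLp_smul _ (memLp_finset_sum _ fun k _ => hlp k)
    have h2 : (fun ω => (warmStart g p K x₀ (fun i k => ξ 0 i k ω)).ci i -
        mask p (gradient (f i) x₀)) = fun ω => mask p ((1 / (K : ℝ)) • ∑ k ∈ Finset.range K,
        (g i x₀ (ξ 0 i k ω) - gradient (f i) x₀)) := by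
      funext ω
      rw [Finset.sum_sub_distrib, Finset.sum_const, Finset.card_range,
        ← Nat.cast_smul_eq_nsmul ℝ, smul_sub, smul_smul, one_div_mul_cancel hK', one_smul,
        mask_sub, mask_smul, mask_sum]
      rfl
    rw [h2]
    refine (meanSq_mask_le p hav (memLp_mask p hav)).trans ?_
    rw [meanSq_smul, meanSq_sum_of_orthogonal _ hlp]
    · calc (1 / (K : ℝ)) ^ 2 * ∑ k ∈ Finset.range K,
            meanSq P (fun ω => g i x₀ (ξ 0 i k ω) - gradient (f i) x₀)
          ≤ (1 / (K : ℝ)) ^ 2 * ∑ k ∈ Finset.range K, σ ^ 2 := by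
            gcongr with k _
            -- The point is deterministic, so the empty set of samples suffices as the past.
            exact (hg i).meanSq_noise_le (hs i) (Y := fun _ => x₀)
              (hξ.samplesIn_le ∅) (hξ.indep_samplesIn (Set.notMem_empty _))
              (hξ.measurable _ _ _) (hξ.law _ _ _) measurable_const
        _ = σ ^ 2 / K := by simp; field_simp
    · intro k _ l _ hkl
      have hm : Measurable[samplesIn ξ {(0, i, k)}]
          (fun ω => g i x₀ (ξ 0 i k ω) - gradient (f i) x₀) :=
        ((hg i).measurable.comp (measurable_const.prodMk
          (measurable_samplesIn ξ (t := (0, i, k)) (Set.mem_singleton _)))).sub measurable_const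
      have hi : Indep (samplesIn ξ {(0, i, k)})
          (MeasurableSpace.comap (ξ 0 i l) inferInstance) P :=
        hξ.indep_samplesIn (by simpa using hkl.symm)
      exact (hg i).integral_inner_noise (hs i) (Y := fun _ => x₀)
        (hξ.samplesIn_le {(0, i, k)}) hi (hξ.measurable 0 i l) (hξ.law 0 i l) measurable_const
        hm (hlp k)
  refine (mul_le_mul_of_nonneg_left (Finset.sum_le_sum fun i _ => h1 i)
    (by positivity)).trans (le_of_eq ?_)
  rw [Finset.sum_const, Finset.card_univ, Fintype.card_fin, nsmul_eq_mul, ← mul_assoc,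
    one_div_mul_cancel hN'.ne', one_mul]

end WarmStart

/-! ### The output -/

theorem expectedErrorLT_outputLaw {Ω : Type*} [MeasurableSpace Ω] {P : Measure Ω} {d : ℕ}
    {x : ℕ → Ω → Vec d} (hx : ∀ r, AEMeasurable (x r) P) {w : ℕ → ℝ} (hw : ∀ r, 0 < w r)
    {e : Vec d → ℝ} (he : Continuous e) (hint : ∀ r, Integrable (fun ω => e (x r ω)) P) {ε : ℝ}
    {R : ℕ} (h : ∑ r ∈ Finset.range (R + 1), w r * ∫ ω, e (x r ω) ∂P <
      ε * ∑ r ∈ Finset.range (R + 1), w r) :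
    ExpectedErrorLT (outputLaw P x w R) e ε := by
  have hW : 0 < ∑ r ∈ Finset.range (R + 1), w r :=
    Finset.sum_pos (fun r _ => hw r) Finset.nonempty_range_add_one
  have hi : ∀ r ∈ Finset.range (R + 1), Integrable e
      (ENNReal.ofReal (w r / ∑ t ∈ Finset.range (R + 1), w t) • P.map (x r)) := fun r _ =>
    ((integrable_map_measure he.aestronglyMeasurable (hx r)).2 (hint r)).smul_measure
      ENNReal.ofReal_ne_top
  refine ⟨integrable_finsetSum_measure.2 hi, ?_⟩
  rw [outputLaw, integral_finsetSum_measure hi]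
  have h1 : ∀ r, ∫ v, e v ∂(ENNReal.ofReal (w r / ∑ t ∈ Finset.range (R + 1), w t) • P.map (x r)) =
      (w r * ∫ ω, e (x r ω) ∂P) / ∑ t ∈ Finset.range (R + 1), w t := by
    intro r
    rw [integral_smul_measure, integral_map (hx r) he.aestronglyMeasurable,
      ENNReal.toReal_ofReal (div_nonneg (hw r).le hW.le), smul_eq_mul]
    ring
  simp only [h1]
  rwa [← Finset.sum_div, div_lt_iff₀ hW]

/-! ### Recursions -/

/-- Dividing the r-th inequality by q^(r+1) makes the contraction telescope; these are the output
weights. -/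
theorem weighted_sum_le {a e : ℕ → ℝ} {q t B : ℝ} (hq : 0 < q) (ha : ∀ r, 0 ≤ a r)
    (h : ∀ r, a (r + 1) ≤ q * a r - t * e r + B) (n : ℕ) :
    t * ∑ r ∈ Finset.range n, (q ^ (r + 1))⁻¹ * e r ≤
      a 0 + B * ∑ r ∈ Finset.range n, (q ^ (r + 1))⁻¹ := by
  have key : t * ∑ r ∈ Finset.range n, (q ^ (r + 1))⁻¹ * e r + (q ^ n)⁻¹ * a n ≤
      a 0 + B * ∑ r ∈ Finset.range n, (q ^ (r + 1))⁻¹ := by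
    induction n with
    | zero => simp
    | succ n ih =>
      rw [Finset.sum_range_succ, Finset.sum_range_succ]
      have h1 := mul_le_mul_of_nonneg_left (h n) (show 0 ≤ (q ^ (n + 1))⁻¹ by positivity)
      have h2 : (q ^ (n + 1))⁻¹ * (q * a n) = (q ^ n)⁻¹ * a n := by
        rw [pow_succ]; field_simp
      linarith
  have := mul_nonneg (show 0 ≤ (q ^ n)⁻¹ by positivity) (ha n)
  linarith

theorem sum_inv_pow {q : ℝ} (hq : 0 < q) (n : ℕ) :
    (1 - q) * ∑ r ∈ Finset.range n, (q ^ (r + 1))⁻¹ = (q ^ n)⁻¹ - 1 := by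
  induction n with
  | zero => simp
  | succ n ih =>
    rw [Finset.sum_range_succ, mul_add, ih, pow_succ]
    field_simp
    ring

theorem sum_le_of_decrease {a e : ℕ → ℝ} {t B m : ℝ} (ha : ∀ r, m ≤ a r)
    (h : ∀ r, a (r + 1) ≤ a r - t * e r + B) (n : ℕ) :
    t * ∑ r ∈ Finset.range n, e r ≤ a 0 - m + B * n := by
  have key : t * ∑ r ∈ Finset.range n, e r + a n ≤ a 0 + B * n := by
    induction n with
    | zero => simp
    | succ n ih =>
      rw [Finset.sum_range_succ]
      push_cast
      linarith [h n]
  linarith [ha n]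

/-! ### Error sums along the run and the initial control error -/

section Run

variable {Ω S : Type*} [MeasurableSpace S] [MeasurableSpace Ω] {P : Measure Ω}
  [IsProbabilityMeasure P] {d N K : ℕ} {p : Finset (Fin d)} {ξ : ℕ → Fin N → ℕ → Ω → S}
  {f : Fin N → Vec d → ℝ} {g : Fin N → Vec d → S → Vec d} {D : Fin N → Measure S}
  {β σ ηl μ ε : ℝ} {init : Ω → State d N} {xs : Vec d}

theorem sum_error_le_of_convex (H : IsState P p ξ 0 init) (hs : ∀ i, IsSmooth β (f i))
    (hg : ∀ i, IsStochasticGradient (D i) (f i) (g i) σ) (hξ : IsSampling P D ξ) (hβ : 0 < β)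
    (hN : 1 ≤ N) (hK : 1 ≤ K) (hηl : 0 < ηl) (hμ : 0 ≤ μ) (hμβ : μ ≤ β)
    (hc : ∀ i, IsMuConvex μ (f i)) (hmin : ∀ x, objective f xs ≤ objective f x)
    (hη : 1000 * (β * (K * ηl * √N)) ≤ 1) (n : ℕ) :
    K * ηl * √N * ∑ r ∈ Finset.range n, ((1 - μ * (K * ηl * √N) / 2) ^ (r + 1))⁻¹ *
      ∫ ω, (objective f (run g p K ηl (√N) (fun r i k => ξ r i k ω) (init ω) r).x -
        objective f xs) ∂P ≤
      meanSq P (fun ω => (init ω).x - xs) + (K * ηl) ^ 2 * controlError P p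
        (fun i _ => gradient (f i) xs) (fun i ω => (init ω).ci i) +
      6 * (K * ηl * √N) ^ 2 * (σ ^ 2 / K * (1 / N) + heterogeneity pᶜ f xs) *
        ∑ r ∈ Finset.range n, ((1 - μ * (K * ηl * √N) / 2) ^ (r + 1))⁻¹ := by
  have hq : 0 < 1 - μ * (K * ηl * √N) / 2 := by
    have : μ * (K * ηl * √N) ≤ β * (K * ηl * √N) := by gcongr
    linarith
  refine weighted_sum_le (a := fun r => meanSq P (fun ω =>
    (run g p K ηl (√N) (fun r i k => ξ r i k ω) (init ω) r).x - xs) + (K * ηl) ^ 2 *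
    controlError P p (fun i _ => gradient (f i) xs) (fun i ω =>
      (run g p K ηl (√N) (fun r i k => ξ r i k ω) (init ω) r).ci i)) hq
    (fun r => add_nonneg meanSq_nonneg (mul_nonneg (sq_nonneg _) controlError_nonneg))
    (fun r => ?_) n
  have hst := H.run (g := g) (ηl := ηl) hs hg hξ hN hK hηl.ne' (√N) r
  have hstep := (hst.isRound (ηl := ηl) hs hg hξ).convex_potential_le (p := p) hs hβ hN hK hηl.le
    hμ hμβ hc hmin hη
  simp only [← hst.commRound_x (g := g) (f := f) hN hK,
    ← hst.commRound_ci (g := g) (f := f) hK hηl.ne' (√N)] at hstep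
  exact hstep

theorem sum_gradient_le (H : IsState P p ξ 0 init) (hs : ∀ i, IsSmooth β (f i))
    (hg : ∀ i, IsStochasticGradient (D i) (f i) (g i) σ) (hξ : IsSampling P D ξ) (hβ : 0 < β)
    (hN : 1 ≤ N) (hK : 1 ≤ K) (hηl : 0 < ηl) {z fs : ℝ} (hz : ∀ v, heterogeneity pᶜ f v ≤ z)
    (hfs : ∀ v, fs ≤ objective f v)
    (hη : 1000 * (β * (K * ηl * √N)) ≤ 1) (n : ℕ) :
    K * ηl * √N / 4 * ∑ r ∈ Finset.range n, meanSq P (fun ω => gradient (objective f)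
      (run g p K ηl (√N) (fun r i k => ξ r i k ω) (init ω) r).x) ≤
      ∫ ω, objective f (init ω).x ∂P + β * (K * ηl) ^ 2 * controlError P p
        (fun i ω => gradient (f i) (init ω).x) (fun i ω => (init ω).ci i) - fs +
      6 * β * (K * ηl * √N) ^ 2 * (σ ^ 2 / K * (1 / N) + z * (1 / N)) * n := by
  refine sum_le_of_decrease (a := fun r => ∫ ω, objective f
    (run g p K ηl (√N) (fun r i k => ξ r i k ω) (init ω) r).x ∂P + β * (K * ηl) ^ 2 *
    controlError P p (fun i ω => gradient (f i)
      (run g p K ηl (√N) (fun r i k => ξ r i k ω) (init ω) r).x) (fun i ω =>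
      (run g p K ηl (√N) (fun r i k => ξ r i k ω) (init ω) r).ci i))
    (fun r => ?_) (fun r => ?_) n
  all_goals have hst := H.run (g := g) (ηl := ηl) hs hg hξ hN hK hηl.ne' (√N) r
  · have h1 := integral_mono (integrable_const fs)
      ((IsSmooth.objective hN hs).integrable_comp hst.memLp_x) fun ω => hfs _
    simp only [integral_const, probReal_univ, smul_eq_mul, one_mul] at h1
    exact h1.trans (le_add_of_nonneg_right (mul_nonneg (by positivity) controlError_nonneg))
  · have hstep := (hst.isRound (ηl := ηl) hs hg hξ).nonconvex_potential_le (p := p) hs hβ hN hK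
      hηl.le hz hη
    simp only [← hst.commRound_x (g := g) (f := f) hN hK,
      ← hst.commRound_ci (g := g) (f := f) hK hηl.ne' (√N)] at hstep
    exact hstep

/-- The initial potential with warm start. -/
theorem warmStart_potential_le (hs : ∀ i, IsSmooth β (f i))
    (hg : ∀ i, IsStochasticGradient (D i) (f i) (g i) σ) (hξ : IsSampling P D ξ)
    (hN : 1 ≤ N) (hK : 1 ≤ K) (x₀ : Vec d) :
    controlError P p (fun i _ => gradient (f i) xs)
      (fun i ω => (warmStart g p K x₀ (fun i k => ξ 0 i k ω)).ci i) ≤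
      2 * (σ ^ 2 / K) + 2 * (β ^ 2 * ‖x₀ - xs‖ ^ 2) := by
  have hN' : (0 : ℝ) < N := by positivity
  have hw := IsState.warmStart (P := P) (p := p) (K := K) hg hξ x₀
  have h1 : ∀ i, meanSq P (fun ω => (warmStart g p K x₀ (fun i k => ξ 0 i k ω)).ci i -
      mask p (gradient (f i) xs)) ≤
      2 * meanSq P (fun ω => (warmStart g p K x₀ (fun i k => ξ 0 i k ω)).ci i -
        mask p (gradient (f i) x₀)) + 2 * (β ^ 2 * ‖x₀ - xs‖ ^ 2) := by
    intro i
    have h2 := meanSq_add_le_two ((hw.memLp_ci i).sub (memLp_const (mask p (gradient (f i) x₀))))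
      (memLp_const (μ := P) (mask p (gradient (f i) x₀) - mask p (gradient (f i) xs)))
    simp only [Pi.sub_apply, sub_add_sub_cancel] at h2
    refine h2.trans ?_
    have h3 : meanSq P (fun _ => mask p (gradient (f i) x₀) - mask p (gradient (f i) xs)) ≤
        β ^ 2 * ‖x₀ - xs‖ ^ 2 := by
      rw [← mask_sub]
      simp only [meanSq, integral_const, probReal_univ, smul_eq_mul, one_mul]
      exact (norm_sq_mask_le p _).trans ((hs i).norm_sq_gradient_sub_le x₀ xs)
    exact add_le_add le_rfl (mul_le_mul_of_nonneg_left h3 zero_le_two)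
  have h4 := controlError_warmStart_le (P := P) (p := p) hs hg hξ hN hK x₀
  rw [controlError] at h4
  calc _ ≤ (1 / (N : ℝ)) * ∑ i, (2 * meanSq P (fun ω =>
        (warmStart g p K x₀ (fun i k => ξ 0 i k ω)).ci i -
        mask p (gradient (f i) x₀)) + 2 * (β ^ 2 * ‖x₀ - xs‖ ^ 2)) :=
        mul_le_mul_of_nonneg_left (Finset.sum_le_sum fun i _ => h1 i) (by positivity)
    _ = 2 * ((1 / (N : ℝ)) * ∑ i, meanSq P (fun ω =>
        (warmStart g p K x₀ (fun i k => ξ 0 i k ω)).ci i - mask p (gradient (f i) x₀))) +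
        2 * (β ^ 2 * ‖x₀ - xs‖ ^ 2) := by
        rw [Finset.sum_add_distrib, Finset.sum_const, Finset.card_univ, Fintype.card_fin,
          nsmul_eq_mul, ← Finset.mul_sum]
        field_simp
    _ ≤ _ := by linarith

/-- The initial potential with control variates initialised to zero. -/
theorem zeroStart_potential_le (x₀ : Vec d) :
    controlError P p (fun i _ => gradient (f i) xs) (fun i _ => (zeroStart N x₀).ci i) ≤
      heterogeneity Finset.univ f xs := by
  rw [controlError, heterogeneity]
  gcongr with i _
  simp only [meanSq, integral_const, probReal_univ, smul_eq_mul, one_mul, zeroStart, zero_sub,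
    norm_neg, mask_univ]
  exact norm_sq_mask_le p _

/-- Accuracy of the output for convex objectives, in terms of the total weight. -/
theorem expectedErrorLT_of_convex (H : IsState P p ξ 0 init) (hs : ∀ i, IsSmooth β (f i))
    (hg : ∀ i, IsStochasticGradient (D i) (f i) (g i) σ) (hξ : IsSampling P D ξ) (hβ : 0 < β)
    (hN : 1 ≤ N) (hK : 1 ≤ K) (hηl : 0 < ηl) (hμ : 0 ≤ μ) (hμβ : μ ≤ β)
    (hc : ∀ i, IsMuConvex μ (f i)) (hmin : ∀ x, objective f xs ≤ objective f x)
    (hη : 1000 * (β * (K * ηl * √N)) ≤ 1) {A : ℝ}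
    (hA : meanSq P (fun ω => (init ω).x - xs) + (K * ηl) ^ 2 * controlError P p
      (fun i _ => gradient (f i) xs) (fun i ω => (init ω).ci i) ≤
      2 * A + 2 * (K * ηl * √N) ^ 2 * (σ ^ 2 / K * (1 / N) + heterogeneity pᶜ f xs))
    (hε : 16 * (K * ηl * √N) * (σ ^ 2 / K * (1 / N) + heterogeneity pᶜ f xs) ≤ ε) {R : ℕ}
    (hR : 4 * A < ε * (K * ηl * √N *
      ∑ r ∈ Finset.range (R + 1), ((1 - μ * (K * ηl * √N) / 2) ^ (r + 1))⁻¹)) :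
    ExpectedErrorLT (outputLaw P (fun r ω =>
        (run g p K ηl (√N) (fun r i k => ξ r i k ω) (init ω) r).x)
        (fun r => ((1 - μ * (K * ηl * √N) / 2) ^ (r + 1))⁻¹) R)
      (fun x => objective f x - objective f xs) ε := by
  have hso := IsSmooth.objective hN hs
  have hst := H.run (g := g) (ηl := ηl) hs hg hξ hN hK hηl.ne' (√N)
  have ht : 0 < K * ηl * √N := by positivity
  have hq : 0 < 1 - μ * (K * ηl * √N) / 2 := by
    have : μ * (K * ηl * √N) ≤ β * (K * ηl * √N) := by gcongr
    linarith
  have hq1 : 1 - μ * (K * ηl * √N) / 2 ≤ 1 := by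
    have : 0 ≤ μ * (K * ηl * √N) := by positivity
    linarith
  have hw : ∀ r : ℕ, 0 < ((1 - μ * (K * ηl * √N) / 2) ^ (r + 1))⁻¹ := fun r => by positivity
  refine expectedErrorLT_outputLaw (e := fun x => objective f x - objective f xs)
    (fun r => (hst r).memLp_x.aestronglyMeasurable.aemeasurable) hw
    (hso.1.continuous.sub continuous_const)
    (fun r => (hso.integrable_comp (hst r).memLp_x).sub (integrable_const _)) ?_
  have h1 := sum_error_le_of_convex H hs hg hξ hβ hN hK hηl hμ hμβ hc hmin hη (R + 1)
  -- Total weight at least 1 lets the initial noise 2t²M join the accumulated 6t²MW. Together they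
  -- are 8t²MW ≤ ε t W/2 by `hε`, and `hR` gives 2A < ε t W/2.
  have hW : 1 ≤ ∑ r ∈ Finset.range (R + 1), ((1 - μ * (K * ηl * √N) / 2) ^ (r + 1))⁻¹ := by
    refine le_trans ?_ (Finset.single_le_sum (fun r _ => (hw r).le)
      (Finset.mem_range.2 (Nat.succ_pos R)))
    exact (one_le_inv₀ (by positivity)).2 (pow_le_one₀ hq.le hq1)
  set W := ∑ r ∈ Finset.range (R + 1), ((1 - μ * (K * ηl * √N) / 2) ^ (r + 1))⁻¹
  set t := K * ηl * √N
  have hM : 0 ≤ σ ^ 2 / K * (1 / N) + heterogeneity pᶜ f xs :=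
    add_nonneg (by positivity) (heterogeneity_nonneg _ _ _)
  set M := σ ^ 2 / K * (1 / N) + heterogeneity pᶜ f xs
  have h2 : 2 * t ^ 2 * M ≤ 2 * t ^ 2 * M * W := le_mul_of_one_le_right (by positivity) hW
  have h3 : 16 * t * M * (t * W) ≤ ε * (t * W) := mul_le_mul_of_nonneg_right hε (by positivity)
  refine lt_of_mul_lt_mul_left ?_ ht.le
  linarith

end Run

/-! ### Complexity bounds -/

section Complexity

variable {Ω S : Type*} [MeasurableSpace S] [MeasurableSpace Ω] {P : Measure Ω}
  [IsProbabilityMeasure P] {d N K : ℕ} {p : Finset (Fin d)} {ξ : ℕ → Fin N → ℕ → Ω → S}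
  {f : Fin N → Vec d → ℝ} {g : Fin N → Vec d → S → Vec d} {D : Fin N → Measure S}
  {β σ μ ε : ℝ} {x₀ xs : Vec d}

/-! ### Choice of the step size -/

/-- The step size `η̃ = K η_l √N`. -/
def stepSize (β a : ℝ) : ℝ := (1000 * β + a)⁻¹

theorem stepSize_pos {β a : ℝ} (hβ : 0 < β) (ha : 0 ≤ a) : 0 < stepSize β a := by
  rw [stepSize]; positivity

theorem stepSize_mul_le {β a : ℝ} (hβ : 0 < β) (ha : 0 ≤ a) : 1000 * (β * stepSize β a) ≤ 1 := by
  have h : stepSize β a * (1000 * β + a) = 1 := inv_mul_cancel₀ (by positivity)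
  have := mul_nonneg (stepSize_pos hβ ha).le ha
  linarith

theorem mul_stepSize_le {β a : ℝ} (hβ : 0 < β) (ha : 0 ≤ a) : a * stepSize β a ≤ 1 := by
  have h : stepSize β a * (1000 * β + a) = 1 := inv_mul_cancel₀ (by positivity)
  have := mul_nonneg (stepSize_pos hβ ha).le hβ.le
  linarith

theorem localStep_mul (hN : 1 ≤ N) (hK : 1 ≤ K) (t : ℝ) : K * (t / (K * √N)) * √N = t := by
  have : (√N : ℝ) ≠ 0 := by positivity
  field_simp

theorem localStep_le (hN : 1 ≤ N) (hK : 1 ≤ K) (hβ : 0 < β) {t b : ℝ} (hb : 0 < b)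
    (ht : b * (β * t) ≤ 1) : t / (K * √N) ≤ 1 / (b * K * √N * β) := by
  have hN' : (0 : ℝ) < √N := by positivity
  have hK' : (0 : ℝ) < K := by positivity
  rw [div_le_div_iff₀ (by positivity) (by positivity)]
  calc t * (b * K * √N * β) = b * (β * t) * (K * √N) := by ring
    _ ≤ 1 * (K * √N) := by gcongr

theorem localStep_le_min (hN : 1 ≤ N) (hK : 1 ≤ K) (hμ : 0 < μ) (hμβ : μ ≤ β) {t : ℝ}
    (h0 : 0 ≤ t) (ht : 1000 * (β * t) ≤ 1) :
    t / (K * √N) ≤ min (1 / (80 * K * √N * β)) (26 / (20 * μ * K * √N)) := by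
  have hN' : (0 : ℝ) < √N := by positivity
  have hK' : (0 : ℝ) < K := by positivity
  have hβ : 0 < β := hμ.trans_le hμβ
  refine le_min (localStep_le hN hK hβ (by norm_num) ?_) ?_
  · have : 0 ≤ β * t := by positivity
    linarith
  · have h1 : μ * t ≤ β * t := by gcongr
    rw [div_le_div_iff₀ (by positivity) (by positivity)]
    calc t * (20 * μ * K * √N) = 20 * (μ * t) * (K * √N) := by ring
      _ ≤ 26 * (K * √N) := by gcongr; linarith

theorem localStep_sq (hN : 1 ≤ N) (hK : 1 ≤ K) (t : ℝ) :
    (K * (t / (K * √N))) ^ 2 = t ^ 2 * (1 / N) := by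
  have hs : (√N : ℝ) ^ 2 = N := Real.sq_sqrt (by positivity)
  have hK' : (K : ℝ) ≠ 0 := by positivity
  have hN' : (N : ℝ) ≠ 0 := by positivity
  calc (K * (t / (K * √N))) ^ 2 = t ^ 2 / √N ^ 2 := by field_simp
    _ = t ^ 2 * (1 / N) := by rw [hs]; ring

/-- The variance and heterogeneity level of the convex bounds. -/
def noiseLevel (p : Finset (Fin d)) (f : Fin N → Vec d → ℝ) (K : ℕ) (σ : ℝ) (xs : Vec d) : ℝ :=
  σ ^ 2 / K * (1 / N) + heterogeneity pᶜ f xs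

theorem noiseLevel_nonneg : 0 ≤ noiseLevel p f K σ xs :=
  add_nonneg (by positivity) (heterogeneity_nonneg _ _ _)

theorem expectedErrorLT_of_subsingleton [Subsingleton (Vec d)] {ν : Measure (Vec d)} (hε : 0 < ε) :
    ExpectedErrorLT ν (fun x => objective f x - objective f xs) ε := by
  have : (fun x => objective f x - objective f xs) = fun _ => 0 :=
    funext fun x => by rw [Subsingleton.elim x xs, sub_self]
  rw [this]
  exact ⟨integrable_zero _ _ _, by simpa using hε⟩

/-- The total weight needed in the strongly convex case. -/
theorem total_weight_gt {t M A : ℝ} (hβ : 0 < β) (hε : 0 < ε) (hμ : 0 < μ) (hμβ : μ ≤ β)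
    (hM : 0 ≤ M) (hA : 0 ≤ A) (ht : t = stepSize β (16 * M / ε)) {R : ℕ}
    (hR : 8000 * ((M / ε + β) / μ) * Real.log (2 + μ * A / ε) < R + 1) :
    4 * A < ε * (t * ∑ r ∈ Finset.range (R + 1), ((1 - μ * t / 2) ^ (r + 1))⁻¹) := by
  have ha : 0 ≤ 16 * M / ε := by positivity
  have ht0 : 0 < t := ht ▸ stepSize_pos hβ ha
  have ht1 : 1000 * (β * t) ≤ 1 := ht ▸ stepSize_mul_le hβ ha
  have hti : t * (1000 * β + 16 * M / ε) = 1 := by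
    rw [ht]; exact inv_mul_cancel₀ (by positivity)
  have hμt : μ * t ≤ β * t := by gcongr
  have hq : 0 < 1 - μ * t / 2 := by linarith
  have hsum := sum_inv_pow hq (R + 1)
  set W := ∑ r ∈ Finset.range (R + 1), ((1 - μ * t / 2) ^ (r + 1))⁻¹
  set u := μ * A / ε with hu
  have hu0 : 0 ≤ u := by positivity
  have hlog : 0 < Real.log (2 + u) := Real.log_pos (by linarith)
  -- By the geometric sum the goal is q^(-(R+1)) > 1 + 2u with q = 1 - μt/2. The square is what
  -- guarantees this for all u ≥ 0, since 2 + u alone falls short once u ≥ 1.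
  have hexp : (2 + u) ^ 2 ≤ ((1 - μ * t / 2) ^ (R + 1))⁻¹ := by
    have h1 : (1 - μ * t / 2) ^ (R + 1) ≤ Real.exp (-(μ * t / 2 * (R + 1))) := by
      have h2 := Real.add_one_le_exp (-(μ * t / 2))
      calc (1 - μ * t / 2) ^ (R + 1) ≤ Real.exp (-(μ * t / 2)) ^ (R + 1) := by
            gcongr; linarith
        _ = _ := by rw [← Real.exp_nat_mul]; congr 1; push_cast; ring
    have h3 : 2 * Real.log (2 + u) ≤ μ * t / 2 * (R + 1) := by
      have h4 := mul_le_mul_of_nonneg_left hR.le (show 0 ≤ μ * t / 2 by positivity)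
      have h5 : μ * t / 2 * (8000 * ((M / ε + β) / μ) * Real.log (2 + u)) =
          4000 * (t * (M / ε + β)) * Real.log (2 + u) := by field_simp; ring
      have h6 : 1 ≤ 1000 * (t * (M / ε + β)) := by
        have : 0 ≤ t * (M / ε) := by positivity
        have h7 : t * (16 * M / ε) = 16 * (t * (M / ε)) := by ring
        linarith
      have h8 := mul_le_mul_of_nonneg_right h6 hlog.le
      rw [h5] at h4
      linarith
    calc (2 + u) ^ 2 = Real.exp (2 * Real.log (2 + u)) := by
          rw [mul_comm, Real.exp_mul, Real.exp_log (by linarith)]; norm_num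
      _ ≤ Real.exp (μ * t / 2 * (R + 1)) := Real.exp_le_exp.2 h3
      _ = (Real.exp (-(μ * t / 2 * (R + 1))))⁻¹ := by rw [Real.exp_neg, inv_inv]
      _ ≤ _ := inv_anti₀ (by positivity) h1
  have h1 : ε * (t * W) = 2 * ε / μ * (((1 - μ * t / 2) ^ (R + 1))⁻¹ - 1) := by
    rw [← hsum]; field_simp; ring
  have h2 : 4 * A = 2 * ε / μ * (2 * u) := by rw [hu]; field_simp; ring
  rw [h1, h2]
  have : 2 * u < ((1 - μ * t / 2) ^ (R + 1))⁻¹ - 1 := by nlinarith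
  gcongr

theorem exists_localStep_of_stronglyConvex (hs : ∀ i, IsSmooth β (f i))
    (hg : ∀ i, IsStochasticGradient (D i) (f i) (g i) σ) (hξ : IsSampling P D ξ) (hβ : 0 < β)
    (hε : 0 < ε) (hN : 1 ≤ N) (hK : 1 ≤ K) (hμ : 0 < μ) (hc : ∀ i, IsMuConvex μ (f i))
    (hmin : ∀ x, objective f xs ≤ objective f x) {init : Ω → State d N}
    (H : IsState P p ξ 0 init) {A : ℝ} (hA0 : 0 ≤ A)
    (hA : ∀ t, 0 < t → 1000 * (β * t) ≤ 1 →
      meanSq P (fun ω => (init ω).x - xs) + t ^ 2 * (1 / N) * controlError P p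
      (fun i _ => gradient (f i) xs) (fun i ω => (init ω).ci i) ≤
      2 * A + 2 * t ^ 2 * noiseLevel p f K σ xs) :
    ∃ ηl : ℝ, 0 < ηl ∧ ηl ≤ min (1 / (80 * K * √N * β)) (26 / (20 * μ * K * √N)) ∧
      ∀ R : ℕ, ⌊8000 * (σ ^ 2 / (μ * N * K * ε) + heterogeneity pᶜ f xs / (μ * ε) + β / μ) *
        Real.log (2 + μ * A / ε)⌋₊ ≤ R →
        ExpectedErrorLT (outputLaw P (fun r ω =>
          (run g p K ηl (√N) (fun r i k => ξ r i k ω) (init ω) r).x)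
          (fun r => ((1 - μ * (K * ηl * √N) / 2) ^ (r + 1))⁻¹) R)
          (fun x => objective f x - objective f xs) ε := by
  -- In dimension 0 the relation μ ≤ β may fail, but the error vanishes identically and the largest
  -- allowed step serves.
  rcases subsingleton_or_nontrivial (Vec d) with hd | hd
  · exact ⟨_, by positivity, le_rfl, fun R _ => expectedErrorLT_of_subsingleton hε⟩
  have hμβ : μ ≤ β := (hc ⟨0, hN⟩).le_of_isSmooth (hs _)
  have hM : 0 ≤ noiseLevel p f K σ xs := noiseLevel_nonneg
  have ha : 0 ≤ 16 * noiseLevel p f K σ xs / ε := by positivity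
  obtain ⟨t, ht⟩ : ∃ t, t = stepSize β (16 * noiseLevel p f K σ xs / ε) := ⟨_, rfl⟩
  have ht0 : 0 < t := ht ▸ stepSize_pos hβ ha
  have ht1 : 1000 * (β * t) ≤ 1 := ht ▸ stepSize_mul_le hβ ha
  have ht2 : 16 * noiseLevel p f K σ xs / ε * t ≤ 1 := ht ▸ mul_stepSize_le hβ ha
  have hT := localStep_mul hN hK t
  refine ⟨t / (K * √N), by positivity, localStep_le_min hN hK hμ hμβ ht0.le ht1, fun R hR => ?_⟩
  refine expectedErrorLT_of_convex H hs hg hξ hβ hN hK (A := A) (by positivity) hμ.le hμβ hc hmin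
    (by rwa [hT]) ?_ ?_ ?_
  · rw [hT]
    rw [localStep_sq hN hK]
    exact hA t ht0 ht1
  · rw [hT]
    rw [div_mul_eq_mul_div, div_le_one hε] at ht2
    exact le_trans (le_of_eq (by rw [noiseLevel]; ring)) ht2
  · rw [hT]
    refine total_weight_gt hβ hε hμ hμβ hM hA0 ht ?_
    -- The output is drawn from R + 1 points, so R ≥ ⌊B⌋ already gives R + 1 > B strictly.
    have h1 := (Nat.lt_floor_add_one _).trans_le (show ((⌊8000 * (σ ^ 2 / (μ * N * K * ε) +
      heterogeneity pᶜ f xs / (μ * ε) + β / μ) * Real.log (2 + μ * A / ε)⌋₊ : ℝ) + 1) ≤ R + 1 by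
        gcongr)
    refine lt_of_eq_of_lt ?_ h1
    have hN' : (N : ℝ) ≠ 0 := by positivity
    have hK' : (K : ℝ) ≠ 0 := by positivity
    congr 2
    rw [noiseLevel]
    field_simp

/-! ### Initial potentials and the final complexity bounds -/

theorem meanSq_const (v : Vec d) : meanSq P (fun _ => v) = ‖v‖ ^ 2 := by
  simp [meanSq]

/-- The sampling noise of the warm start, weighted by t²/N, is of the same kind as one round of
noise; the shift of reference from x₀ to x* is dominated by the initial distance because βt is
small. -/
theorem warmStart_initial_le (hs : ∀ i, IsSmooth β (f i))
    (hg : ∀ i, IsStochasticGradient (D i) (f i) (g i) σ) (hξ : IsSampling P D ξ) (hβ : 0 < β)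
    (hN : 1 ≤ N) (hK : 1 ≤ K) {t : ℝ} (ht : 0 < t) (hβt : 1000 * (β * t) ≤ 1) :
    meanSq P (fun ω => (warmStart g p K x₀ (fun i k => ξ 0 i k ω)).x - xs) +
      t ^ 2 * (1 / N) * controlError P p (fun i _ => gradient (f i) xs)
        (fun i ω => (warmStart g p K x₀ (fun i k => ξ 0 i k ω)).ci i) ≤
      2 * ‖x₀ - xs‖ ^ 2 + 2 * t ^ 2 * noiseLevel p f K σ xs := by
  have hN' : (1 : ℝ) ≤ N := by exact_mod_cast hN
  have h1 := mul_le_mul_of_nonneg_left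
    (warmStart_potential_le (P := P) (p := p) (xs := xs) hs hg hξ hN hK x₀)
    (show 0 ≤ t ^ 2 * (1 / (N : ℝ)) by positivity)
  have h2 : meanSq P (fun ω => (warmStart g p K x₀ (fun i k => ξ 0 i k ω)).x - xs) =
      ‖x₀ - xs‖ ^ 2 := by
    simp only [warmStart, meanSq_const]
  have hb0 : 0 ≤ β * t := by positivity
  have h3 : (β * t) ^ 2 * (1 / N) ≤ 1 / 1000 * 1 := by
    gcongr
    · nlinarith
    · rw [div_le_one (by positivity)]; exact hN'
  have h4 := mul_le_mul_of_nonneg_right h3 (sq_nonneg ‖x₀ - xs‖)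
  have h5 : 0 ≤ 2 * t ^ 2 * heterogeneity pᶜ f xs :=
    mul_nonneg (by positivity) (heterogeneity_nonneg _ _ _)
  rw [h2, noiseLevel]
  generalize controlError P p (fun i _ => gradient (f i) xs)
    (fun i ω => (warmStart g p K x₀ (fun i k => ξ 0 i k ω)).ci i) = U at h1 ⊢
  have h6 := sq_nonneg ‖x₀ - xs‖
  have h7 : t ^ 2 * (1 / N) * (2 * (σ ^ 2 / K) + 2 * (β ^ 2 * ‖x₀ - xs‖ ^ 2)) =
      2 * t ^ 2 * (σ ^ 2 / K * (1 / N)) + 2 * ((β * t) ^ 2 * (1 / N) * ‖x₀ - xs‖ ^ 2) := by ring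
  linarith

/-- The initial control error is at most the full heterogeneity at x*. Since t² ≤ 1/β², it acts as
extra initial distance, which the strongly convex bound sees only inside the logarithm. -/
theorem zeroStart_initial_le (hβ : 0 < β) (hN : 1 ≤ N) {t : ℝ} (ht : 0 < t)
    (hβt : 1000 * (β * t) ≤ 1) :
    meanSq P (fun _ : Ω => (zeroStart N x₀).x - xs) +
      t ^ 2 * (1 / N) * controlError P p (fun i _ => gradient (f i) xs)
        (fun i _ => (zeroStart N x₀).ci i) ≤
      2 * (‖x₀ - xs‖ ^ 2 + heterogeneity Finset.univ f xs / β ^ 2) +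
        2 * t ^ 2 * noiseLevel p f K σ xs := by
  have hN' : (1 : ℝ) ≤ N := by exact_mod_cast hN
  have h1 := mul_le_mul_of_nonneg_left (zeroStart_potential_le (P := P) (p := p) (f := f)
    (xs := xs) x₀) (show 0 ≤ t ^ 2 * (1 / (N : ℝ)) by positivity)
  have h2 : meanSq P (fun _ : Ω => (zeroStart N x₀).x - xs) = ‖x₀ - xs‖ ^ 2 := meanSq_const _
  have hz := heterogeneity_nonneg Finset.univ f xs
  have h3 : t ^ 2 * (1 / N) * heterogeneity Finset.univ f xs ≤
      heterogeneity Finset.univ f xs / β ^ 2 := by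
    rw [le_div_iff₀ (by positivity)]
    have hb0 : 0 ≤ β * t := by positivity
    have h4 : (β * t) ^ 2 * (1 / N) ≤ 1 * 1 := by
      gcongr
      · nlinarith
      · rw [div_le_one (by positivity)]; exact hN'
    have h5 := mul_le_mul_of_nonneg_right h4 hz
    linarith
  have h6 : 0 ≤ heterogeneity Finset.univ f xs / β ^ 2 := by positivity
  have h7 : 0 ≤ 2 * t ^ 2 * noiseLevel p f K σ xs := mul_nonneg (by positivity) noiseLevel_nonneg
  rw [h2]
  linarith [sq_nonneg ‖x₀ - xs‖]

theorem exists_localStep_of_convex (hs : ∀ i, IsSmooth β (f i))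
    (hg : ∀ i, IsStochasticGradient (D i) (f i) (g i) σ) (hξ : IsSampling P D ξ) (hβ : 0 < β)
    (hε : 0 < ε) (hN : 1 ≤ N) (hK : 1 ≤ K) (hc : ∀ i, IsMuConvex 0 (f i))
    (hmin : ∀ x, objective f xs ≤ objective f x) :
    ∃ ηl : ℝ, 0 < ηl ∧ ηl ≤ 1 / (80 * K * √N * β) ∧
      ∀ R : ℕ, ⌊8000 * (σ ^ 2 * ‖x₀ - xs‖ ^ 2 / (K * N * ε ^ 2) +
        heterogeneity pᶜ f xs * ‖x₀ - xs‖ ^ 2 / ε ^ 2 + β * ‖x₀ - xs‖ ^ 2 / ε +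
        (objective f x₀ - objective f xs))⌋₊ ≤ R →
        ExpectedErrorLT (outputLaw P (warmIterate g p K ηl (√N) ξ x₀) (fun _ => 1) R)
          (fun x => objective f x - objective f xs) ε := by
  have hM : 0 ≤ noiseLevel p f K σ xs := noiseLevel_nonneg
  have ha : 0 ≤ 16 * noiseLevel p f K σ xs / ε := by positivity
  obtain ⟨t, ht⟩ : ∃ t, t = stepSize β (16 * noiseLevel p f K σ xs / ε) := ⟨_, rfl⟩
  have ht0 : 0 < t := ht ▸ stepSize_pos hβ ha
  have ht1 : 1000 * (β * t) ≤ 1 := ht ▸ stepSize_mul_le hβ ha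
  have ht2 : 16 * noiseLevel p f K σ xs / ε * t ≤ 1 := ht ▸ mul_stepSize_le hβ ha
  have hti : t * (1000 * β + 16 * noiseLevel p f K σ xs / ε) = 1 := by
    rw [ht]; exact inv_mul_cancel₀ (by positivity)
  have hT := localStep_mul hN hK t
  have hβt : 0 ≤ β * t := by positivity
  refine ⟨t / (K * √N), by positivity, localStep_le hN hK hβ (by norm_num) (by linarith),
    fun R hR => ?_⟩
  -- For μ = 0 the contraction factor is 1 and the geometric weights become uniform.
  have hw : (fun r : ℕ => ((1 - 0 * (K * (t / (K * √N)) * √N) / 2 : ℝ) ^ (r + 1))⁻¹) =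
      fun _ => 1 := by funext r; simp
  have key := expectedErrorLT_of_convex (IsState.warmStart (p := p) (K := K) hg hξ x₀) hs hg hξ
    (ηl := t / (K * √N)) (A := ‖x₀ - xs‖ ^ 2) (ε := ε) (R := R) hβ hN hK (by positivity) le_rfl
    hβ.le hc hmin (by rwa [hT]) ?_ ?_ ?_
  · rwa [hw] at key
  · rw [hT, localStep_sq hN hK]
    exact warmStart_initial_le hs hg hξ hβ hN hK ht0 ht1
  · rw [hT]
    rw [div_mul_eq_mul_div, div_le_one hε] at ht2
    exact le_trans (le_of_eq (by rw [noiseLevel]; ring)) ht2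
  · rw [hT]
    simp only [zero_mul, zero_div, sub_zero, one_pow, inv_one, Finset.sum_const, Finset.card_range,
      nsmul_eq_mul, mul_one]
    push_cast
    have h1 := (Nat.lt_floor_add_one _).trans_le (show ((⌊8000 * (σ ^ 2 * ‖x₀ - xs‖ ^ 2 /
      (K * N * ε ^ 2) + heterogeneity pᶜ f xs * ‖x₀ - xs‖ ^ 2 / ε ^ 2 + β * ‖x₀ - xs‖ ^ 2 / ε +
        (objective f x₀ - objective f xs))⌋₊ : ℝ) + 1) ≤ R + 1 by gcongr)
    have hN' : (N : ℝ) ≠ 0 := by positivity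
    have hK' : (K : ℝ) ≠ 0 := by positivity
    set Δ := ‖x₀ - xs‖ ^ 2 with hΔ
    have hΔ0 : 0 ≤ Δ := by positivity
    have h2 : σ ^ 2 * Δ / (K * N * ε ^ 2) + heterogeneity pᶜ f xs * Δ / ε ^ 2 =
        noiseLevel p f K σ xs / ε * (Δ / ε) := by
      rw [noiseLevel]; field_simp
    rw [h2] at h1
    set M := noiseLevel p f K σ xs
    -- The initial gap is nonnegative and only enlarges the round count, so it is dropped.
    have hF := sub_nonneg.2 (hmin x₀)
    have h3 : 8000 * ((M / ε + β) * (Δ / ε)) < R + 1 := by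
      have : β * Δ / ε = β * (Δ / ε) := by ring
      linarith
    have h4 : 1 ≤ 1000 * (t * (M / ε + β)) := by
      have h5 : 0 ≤ t * (M / ε) := by positivity
      have h7 : t * (16 * M / ε) = 16 * (t * (M / ε)) := by ring
      linarith
    have h5 := mul_lt_mul_of_pos_left h3 (mul_pos hε ht0)
    have h6 := mul_le_mul_of_nonneg_right h4 (show 0 ≤ 8 * Δ by positivity)
    have h8 : ε * t * (8000 * ((M / ε + β) * (Δ / ε))) =
        1000 * (t * (M / ε + β)) * (8 * Δ) := by field_simp; ring
    linarith

theorem exists_localStep_of_nonconvex (hs : ∀ i, IsSmooth β (f i))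
    (hg : ∀ i, IsStochasticGradient (D i) (f i) (g i) σ) (hξ : IsSampling P D ξ) (hβ : 0 < β)
    (hε : 0 < ε) (hN : 1 ≤ N) (hK : 1 ≤ K) {fs ζ : ℝ} (hfs : ∀ x, fs ≤ objective f x)
    (hζ : ∀ x, heterogeneity pᶜ f x ≤ ζ ^ 2) :
    ∃ ηl : ℝ, 0 < ηl ∧ ηl ≤ 1 / (26 * K * √N * β) ∧
      ∀ R : ℕ, ⌊8000 * (β * σ ^ 2 * (objective f x₀ - fs) / (K * N * ε ^ 2) +
        β * ζ ^ 2 * (objective f x₀ - fs) / (N * ε ^ 2) +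
        β * (objective f x₀ - fs) / ε)⌋₊ ≤ R →
        ExpectedErrorLT (outputLaw P (warmIterate g p K ηl (√N) ξ x₀) (fun _ => 1) R)
          (fun x => ‖gradient (objective f) x‖ ^ 2) ε := by
  have hN' : (N : ℝ) ≠ 0 := by positivity
  have hK' : (K : ℝ) ≠ 0 := by positivity
  obtain ⟨M, hMdef⟩ : ∃ M, M = σ ^ 2 / K * (1 / N) + ζ ^ 2 * (1 / N) := ⟨_, rfl⟩
  have hM : 0 ≤ M := by rw [hMdef]; positivity
  have ha : 0 ≤ 56 * β * M / ε := by positivity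
  -- The noise costs at most 7βt²M per round, 6 from the recursion and 1 reserved for the warm
  -- start. Dividing by the decrease t/4 gives 28βtM, which this choice makes at most ε/2.
  obtain ⟨t, ht⟩ : ∃ t, t = stepSize β (56 * β * M / ε) := ⟨_, rfl⟩
  have ht0 : 0 < t := ht ▸ stepSize_pos hβ ha
  have ht1 : 1000 * (β * t) ≤ 1 := ht ▸ stepSize_mul_le hβ ha
  have ht2 : 56 * β * M / ε * t ≤ 1 := ht ▸ mul_stepSize_le hβ ha
  rw [div_mul_eq_mul_div, div_le_one hε] at ht2
  have hti : t * (1000 * β + 56 * β * M / ε) = 1 := by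
    rw [ht]; exact inv_mul_cancel₀ (by positivity)
  have hT := localStep_mul hN hK t
  have hβt : 0 ≤ β * t := by positivity
  refine ⟨t / (K * √N), by positivity, localStep_le hN hK hβ (by norm_num) (by linarith),
    fun R hR => ?_⟩
  have hso := IsSmooth.objective hN hs
  have hw := IsState.warmStart (P := P) (p := p) (K := K) hg hξ x₀
  have hst := hw.run (g := g) (ηl := t / (K * √N)) hs hg hξ hN hK (by positivity) (√N)
  refine expectedErrorLT_outputLaw (e := fun x => ‖gradient (objective f) x‖ ^ 2)
    (fun r => (hst r).memLp_x.aestronglyMeasurable.aemeasurable) (fun _ => one_pos)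
    (hso.continuous_gradient.norm.pow 2)
    (fun r => integrable_norm_sq (hso.memLp_gradient (hst r).memLp_x)) ?_
  have h1 := sum_gradient_le hw hs hg hξ hβ hN hK (show 0 < t / (K * √N) by positivity) hζ hfs
    (by rwa [hT]) (R + 1)
  rw [hT, localStep_sq hN hK, ← hMdef] at h1
  have h2 : ∫ ω, objective f (warmStart g p K x₀ (fun i k => ξ 0 i k ω)).x ∂P =
      objective f x₀ := by
    simp [warmStart]
  have h3 := mul_le_mul_of_nonneg_left
    (controlError_warmStart_le (P := P) (p := p) hs hg hξ hN hK x₀)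
    (show 0 ≤ β * (t ^ 2 * (1 / (N : ℝ))) by positivity)
  have h4 : β * (t ^ 2 * (1 / N)) * (σ ^ 2 / K) ≤ β * t ^ 2 * M * (R + 1) := by
    have h5 : β * (t ^ 2 * (1 / N)) * (σ ^ 2 / K) ≤ β * t ^ 2 * M := by
      have : 0 ≤ β * t ^ 2 * (ζ ^ 2 * (1 / N)) := by positivity
      rw [hMdef]
      linarith
    have h6 : (0 : ℝ) ≤ R := Nat.cast_nonneg R
    exact h5.trans (le_mul_of_one_le_right (by positivity) (by linarith))
  have h5 := (Nat.lt_floor_add_one _).trans_le (show ((⌊8000 * (β * σ ^ 2 *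
    (objective f x₀ - fs) / (K * N * ε ^ 2) + β * ζ ^ 2 * (objective f x₀ - fs) / (N * ε ^ 2) +
      β * (objective f x₀ - fs) / ε)⌋₊ : ℝ) + 1) ≤ R + 1 by gcongr)
  have hF : 0 ≤ objective f x₀ - fs := sub_nonneg.2 (hfs x₀)
  have h6 : β * σ ^ 2 * (objective f x₀ - fs) / (K * N * ε ^ 2) +
      β * ζ ^ 2 * (objective f x₀ - fs) / (N * ε ^ 2) + β * (objective f x₀ - fs) / ε =
      (β * M / ε + β) * ((objective f x₀ - fs) / ε) := by
    rw [hMdef]; field_simp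
  rw [h6] at h5
  simp only [one_mul, Finset.sum_const, Finset.card_range, nsmul_eq_mul, mul_one]
  push_cast at h1 ⊢
  have h7 : 1 ≤ 1000 * (t * (β * M / ε + β)) := by
    have h8 : 0 ≤ t * (β * M / ε) := by positivity
    have h9 : t * (56 * β * M / ε) = 56 * (t * (β * M / ε)) := by ring
    linarith
  set F := objective f x₀ - fs with hFdef
  have h8 := mul_lt_mul_of_pos_left h5 (mul_pos hε ht0)
  -- Here 8000 = 8 · 1000: the step inverts at most 1000 (βM/ε + β), and 8F < ε t (R + 1) is what
  -- the other half of ε requires.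
  have h9 := mul_le_mul_of_nonneg_right h7 (show 0 ≤ 8 * F by positivity)
  have h10 : ε * t * (8000 * ((β * M / ε + β) * (F / ε))) =
      1000 * (t * (β * M / ε + β)) * (8 * F) := by field_simp; ring
  have h11 : 56 * β * M * t * (t * (R + 1)) ≤ ε * (t * (R + 1)) :=
    mul_le_mul_of_nonneg_right ht2 (by positivity)
  change ∑ r ∈ Finset.range (R + 1), meanSq P (fun ω => gradient (objective f)
    (run g p K (t / (K * √N)) (√N) (fun r i k => ξ r i k ω)
      (warmStart g p K x₀ (fun i k => ξ 0 i k ω)) r).x) < _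
  change _ ≤ _ + β * (t ^ 2 * (1 / N)) * controlError P p (fun i _ => gradient (f i) x₀) _ - _ + _
    at h1
  rw [h2] at h1
  refine lt_of_mul_lt_mul_left ?_ ht0.le
  linarith

end Complexity

end FedPVR

end

theorem theorem1 :
    ∃ C : ℝ, 0 < C ∧
      ∀ (S Ω : Type*) [MeasurableSpace S] [MeasurableSpace Ω]
        (P : Measure Ω) [IsProbabilityMeasure P]
        (d N K : ℕ) (_hN : 1 ≤ N) (_hK : 1 ≤ K) (p : Finset (Fin d))
        (f : Fin N → FedPVR.Vec d → ℝ)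
        (D : Fin N → Measure S) (g : Fin N → FedPVR.Vec d → S → FedPVR.Vec d)
        (ξ : ℕ → Fin N → ℕ → Ω → S)
        (β σ ε : ℝ) (_hβ : 0 < β) (_hε : 0 < ε) (x₀ : FedPVR.Vec d)
        (_hsmooth : ∀ i, FedPVR.IsSmooth β (f i))
        (_hgrad : ∀ i, FedPVR.IsStochasticGradient (D i) (f i) (g i) σ)
        (_hsamp : FedPVR.IsSampling P D ξ),
        -- strongly convex case, warm-started control variates
        (∀ (μ : ℝ) (xs : FedPVR.Vec d), 0 < μ →
          (∀ i, FedPVR.IsMuConvex μ (f i)) →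
          (∀ x, FedPVR.objective f xs ≤ FedPVR.objective f x) →
          ∃ ηl : ℝ, 0 < ηl ∧
            ηl ≤ min (1 / (80 * K * √N * β)) (26 / (20 * μ * K * √N)) ∧
            ∀ R : ℕ,
              ⌊C * (σ ^ 2 / (μ * N * K * ε) + FedPVR.heterogeneity pᶜ f xs / (μ * ε) + β / μ) *
                Real.log (2 + μ * ‖x₀ - xs‖ ^ 2 / ε)⌋₊ ≤ R →
              FedPVR.ExpectedErrorLT
                (FedPVR.outputLaw P (FedPVR.warmIterate g p K ηl (√N) ξ x₀)
                  (fun r => ((1 - μ * (K * ηl * √N) / 2) ^ (r + 1))⁻¹) R)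
                (fun x => FedPVR.objective f x - FedPVR.objective f xs) ε) ∧
        -- strongly convex case, control variates initialised to zero
        (∀ (μ : ℝ) (xs : FedPVR.Vec d), 0 < μ →
          (∀ i, FedPVR.IsMuConvex μ (f i)) →
          (∀ x, FedPVR.objective f xs ≤ FedPVR.objective f x) →
          ∃ ηl : ℝ, 0 < ηl ∧
            ηl ≤ min (1 / (80 * K * √N * β)) (26 / (20 * μ * K * √N)) ∧
            ∀ R : ℕ,
              ⌊C * (σ ^ 2 / (μ * N * K * ε) + FedPVR.heterogeneity pᶜ f xs / (μ * ε) + β / μ) *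
                Real.log (2 + μ * (‖x₀ - xs‖ ^ 2 +
                  FedPVR.heterogeneity Finset.univ f xs / β ^ 2) / ε)⌋₊ ≤ R →
              FedPVR.ExpectedErrorLT
                (FedPVR.outputLaw P (FedPVR.zeroIterate g p K ηl (√N) ξ x₀)
                  (fun r => ((1 - μ * (K * ηl * √N) / 2) ^ (r + 1))⁻¹) R)
                (fun x => FedPVR.objective f x - FedPVR.objective f xs) ε) ∧
        -- general convex case
        (∀ xs : FedPVR.Vec d,
          (∀ i, FedPVR.IsMuConvex 0 (f i)) →
          (∀ x, FedPVR.objective f xs ≤ FedPVR.objective f x) →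
          ∃ ηl : ℝ, 0 < ηl ∧ ηl ≤ 1 / (80 * K * √N * β) ∧
            ∀ R : ℕ,
              ⌊C * (σ ^ 2 * ‖x₀ - xs‖ ^ 2 / (K * N * ε ^ 2) +
                FedPVR.heterogeneity pᶜ f xs * ‖x₀ - xs‖ ^ 2 / ε ^ 2 +
                β * ‖x₀ - xs‖ ^ 2 / ε +
                (FedPVR.objective f x₀ - FedPVR.objective f xs))⌋₊ ≤ R →
              FedPVR.ExpectedErrorLT
                (FedPVR.outputLaw P (FedPVR.warmIterate g p K ηl (√N) ξ x₀) (fun _ => 1) R)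
                (fun x => FedPVR.objective f x - FedPVR.objective f xs) ε) ∧
        -- non-convex case
        (∀ fs ζ : ℝ,
          IsGLB (Set.range (FedPVR.objective f)) fs →
          (∀ x, FedPVR.heterogeneity pᶜ f x ≤ ζ ^ 2) →
          ∃ ηl : ℝ, 0 < ηl ∧ ηl ≤ 1 / (26 * K * √N * β) ∧
            ∀ R : ℕ,
              ⌊C * (β * σ ^ 2 * (FedPVR.objective f x₀ - fs) / (K * N * ε ^ 2) +
                β * ζ ^ 2 * (FedPVR.objective f x₀ - fs) / (N * ε ^ 2) +
                β * (FedPVR.objective f x₀ - fs) / ε)⌋₊ ≤ R →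
              FedPVR.ExpectedErrorLT
                (FedPVR.outputLaw P (FedPVR.warmIterate g p K ηl (√N) ξ x₀) (fun _ => 1) R)
                (fun x => ‖gradient (FedPVR.objective f) x‖ ^ 2) ε) := by
  refine ⟨8000, by norm_num, ?_⟩
  intro S Ω _ _ P _ d N K hN hK p f D g ξ β σ ε hβ hε x₀ hs hg hξ
  refine ⟨fun μ xs hμ hc hmin => ?_, fun μ xs hμ hc hmin => ?_, fun xs hc hmin => ?_,
    fun fs ζ hfs hζ => ?_⟩
  · exact FedPVR.exists_localStep_of_stronglyConvex hs hg hξ hβ hε hN hK hμ hc hmin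
      (FedPVR.IsState.warmStart hg hξ x₀) (sq_nonneg _)
      fun t ht hβt => FedPVR.warmStart_initial_le hs hg hξ hβ hN hK ht hβt
  · exact FedPVR.exists_localStep_of_stronglyConvex hs hg hξ hβ hε hN hK hμ hc hmin
      (FedPVR.IsState.zeroStart x₀)
      (add_nonneg (sq_nonneg _) (div_nonneg (FedPVR.heterogeneity_nonneg _ _ _) (sq_nonneg _)))
      fun t ht hβt => FedPVR.zeroStart_initial_le hβ hN ht hβt
  · exact FedPVR.exists_localStep_of_convex hs hg hξ hβ hε hN hK hc hmin
  · exact FedPVR.exists_localStep_of_nonconvex hs hg hξ hβ hε hN hK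
      (fun x => hfs.1 ⟨x, rfl⟩) hζ
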